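/- Let $k$ be an algebraically closed field. **Conventions.** Paths are written from left to right, so $\alpha\beta$ means first $\alpha$, then $\beta$. Let $Q$ be a finite, non-empty, connected quiver and $I$ an admissible ideal of $kQ$ (that is, $R^N\subseteq I\subseteq R^2$ for some $N\ge 2$, where $R$ is the ideal generated by the arrows). Then $\Lambda=kQ/I$ is finite dimensional; it is called *special biserial* if (S1) every vertex of $Q$ is the start of at most two arrows and the end of at most two arrows, and (S2) for every arrow $\alpha$ there is at most one arrow $\beta$ with $\alpha\beta\notin I$ and at most one arrow $\gamma$ with $\gamma\alpha\notin I$. A finite-dimensional $k$-algebra $A$ is *symmetric* if $A\cong \operatorname{Hom}_k(A,k)$ as $A$-$A$-bimodules. The algebras isomorphic to $k$ or $k[x]/(x^2)$ are excluded throughout. **Brauer graph algebras.** A *Brauer graph* $\Gamma$ is a finite connected graph (loops and multiple edges allowed), each edge consisting of two germs (half-edges), with a cyclic ordering of the germs attached to each vertex $\nu$ and an integer multiplicity $e(\nu)\ge 1$. The graph with one vertex and no edge, and the graph with a single edge joining two distinct vertices of multiplicity one, are excluded. A germ is *truncated* if it is the only germ at its vertex and this vertex has multiplicity one. The vertices of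 the quiver $Q_\Gamma$ are the edges of $\Gamma$; each non-truncated germ $g$ gives one arrow, from the edge of $g$ to the edge of its successor $g^+$ in the cyclic ordering. Let $C_g$ be the cycle in $Q_\Gamma$ that begins with the arrow of $g$ and goes once around the vertex of $g$, and let $e_g$ be the multiplicity of that vertex. The *Brauer graph algebra* $B_\Gamma=kQ_\Gamma/I_\Gamma$ is defined by the following generators of $I_\Gamma$: (i) $C_g^{e_g}-C_h^{e_h}$ if $g\ne h$ are the two germs of one edge and neither is truncated; (ii) $C_g^{e_g}\alpha$, with $\alpha$ the arrow of $g$, if the other germ of the edge of $g$ is truncated and $g$ is not; (iii) $\alpha\beta$, if $\alpha$ is the arrow of $g$, $\beta$ is the arrow of $h$, and $g^+$ and $h$ are the two different germs of one edge. **The graph $G_\Lambda$.** Let $\Lambda=kQ/I$ be symmetric special biserial. A path $p\notin I$ is *maximal* if $\alpha p\in I$ and $p\alpha\in I$ for all arrows $\alpha$. The *maximal cyclic paths* are the non-trivial maximal paths from a vertex to itself, together with the trivial path at each vertex $i$ for which the projective right module $e_i\Lambda$ is uniserial. If $p$ is non-trivial, write $p=p_0^{e(p)}$ with $p_0$ a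 cycle that is no proper power of a cycle, and let $\mu(p)$ be the sequence of the starting vertices of the arrows of $p_0$; if $p$ is the trivial path at $i$, put $e(p)=1$ and $\mu(p)=(i)$. The vertices of $G_\Lambda$ are the classes $\nu(p)$ of maximal cyclic paths under cyclic rotation, with multiplicity $e(p)$; the germs at $\nu(p)$ are the positions of $\mu(p)$, in their cyclic order, each labelled by the vertex of $Q$ at that position; and the edges are the vertices of $Q$, the edge $i$ consisting of the germs labelled $i$. **Theorem 1.1.** 1. Let $\Lambda=kQ/I$ be a symmetric special biserial algebra as above, not isomorphic to $k$ or $k[x]/(x^2)$. Then $G_\Lambda$ is a (non-excluded) Brauer graph, and the Brauer graph algebra of $G_\Lambda$ is isomorphic to $\Lambda$ as a $k$-algebra. 2. Conversely, for every (non-excluded) Brauer graph $\Gamma$, the quiver $Q_\Gamma$ is finite and connected, the ideal $I_\Gamma$ is admissible and satisfies (S1) and (S2), and $B_\Gamma$ is finite dimensional and symmetric. 3. Hence a $k$-algebra $A$ is isomorphic to a symmetric special biserial algebra $kQ/I$ as above and is not isomorphic to $k$ or $k[x]/(x^2)$ if and only if $A$ is isomorphic to the Brauer graph algebra of a (non-excluded)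 Brauer graph. -/

import Mathlib

universe u v w

open Quiver

namespace SSB

noncomputable section

/-! ## Path algebras -/

/-- All paths of a quiver (the trivial paths included), with their start and end vertices. -/
abbrev TotalPath (V : Type u) [Quiver.{v} V] : Type (max u v) :=
  Σ a : V, Σ b : V, Path a b

/-- The path algebra `kQ`: the vector space with the paths of `Q` as a basis. Paths are written
from left to right: in `p * q` the path `p` is run through first. -/
def PathAlgebra (k : Type w) (V : Type u) [Quiver.{v} V] [Field k] : Type (max u v w) :=
  TotalPath V →₀ k

namespace PathAlgebra

section

variable (k : Type w) {V : Type u} [Quiver.{v} V] [Field k]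

instance : AddCommGroup (PathAlgebra k V) := inferInstanceAs (AddCommGroup (TotalPath V →₀ k))

instance : Module k (PathAlgebra k V) := inferInstanceAs (Module k (TotalPath V →₀ k))

/-- The basis element of `kQ` given by a path. -/
def ofPath {a b : V} (p : Path a b) : PathAlgebra k V := Finsupp.single ⟨a, b, p⟩ 1

open Classical in
/-- The product of two paths: their concatenation if the first one ends where the second one
starts, and zero otherwise. -/
def pathMul (p q : TotalPath V) : PathAlgebra k V :=
  if h : p.2.1 = q.1 then ofPath k (p.2.2.comp (q.2.2.cast h.symm rfl)) else 0

/-- Multiplication of the path algebra, as the bilinear extension of `pathMul`. -/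
def mulLin : PathAlgebra k V →ₗ[k] PathAlgebra k V →ₗ[k] PathAlgebra k V :=
  Finsupp.linearCombination k fun p : TotalPath V =>
    (Finsupp.linearCombination k fun q : TotalPath V => pathMul k p q :
      (TotalPath V →₀ k) →ₗ[k] PathAlgebra k V)

instance : Mul (PathAlgebra k V) := ⟨fun x y => mulLin k x y⟩

/-- The identity element is the sum of the trivial paths. -/
instance [Finite V] : One (PathAlgebra k V) :=
  ⟨∑ a ∈ (Set.finite_univ (α := V)).toFinset, ofPath k (Path.nil : Path a a)⟩

variable {k}

theorem mul_def (x y : PathAlgebra k V) : x * y = mulLin k x y := rfl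

theorem hom_ext {M : Type*} [AddCommMonoid M] [Module k M] {f g : PathAlgebra k V →ₗ[k] M}
    (h : ∀ (a b : V) (p : Path a b), f (ofPath k p) = g (ofPath k p)) : f = g := by
  refine Finsupp.lhom_ext' (M := k) (R := k) fun p => LinearMap.ext_ring ?_
  obtain ⟨a, b, p⟩ := p
  exact h a b p

theorem ofPath_mul_ofPath' {a b c d : V} (p : Path a b) (q : Path c d) :
    ofPath k p * ofPath k q = pathMul k ⟨a, b, p⟩ ⟨c, d, q⟩ := by
  rw [mul_def]
  unfold mulLin
  have h1 := Finsupp.linearCombination_single k (v := fun p : TotalPath V =>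
    (Finsupp.linearCombination k fun q : TotalPath V => pathMul k p q :
      (TotalPath V →₀ k) →ₗ[k] PathAlgebra k V)) 1 ⟨a, b, p⟩
  have h2 := Finsupp.linearCombination_single k
    (v := fun q : TotalPath V => pathMul k ⟨a, b, p⟩ q) 1 ⟨c, d, q⟩
  rw [one_smul] at h1 h2
  exact (congrArg (fun f : (TotalPath V →₀ k) →ₗ[k] PathAlgebra k V =>
    f (ofPath k q)) h1).trans h2

theorem ofPath_mul_ofPath {a b c : V} (p : Path a b) (q : Path b c) :
    ofPath k p * ofPath k q = ofPath k (p.comp q) := by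
  rw [ofPath_mul_ofPath']
  simp [pathMul]

theorem ofPath_mul_ofPath_of_ne {a b c d : V} (p : Path a b) (q : Path c d) (h : b ≠ c) :
    ofPath k p * ofPath k q = 0 := by
  rw [ofPath_mul_ofPath']
  simp [pathMul, h]

theorem zero_mul' (x : PathAlgebra k V) : 0 * x = 0 := by simp [mul_def]

theorem mul_zero' (x : PathAlgebra k V) : x * 0 = 0 := by simp [mul_def]

theorem mul_assoc_ofPath {a b c d e f : V} (p : Path a b) (q : Path c d) (r : Path e f) :
    ofPath k p * ofPath k q * ofPath k r = ofPath k p * (ofPath k q * ofPath k r) := by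
  by_cases h : b = c
  · subst h
    by_cases h' : d = e
    · subst h'
      simp only [ofPath_mul_ofPath, Path.comp_assoc]
    · rw [ofPath_mul_ofPath, ofPath_mul_ofPath_of_ne _ _ h', ofPath_mul_ofPath_of_ne _ _ h',
        mul_zero']
  · by_cases h' : d = e
    · subst h'
      rw [ofPath_mul_ofPath, ofPath_mul_ofPath_of_ne _ _ h, ofPath_mul_ofPath_of_ne _ _ h,
        zero_mul']
    · rw [ofPath_mul_ofPath_of_ne _ _ h, ofPath_mul_ofPath_of_ne _ _ h', zero_mul', mul_zero']

theorem mul_assoc' (x y z : PathAlgebra k V) : x * y * z = x * (y * z) := by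
  have step1 : ∀ (a b : V) (p : Path a b) (c d : V) (q : Path c d) (z : PathAlgebra k V),
      ofPath k p * ofPath k q * z = ofPath k p * (ofPath k q * z) := by
    intro a b p c d q z
    have : mulLin k (ofPath k p * ofPath k q) =
        (mulLin k (ofPath k p)).comp (mulLin k (ofPath k q)) :=
      hom_ext fun e f r => mul_assoc_ofPath p q r
    exact LinearMap.congr_fun this z
  have step2 : ∀ (a b : V) (p : Path a b) (y z : PathAlgebra k V),
      ofPath k p * y * z = ofPath k p * (y * z) := by
    intro a b p y z
    have : ((mulLin k).flip z).comp (mulLin k (ofPath k p)) =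
        (mulLin k (ofPath k p)).comp ((mulLin k).flip z) :=
      hom_ext fun c d q => step1 a b p c d q z
    exact LinearMap.congr_fun this y
  have : ((mulLin k).flip z).comp ((mulLin k).flip y) = (mulLin k).flip (y * z) :=
    hom_ext fun a b p => step2 a b p y z
  exact LinearMap.congr_fun this x

theorem one_def [Finite V] : (1 : PathAlgebra k V) =
    ∑ a ∈ (Set.finite_univ (α := V)).toFinset, ofPath k (Path.nil : Path a a) := rfl

theorem one_mul' [Finite V] (x : PathAlgebra k V) : 1 * x = x := by
  have : mulLin k (1 : PathAlgebra k V) = LinearMap.id := by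
    refine hom_ext fun a b p => ?_
    rw [one_def, map_sum, LinearMap.sum_apply, Finset.sum_eq_single a]
    · exact (ofPath_mul_ofPath _ _).trans (by simp)
    · intro c _ hc
      exact ofPath_mul_ofPath_of_ne _ _ hc
    · simp
  exact LinearMap.congr_fun this x

theorem mul_one' [Finite V] (x : PathAlgebra k V) : x * 1 = x := by
  have : (mulLin k).flip (1 : PathAlgebra k V) = LinearMap.id := by
    refine hom_ext fun a b p => ?_
    rw [LinearMap.flip_apply, one_def, map_sum, Finset.sum_eq_single b]
    · exact (ofPath_mul_ofPath _ _).trans (by simp)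
    · intro c _ hc
      exact ofPath_mul_ofPath_of_ne _ _ hc.symm
    · simp
  exact LinearMap.congr_fun this x

instance [Finite V] : Ring (PathAlgebra k V) where
  toAddCommGroup := inferInstance
  mul := (· * ·)
  one := 1
  left_distrib x y z := (mulLin k x).map_add y z
  right_distrib x y z := LinearMap.map_add₂ (mulLin k) x y z
  zero_mul := zero_mul'
  mul_zero := mul_zero'
  mul_assoc := mul_assoc'
  one_mul := one_mul'
  mul_one := mul_one'

instance [Finite V] : Algebra k (PathAlgebra k V) :=
  Algebra.ofModule (fun c x y => LinearMap.map_smul₂ (mulLin k) c x y)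
    (fun c x y => (mulLin k x).map_smul c y)

end

end PathAlgebra

open PathAlgebra

/-! ## Bound quivers and their algebras -/

section Bound

variable {k : Type w} {V : Type u} [Quiver.{v} V] [Field k] [Finite V]

/-- The bound quiver algebra `kQ/I`. -/
abbrev BoundAlgebra (I : TwoSidedIdeal (PathAlgebra k V)) : Type (max u v w) :=
  I.ringCon.Quotient

/-- The coefficient of the path `p` in `x`. -/
def coeff (x : PathAlgebra k V) {a b : V} (p : Path a b) : k :=
  (show TotalPath V →₀ k from x) ⟨a, b, p⟩

/-- `I` is an admissible ideal: `R ^ N ⊆ I ⊆ R ^ 2` for some `N ≥ 2`, where `R` is the ideal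
generated by the arrows (`R ^ n` is the span of the paths of length at least `n`). -/
def IsAdmissible (I : TwoSidedIdeal (PathAlgebra k V)) : Prop :=
  (∃ N : ℕ, 2 ≤ N ∧ ∀ (a b : V) (p : Path a b), N ≤ p.length → ofPath k p ∈ I) ∧
  ∀ x ∈ I, ∀ (a b : V) (p : Path a b), coeff x p ≠ 0 → 2 ≤ p.length

/-- The conditions (S1) and (S2): every vertex is the start of at most two arrows and the end of at
most two arrows; for every arrow `α` there is at most one arrow `β` with `αβ ∉ I` and at most one
arrow `γ` with `γα ∉ I`. -/
structure IsSpecialBiserial (I : TwoSidedIdeal (PathAlgebra k V)) : Prop where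
  out_le_two : ∀ a : V, Nat.card (Σ b : V, a ⟶ b) ≤ 2
  in_le_two : ∀ a : V, Nat.card (Σ b : V, b ⟶ a) ≤ 2
  right_unique : ∀ (a b : V) (α : a ⟶ b) (β β' : Σ c : V, b ⟶ c),
    ofPath k (α.toPath.comp β.2.toPath) ∉ I → ofPath k (α.toPath.comp β'.2.toPath) ∉ I → β = β'
  left_unique : ∀ (a b : V) (α : a ⟶ b) (γ γ' : Σ c : V, c ⟶ a),
    ofPath k (γ.2.toPath.comp α.toPath) ∉ I → ofPath k (γ'.2.toPath.comp α.toPath) ∉ I → γ = γ'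

end Bound

/-- The `k`-algebra `A` is symmetric: `A` and its dual `D(A) = Hom_k(A, k)` are isomorphic as
`A`-`A`-bimodules, the bimodule structure of `D(A)` being `(a f b)(y) = f (b y a)`. -/
def IsSymmetricAlgebra (k : Type w) (A : Type u) [Field k] [Ring A] [Algebra k A] : Prop :=
  ∃ φ : A ≃ₗ[k] Module.Dual k A, ∀ a x b y : A, φ (a * x * b) y = φ x (b * y * a)

/-- The quiver is finite. -/
def IsFiniteQuiver (V : Type u) [Quiver.{v} V] : Prop :=
  Finite V ∧ ∀ a b : V, Finite (a ⟶ b)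

/-- The quiver is non-empty and its underlying graph is connected. -/
def IsConnectedQuiver (V : Type u) [Quiver.{v} V] : Prop :=
  Nonempty V ∧ ∀ a b : V, Nonempty (@Path (Symmetrify V) _ a b)

/-- `A` is isomorphic to one of the algebras `k` and `k[x]/(x²)`, which are left out when one
speaks of Brauer graph algebras. -/
def IsExcludedAlgebra (k : Type w) (A : Type u) [Field k] [Ring A] [Algebra k A] : Prop :=
  Nonempty (A ≃ₐ[k] k) ∨ Nonempty (A ≃ₐ[k] DualNumber k)

/-! ## Brauer graphs and Brauer graph algebras -/

/-- The data of a graph with local structure. Edges are made of germs (half-edges); `edge g` is the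
edge to which the germ `g` belongs and `vert g` is the vertex to which it is attached; `next` sends
a germ to its direct successor in the cyclic ordering of the germs at the same vertex, and `mult`
is the multiplicity of a vertex. -/
structure LocalGraph where
  Vert : Type v
  Edge : Type u
  Germ : Type v
  finite_edge : Finite Edge
  edge : Germ → Edge
  vert : Germ → Vert
  next : Equiv.Perm Germ
  mult : Vert → ℕ

namespace LocalGraph

variable (Γ : LocalGraph.{u, v})

/-- `Γ` is a Brauer graph: a finite connected graph (loops and multiple edges are allowed) with a
cyclic ordering of the germs at each vertex and positive multiplicities. -/
structure IsBrauerGraph : Prop where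
  finite_germ : Finite Γ.Germ
  finite_vert : Finite Γ.Vert
  /-- every edge consists of exactly two germs -/
  two_germs : ∀ e : Γ.Edge, Nat.card {g : Γ.Germ // Γ.edge g = e} = 2
  /-- the germs at each vertex form one cycle of `next` -/
  cyclic : ∀ g h : Γ.Germ, Γ.vert g = Γ.vert h ↔ Γ.next.SameCycle g h
  mult_pos : ∀ x : Γ.Vert, 0 < Γ.mult x
  nonempty_vert : Nonempty Γ.Vert
  connected : ∀ x y : Γ.Vert, Relation.ReflTransGen
    (fun x y => ∃ g h : Γ.Germ, Γ.edge g = Γ.edge h ∧ Γ.vert g = x ∧ Γ.vert h = y) x y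

/-- The Brauer graphs that are left out: a single vertex without edges, and a single edge that is
not a loop with both vertices of multiplicity one (they stand for the algebras `k` and
`k[x]/(x²)`). -/
def IsExcluded : Prop :=
  IsEmpty Γ.Edge ∨
    (Nat.card Γ.Edge = 1 ∧ Function.Injective Γ.vert ∧ ∀ g : Γ.Germ, Γ.mult (Γ.vert g) = 1)

/-- The germ `g` is the only one at its vertex (a leaf vertex), and this vertex has multiplicity
one. -/
def IsTruncated (g : Γ.Germ) : Prop := Γ.next g = g ∧ Γ.mult (Γ.vert g) = 1

/-- The vertices of the quiver `Q_Γ` are the edges of `Γ`. -/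
def QVert : Type u := Γ.Edge

instance : Finite Γ.QVert := Γ.finite_edge

/-- The arrows of `Q_Γ`: one for every germ that is not truncated, from its edge to the edge of the
next germ. -/
instance : Quiver.{v} Γ.QVert where
  Hom a b := {g : Γ.Germ // Γ.edge g = a ∧ Γ.edge (Γ.next g) = b ∧ ¬ Γ.IsTruncated g}

variable {Γ}

/-- The edge of a germ as a vertex of `Q_Γ`. -/
def qvert (g : Γ.Germ) : Γ.QVert := Γ.edge g

theorem not_isTruncated_pow {g : Γ.Germ} (h : ¬ Γ.IsTruncated g) (n : ℕ) :
    ¬ Γ.IsTruncated ((Γ.next ^ n) g) := by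
  rintro ⟨h1, h2⟩
  have hg : (Γ.next ^ n) (Γ.next g) = (Γ.next ^ n) g := by
    rw [← Equiv.Perm.mul_apply, ← pow_succ, pow_succ', Equiv.Perm.mul_apply, h1]
  have hg' : Γ.next g = g := (Γ.next ^ n).injective hg
  have hn : (Γ.next ^ n) g = g := by
    induction n with
    | zero => rfl
    | succ n ih => exact Equiv.Perm.pow_apply_eq_self_of_apply_eq_self hg' (n + 1)
  exact h ⟨hg', hn ▸ h2⟩

/-- The arrow of `Q_Γ` that starts with the germ `g`. -/
def arrow (g : Γ.Germ) (hg : ¬ Γ.IsTruncated g) : qvert g ⟶ qvert (Γ.next g) :=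
  ⟨g, rfl, rfl, hg⟩

/-- The path in `Q_Γ` that starts with the germ `g` and makes `n` steps around its vertex. -/
def walk (g : Γ.Germ) (hg : ¬ Γ.IsTruncated g) : (n : ℕ) → Path (qvert g) (qvert ((Γ.next ^ n) g))
  | 0 => Path.nil
  | n + 1 => (walk g hg n).cons
      (⟨(Γ.next ^ n) g, rfl, by rw [pow_succ', Equiv.Perm.mul_apply]; rfl,
        not_isTruncated_pow hg n⟩ :
        qvert ((Γ.next ^ n) g) ⟶ qvert ((Γ.next ^ (n + 1)) g))

variable (k : Type w) [Field k]

/-- The cycle `C_g` in `Q_Γ` that starts with the germ `g` and goes once around its vertex. -/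
def cycle (g : Γ.Germ) (hg : ¬ Γ.IsTruncated g) : PathAlgebra k Γ.QVert :=
  ofPath k (walk g hg (Function.minimalPeriod Γ.next g))

/-- The path `C_g ^ e`, where `e` is the multiplicity of the vertex of `g`. -/
def cyclePow (g : Γ.Germ) (hg : ¬ Γ.IsTruncated g) : PathAlgebra k Γ.QVert :=
  cycle k g hg ^ Γ.mult (Γ.vert g)

/-- The relations of the Brauer graph algebra. -/
inductive Rel : PathAlgebra k Γ.QVert → Prop
  /-- the two cycles of an edge none of whose germs is truncated, raised to the multiplicities, are
  equal -/
  | comm (g h : Γ.Germ) (hg : ¬ Γ.IsTruncated g) (hh : ¬ Γ.IsTruncated h) :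
      g ≠ h → Γ.edge g = Γ.edge h → Rel (cyclePow k g hg - cyclePow k h hh)
  /-- if one germ of an edge is truncated, then the cycle of the other germ, raised to the
  multiplicity and followed by its own first arrow, is zero -/
  | leaf (g h : Γ.Germ) (hg : ¬ Γ.IsTruncated g) :
      g ≠ h → Γ.edge g = Γ.edge h → Γ.IsTruncated h →
      Rel (cyclePow k g hg * ofPath k (arrow g hg).toPath)
  /-- a path of two arrows is zero if it passes from one germ of an edge to the other -/
  | zero (g h : Γ.Germ) (hg : ¬ Γ.IsTruncated g) (hh : ¬ Γ.IsTruncated h) :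
      Γ.edge (Γ.next g) = Γ.edge h → Γ.next g ≠ h →
      Rel (ofPath k (arrow g hg).toPath * ofPath k (arrow h hh).toPath)

variable (Γ)

/-- The ideal `I_Γ` generated by the relations. -/
def ideal : TwoSidedIdeal (PathAlgebra k Γ.QVert) := TwoSidedIdeal.span {x | Rel k x}

/-- The Brauer graph algebra `B_Γ = kQ_Γ/I_Γ`. -/
abbrev BrauerGraphAlgebra : Type (max u v w) := BoundAlgebra (Γ.ideal k)

end LocalGraph

/-! ## Cyclic paths and their rotations -/

section Cyclic

variable (V : Type u) [Quiver.{v} V]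

/-- Cyclic paths: the paths from a vertex to itself, the trivial paths included. -/
abbrev CyclicPath : Type (max u v) := Σ a : V, Path a a

variable {V}

/-- Splits off the first arrow of the non-trivial path `p.cons f`. -/
def splitFirst {a : V} : {b c : V} → Path a b → (b ⟶ c) → Σ x : V, (a ⟶ x) × Path x c
  | _, _, Path.nil, f => ⟨_, f, Path.nil⟩
  | _, _, Path.cons p e, f => ⟨_, (splitFirst p e).2.1, (splitFirst p e).2.2.cons f⟩

theorem splitFirst_spec {a b c : V} (p : Path a b) (f : b ⟶ c) :
    (splitFirst p f).2.1.toPath.comp (splitFirst p f).2.2 = p.cons f := by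
  induction p generalizing c with
  | nil => rfl
  | cons p e ih => simp only [splitFirst, Path.comp_cons, ih]

/-- The rotation `α₁ α₂ ⋯ αₙ ↦ α₂ ⋯ αₙ α₁` of a cyclic path; trivial paths are fixed. -/
def rotateFun : CyclicPath V → CyclicPath V
  | ⟨a, Path.nil⟩ => ⟨a, Path.nil⟩
  | ⟨_, Path.cons p e⟩ => ⟨_, (splitFirst p e).2.2.cons (splitFirst p e).2.1⟩

/-- The inverse rotation `α₁ ⋯ αₙ₋₁ αₙ ↦ αₙ α₁ ⋯ αₙ₋₁`. -/
def unrotateFun : CyclicPath V → CyclicPath V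
  | ⟨a, Path.nil⟩ => ⟨a, Path.nil⟩
  | ⟨_, Path.cons p e⟩ => ⟨_, e.toPath.comp p⟩

theorem unrotate_rotate (p : CyclicPath V) : unrotateFun (rotateFun p) = p := by
  obtain ⟨a, p⟩ := p
  cases p with
  | nil => rfl
  | cons p e => simp only [rotateFun, unrotateFun, splitFirst_spec]

theorem rotateFun_comp {a b : V} (e : a ⟶ b) (p : Path b a) :
    rotateFun ⟨a, e.toPath.comp p⟩ = ⟨b, p.cons e⟩ := by
  have key : ∀ {c d : V} (q : Path b c) (f : c ⟶ d),
      splitFirst (e.toPath.comp q) f = ⟨b, e, q.cons f⟩ := by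
    intro c d q
    induction q generalizing d with
    | nil => intro f; rfl
    | cons q g ih =>
      intro f
      rw [Path.comp_cons, splitFirst, ih]
  cases p with
  | nil => rfl
  | cons p f =>
    rw [Path.comp_cons, rotateFun, key]

theorem rotate_unrotate (p : CyclicPath V) : rotateFun (unrotateFun p) = p := by
  obtain ⟨a, p⟩ := p
  cases p with
  | nil => rfl
  | cons p e => exact rotateFun_comp e p

variable (V) in
/-- Rotation by one arrow, as a permutation of the cyclic paths. Two cyclic paths are cyclic
rotations of each other if and only if they lie in the same cycle of this permutation. -/
def rotate : Equiv.Perm (CyclicPath V) where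
  toFun := rotateFun
  invFun := unrotateFun
  left_inv := unrotate_rotate
  right_inv := rotate_unrotate

/-- The `m`-th power of a cyclic path at a vertex. -/
def pathPow {a : V} (c : Path a a) : ℕ → Path a a
  | 0 => Path.nil
  | m + 1 => (pathPow c m).comp c

/-- The `m`-th power of a cyclic path. -/
def cyclicPow (c : CyclicPath V) (m : ℕ) : CyclicPath V := ⟨c.1, pathPow c.2 m⟩

/-- A simple cycle: a non-trivial cyclic path which is no proper power of a cyclic path. -/
def IsSimpleCycle (c : CyclicPath V) : Prop :=
  0 < c.2.length ∧ ∀ (d : CyclicPath V) (m : ℕ), c = cyclicPow d m → m = 1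

open Classical in
/-- The multiplicity `e(p)` of a cyclic path `p`: the number `m` for which `p = c ^ m` with a simple
cycle `c` if `p` is not trivial, and `1` if `p` is trivial. -/
def multiplicity (p : CyclicPath V) : ℕ :=
  if p.2.length = 0 then 1 else sSup {m | ∃ c : CyclicPath V, IsSimpleCycle c ∧ p = cyclicPow c m}

theorem comp_pathPow {a : V} (c : Path a a) (m : ℕ) :
    c.comp (pathPow c m) = (pathPow c m).comp c := by
  induction m with
  | zero => simp [pathPow]
  | succ m ih => rw [pathPow, ← Path.comp_assoc, ih]

theorem pathPow_comp_shift {a b : V} (e : a ⟶ b) (q : Path b a) (m : ℕ) :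
    (pathPow (e.toPath.comp q) m).comp e.toPath =
      e.toPath.comp (pathPow (q.comp e.toPath) m) := by
  induction m with
  | zero => rw [pathPow, pathPow, Path.nil_comp, Path.comp_nil]
  | succ m ih =>
    have : (pathPow (e.toPath.comp q) (m + 1)).comp e.toPath =
        ((pathPow (e.toPath.comp q) m).comp e.toPath).comp (q.comp e.toPath) := by
      rw [pathPow, Path.comp_assoc, Path.comp_assoc, Path.comp_assoc]
    rw [this, ih, Path.comp_assoc, pathPow]

theorem length_rotate (p : CyclicPath V) : (rotate V p).2.length = p.2.length := by
  obtain ⟨a, p⟩ := p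
  by_cases hp : p.length = 0
  · obtain rfl := Path.eq_nil_of_length_zero p hp
    rfl
  · obtain ⟨b, e, q, rfl, -⟩ := (Path.length_ne_zero_iff_eq_comp p).1 hp
    have h1 : rotate V ⟨a, e.toPath.comp q⟩ = ⟨b, q.cons e⟩ := rotateFun_comp e q
    rw [h1]
    simp [add_comm]

theorem rotate_cyclicPow (c : CyclicPath V) (m : ℕ) (hm : m ≠ 0) :
    rotate V (cyclicPow c m) = cyclicPow (rotate V c) m := by
  obtain ⟨m, rfl⟩ := Nat.exists_eq_succ_of_ne_zero hm
  obtain ⟨a, c⟩ := c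
  by_cases hc : c.length = 0
  · obtain rfl := Path.eq_nil_of_length_zero c hc
    have h0 : ∀ m, pathPow (Path.nil : Path a a) m = Path.nil := by
      intro m
      induction m with
      | zero => rfl
      | succ m ih => rw [pathPow, ih, Path.comp_nil]
    have h1 : rotate V ⟨a, Path.nil⟩ = ⟨a, Path.nil⟩ := rfl
    rw [h1, cyclicPow, h0, h1]
  · obtain ⟨b, e, q, rfl, -⟩ := (Path.length_ne_zero_iff_eq_comp c).1 hc
    have h1 : ∀ q : Path b a, rotate V ⟨a, e.toPath.comp q⟩ = ⟨b, q.comp e.toPath⟩ :=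
      fun q => rotateFun_comp e q
    have h2 : pathPow (e.toPath.comp q) (m + 1) =
        e.toPath.comp (q.comp (pathPow (e.toPath.comp q) m)) := by
      rw [pathPow, ← comp_pathPow, Path.comp_assoc]
    have h3 : pathPow (q.comp e.toPath) (m + 1) =
        (q.comp (pathPow (e.toPath.comp q) m)).comp e.toPath := by
      rw [pathPow, ← comp_pathPow, Path.comp_assoc, Path.comp_assoc, pathPow_comp_shift]
    rw [h1, cyclicPow, cyclicPow, Nat.succ_eq_add_one, h2, h3, h1]

theorem isSimpleCycle_rotate (c : CyclicPath V) : IsSimpleCycle (rotate V c) ↔ IsSimpleCycle c := by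
  have ne_zero : ∀ (p d : CyclicPath V) (m : ℕ), 0 < p.2.length → p = cyclicPow d m → m ≠ 0 := by
    rintro p d m hp rfl rfl
    exact absurd hp (lt_irrefl _)
  unfold IsSimpleCycle
  rw [length_rotate]
  refine and_congr_right fun hc => ⟨fun h d m hd => ?_, fun h d m hd => ?_⟩
  · refine h (rotate V d) m ?_
    rw [hd, rotate_cyclicPow d m (ne_zero c d m hc hd)]
  · have hm := ne_zero _ d m (by rwa [length_rotate]) hd
    obtain ⟨d, rfl⟩ := (rotate V).surjective d
    rw [← rotate_cyclicPow d m hm] at hd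
    exact h d m ((rotate V).injective hd)

/-- The multiplicity is invariant under rotation. -/
theorem multiplicity_rotate (p : CyclicPath V) : multiplicity (rotate V p) = multiplicity p := by
  unfold multiplicity
  rw [length_rotate]
  split_ifs with hp
  · rfl
  · have ne_zero : ∀ (p d : CyclicPath V) (m : ℕ), p.2.length ≠ 0 → p = cyclicPow d m → m ≠ 0 := by
      rintro p d m hp rfl rfl
      exact hp rfl
    congr 1
    ext m
    constructor
    · rintro ⟨c, hc, h⟩
      have hm := ne_zero _ c m (by rwa [length_rotate]) h
      obtain ⟨c, rfl⟩ := (rotate V).surjective c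
      rw [← rotate_cyclicPow c m hm] at h
      exact ⟨c, (isSimpleCycle_rotate c).1 hc, (rotate V).injective h⟩
    · rintro ⟨c, hc, h⟩
      refine ⟨rotate V c, (isSimpleCycle_rotate c).2 hc, ?_⟩
      rw [h, rotate_cyclicPow c m (ne_zero p c m hp h)]

theorem multiplicity_eq_of_sameCycle {p q : CyclicPath V} (h : (rotate V).SameCycle p q) :
    multiplicity p = multiplicity q := by
  obtain ⟨n, rfl⟩ := h
  induction n with
  | zero => rfl
  | succ n ih =>
    rw [ih, add_comm, zpow_add, zpow_one, Equiv.Perm.mul_apply, multiplicity_rotate]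
  | pred n ih =>
    rw [ih, ← multiplicity_rotate (((rotate V) ^ (-(n : ℤ) - 1)) p), ← Equiv.Perm.mul_apply,
      ← zpow_one_add, add_sub_cancel]

end Cyclic

/-! ## The graph of a symmetric special biserial algebra -/

section Graph

variable {k : Type w} {V : Type u} [Quiver.{v} V] [Field k] [Finite V]

/-- A module is uniserial if its submodules form a chain. -/
def IsUniserial (R : Type u) (M : Type v) [Ring R] [AddCommGroup M] [Module R M] : Prop :=
  ∀ N N' : Submodule R M, N ≤ N' ∨ N' ≤ N

/-- The residue class of a path in `kQ/I`. -/
def pathClass (I : TwoSidedIdeal (PathAlgebra k V)) {a b : V} (p : Path a b) : BoundAlgebra I :=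
  (ofPath k p : PathAlgebra k V)

/-- The projective right module `P_a = e_a Λ` over `Λ = kQ/I` at the vertex `a`. -/
abbrev projectiveAt (I : TwoSidedIdeal (PathAlgebra k V)) (a : V) :
    Submodule (BoundAlgebra I)ᵐᵒᵖ (BoundAlgebra I) :=
  Submodule.span (BoundAlgebra I)ᵐᵒᵖ {pathClass I (Path.nil : Path a a)}

/-- The path `p` is maximal in `(Q, I)`: it does not lie in `I`, but `αp` and `pα` lie in `I` for all
arrows `α`. -/
def IsMaximalPath (I : TwoSidedIdeal (PathAlgebra k V)) {a b : V} (p : Path a b) : Prop :=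
  ofPath k p ∉ I ∧ (∀ (c : V) (α : c ⟶ a), ofPath k (α.toPath.comp p) ∈ I) ∧
    ∀ (c : V) (α : b ⟶ c), ofPath k (p.comp α.toPath) ∈ I

/-- Maximal cyclic paths: the non-trivial maximal paths from a vertex to itself, and the trivial
paths at those vertices `a` for which `P_a` is uniserial. -/
def IsMaximalCyclicPath (I : TwoSidedIdeal (PathAlgebra k V)) (p : CyclicPath V) : Prop :=
  (0 < p.2.length ∧ IsMaximalPath I p.2) ∨
    (p.2.length = 0 ∧ IsUniserial (BoundAlgebra I)ᵐᵒᵖ (projectiveAt I p.1))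

/-- The cyclic rotations of maximal cyclic paths. -/
def IsGerm (I : TwoSidedIdeal (PathAlgebra k V)) (p : CyclicPath V) : Prop :=
  ∃ q : CyclicPath V, IsMaximalCyclicPath I q ∧ (rotate V).SameCycle q p

theorem isGerm_rotate (I : TwoSidedIdeal (PathAlgebra k V)) (p : CyclicPath V) :
    IsGerm I (rotate V p) ↔ IsGerm I p := by
  simp only [IsGerm, Equiv.Perm.sameCycle_apply_right]

/-- The permutation of the rotations of the maximal cyclic paths that is given by rotation by one
arrow. -/
def rotateGerm (I : TwoSidedIdeal (PathAlgebra k V)) : Equiv.Perm {p : CyclicPath V // IsGerm I p} :=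
  (rotate V).subtypePerm (isGerm_rotate I)

/-- The graph with local structure `G_Λ` of `Λ = kQ/I`.

Its vertices are the classes `ν(p)` of maximal cyclic paths `p` under cyclic rotation, the
multiplicity of `ν(p)` is `e(p)`, and its edges are the vertices of `Q`. The germs attached to `ν(p)`,
where `p = c ^ e(p)` with a simple cycle `c`, correspond to the positions in the sequence `μ(p)` of
the vertices at which the arrows of `c` start. As `c` is simple, different positions give different
rotations of `p`, and all rotations of `p` are obtained in this way: hence a germ is encoded by the
rotation of `p` that starts at its position. It is labelled by (and so belongs to the edge given by)
the vertex of `Q` at which this rotation starts, and the next germ in the cyclic order, the one at the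
next position, is given by rotation by one arrow. -/
def graph (I : TwoSidedIdeal (PathAlgebra k V)) : LocalGraph.{u, max u v} where
  Vert := Quotient (Equiv.Perm.SameCycle.setoid (rotateGerm I))
  Edge := V
  Germ := {p : CyclicPath V // IsGerm I p}
  finite_edge := inferInstance
  edge p := p.1.1
  vert p := Quotient.mk _ p
  next := rotateGerm I
  mult := Quotient.lift (fun p => multiplicity p.1) fun _ _ h =>
    multiplicity_eq_of_sameCycle (Equiv.Perm.sameCycle_subtypePerm.1 h)

end Graph

/-! ## The two classes of algebras -/

/-- `A` is a symmetric special biserial algebra: up to isomorphism `A = kQ/I` for a finite connected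
quiver `Q` and an admissible ideal `I` with (S1) and (S2), and `A` is symmetric. -/
def IsSymmetricSpecialBiserialAlgebra (k : Type w) (A : Type v) [Field k] [Ring A] [Algebra k A] :
    Prop :=
  ∃ (V : Type u) (_ : Quiver.{u} V) (hV : IsFiniteQuiver V),
    haveI : Finite V := hV.1
    IsConnectedQuiver V ∧ ∃ I : TwoSidedIdeal (PathAlgebra k V),
      IsAdmissible I ∧ IsSpecialBiserial I ∧ IsSymmetricAlgebra k A ∧
        Nonempty (A ≃ₐ[k] BoundAlgebra I)

/-- `A` is a Brauer graph algebra: up to isomorphism `A = B_Γ` for a Brauer graph `Γ` (which is not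
one of the two graphs left out). -/
def IsBrauerGraphAlgebra (k : Type w) (A : Type v) [Field k] [Ring A] [Algebra k A] : Prop :=
  ∃ Γ : LocalGraph.{u, u}, Γ.IsBrauerGraph ∧ ¬ Γ.IsExcluded ∧
    Nonempty (A ≃ₐ[k] Γ.BrauerGraphAlgebra k)

end

end SSB

namespace SSB

noncomputable section

open PathAlgebra

/-! ## Bound quiver algebras -/

section Bound

variable {k : Type w} {V : Type u} [Quiver.{v} V] [Field k] [Finite V]

/-! Both directions rest on a symmetrizing form: a linear form `f` with `f (x * y) = f (y * x)`
whose kernel contains no non-zero right ideal. For finite-dimensional algebras such a form is the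
same as a bimodule isomorphism with the dual.

From graphs to algebras. The relations kill every path that is not a walk around one vertex of
length at most that of `C_g ^ e` (`ofPath_mem_or`), which gives finite dimension and one half of
admissibility. The form takes the value one on the paths `C_g ^ e` and zero on all other paths. It
is symmetric because rotating such a path gives another one, and it vanishes on the ideal because it
vanishes on every relation multiplied by paths on both sides. Non-degeneracy is `exists_mul_mul_eq`:
the shortest term of an element that is not yet a socle element is completed to `C_g ^ e`, and this
completion kills all other terms.

From algebras to graphs. Given `f` on `kQ/I`, a path that cannot be prolonged to the right has
non-zero `f`. Hence it is a cycle, it is maximal on both sides, and all its rotations are maximal as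
well. By (S2) the non-zero paths with a given first arrow form a chain, so every arrow starts
exactly one maximal cycle. The projective module at a vertex is uniserial exactly if only one arrow
starts there, and then the trivial path supplies the second germ of the edge; otherwise the two
arrows supply both germs. The period of a maximal cycle under rotation times its multiplicity is its
length, so the path `C_g ^ e` of the graph corresponds to the maximal cycle itself.

Two maximal cycles at one vertex of `Q` agree in `kQ/I` only up to a scalar. Since `k` is
algebraically closed, each arrow can be multiplied by an `n`-th root of `f(p)⁻¹`, where `p` is its
maximal cycle and `n` the length of `p`; after this the relations of the Brauer graph algebra hold.
The resulting homomorphism is surjective because the scalars are not zero. It is injective because,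
by `exists_mul_mul_eq`, a non-zero kernel would contain some `C_g ^ e`, whose image is not zero. The
algebras `k` and `k[x]/(x²)` are exactly what is met when a vertex has no arrow or a maximal cycle
has length one. -/

/-- The projection `kQ → kQ/I`. -/
def quotMap (I : TwoSidedIdeal (PathAlgebra k V)) : PathAlgebra k V →ₐ[k] BoundAlgebra I :=
  { I.ringCon.mk' with commutes' := fun _ => rfl }

variable (I : TwoSidedIdeal (PathAlgebra k V))

variable {I} in
theorem quotMap_eq_zero {x : PathAlgebra k V} : quotMap I x = 0 ↔ x ∈ I := by
  have h : quotMap I x = 0 ↔ I.ringCon x 0 := RingCon.eq _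
  rw [h, TwoSidedIdeal.rel_iff, sub_zero]

theorem quotMap_surjective : Function.Surjective (quotMap I) := I.ringCon.mk'_surjective

variable {I}

theorem pathClass_eq_zero {a b : V} {p : Path a b} : pathClass I p = 0 ↔ ofPath k p ∈ I :=
  quotMap_eq_zero

theorem quotMap_ofPath {a b : V} (p : Path a b) : quotMap I (ofPath k p) = pathClass I p := rfl

theorem pathClass_comp {a b c : V} (p : Path a b) (q : Path b c) :
    pathClass I (p.comp q) = pathClass I p * pathClass I q := by
  rw [← quotMap_ofPath, ← ofPath_mul_ofPath, map_mul]; rfl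

theorem pathClass_mul_of_ne {a b c d : V} (p : Path a b) (q : Path c d) (h : b ≠ c) :
    pathClass I p * pathClass I q = 0 := by
  rw [← quotMap_ofPath, ← quotMap_ofPath, ← map_mul, ofPath_mul_ofPath_of_ne _ _ h, map_zero]

theorem pathClass_nil_mul {a b : V} (p : Path a b) :
    pathClass I (Path.nil : Path a a) * pathClass I p = pathClass I p := by
  rw [← pathClass_comp, Path.nil_comp]

theorem pathClass_mul_nil {a b : V} (p : Path a b) :
    pathClass I p * pathClass I (Path.nil : Path b b) = pathClass I p := by
  rw [← pathClass_comp, Path.comp_nil]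

theorem eq_sum_ofPath (x : PathAlgebra k V) :
    x = Finsupp.sum (show TotalPath V →₀ k from x) fun p c => c • ofPath k p.2.2 := by
  have h : ∀ (p : TotalPath V) (c : k), c • ofPath k p.2.2 =
      (show PathAlgebra k V from Finsupp.single p c) := by
    intro p c
    exact (Finsupp.smul_single c p (1 : k)).trans (by rw [smul_eq_mul, mul_one])
  simp only [h]
  exact (Finsupp.sum_single (show TotalPath V →₀ k from x)).symm

theorem quotMap_eq_sum (x : PathAlgebra k V) :
    quotMap I x = Finsupp.sum (show TotalPath V →₀ k from x) fun p c => c • pathClass I p.2.2 := by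
  conv_lhs => rw [eq_sum_ofPath x]
  rw [Finsupp.sum, map_sum]
  exact Finset.sum_congr rfl fun p _ => by rw [map_smul, quotMap_ofPath]

theorem span_pathClass :
    Submodule.span k (Set.range fun p : TotalPath V => pathClass I p.2.2) = ⊤ := by
  refine eq_top_iff.2 fun x _ => ?_
  obtain ⟨x, rfl⟩ := quotMap_surjective I x
  rw [quotMap_eq_sum]
  exact Submodule.sum_mem _ fun p _ => Submodule.smul_mem _ _ (Submodule.subset_span ⟨p, rfl⟩)

theorem one_eq_sum_pathClass : (1 : BoundAlgebra I) =
    ∑ a ∈ (Set.finite_univ (α := V)).toFinset, pathClass I (Path.nil : Path a a) := by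
  rw [← map_one (quotMap I), PathAlgebra.one_def, map_sum]
  rfl

theorem linearMap_ext_pathClass {M : Type*} [AddCommMonoid M] [Module k M]
    {f g : BoundAlgebra I →ₗ[k] M}
    (h : ∀ (a b : V) (p : Path a b), f (pathClass I p) = g (pathClass I p)) : f = g :=
  LinearMap.ext_on_range span_pathClass fun p => h _ _ p.2.2

theorem coeff_add (x y : PathAlgebra k V) {a b : V} (p : Path a b) :
    coeff (x + y) p = coeff x p + coeff y p := rfl

theorem coeff_sub (x y : PathAlgebra k V) {a b : V} (p : Path a b) :
    coeff (x - y) p = coeff x p - coeff y p := rfl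

theorem coeff_smul (c : k) (x : PathAlgebra k V) {a b : V} (p : Path a b) :
    coeff (c • x) p = c * coeff x p := rfl

theorem coeff_zero {a b : V} (p : Path a b) : coeff (0 : PathAlgebra k V) p = 0 := rfl

omit [Finite V] in
theorem coeff_ofPath_self {a b : V} (p : Path a b) : coeff (ofPath k p) p = 1 :=
  Finsupp.single_eq_same

omit [Finite V] in
theorem coeff_ofPath_of_ne {a b c d : V} {p : Path a b} {q : Path c d}
    (h : (⟨c, d, q⟩ : TotalPath V) ≠ ⟨a, b, p⟩) : coeff (ofPath k q) p = 0 :=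
  Finsupp.single_eq_of_ne' h

omit [Finite V] in
theorem coeff_ofPath_of_length_ne {a b c d : V} {p : Path a b} {q : Path c d}
    (h : q.length ≠ p.length) : coeff (ofPath k q) p = 0 := by
  refine coeff_ofPath_of_ne fun h' => h ?_
  have := congrArg (fun r : TotalPath V => r.2.2.length) h'
  exact this

/-- Evaluation at a path, as a linear form. -/
def coeffLin {a b : V} (p : Path a b) : PathAlgebra k V →ₗ[k] k where
  toFun x := coeff x p
  map_add' x y := coeff_add x y p
  map_smul' c x := coeff_smul c x p

theorem coeffLin_apply {a b : V} (p : Path a b) (x : PathAlgebra k V) :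
    coeffLin p x = coeff x p := rfl

/-- The standard way to see that an element survives in the quotient: an admissible ideal lies in `R
^ 2`, so trivial paths and arrows remain linearly independent modulo it. -/
theorem length_one_notMem (hI : IsAdmissible I) {x : PathAlgebra k V} {a b : V} {p : Path a b}
    (hp : p.length < 2) (hx : coeff x p ≠ 0) : x ∉ I :=
  fun h => absurd (hI.2 x h a b p hx) (by omega)

theorem ofPath_notMem (hI : IsAdmissible I) {a b : V} {p : Path a b}
    (hp : p.length < 2) : ofPath k p ∉ I :=
  length_one_notMem hI hp (by rw [coeff_ofPath_self]; exact one_ne_zero)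

theorem ofPath_comp_mem_left {a b c : V} {p : Path a b} (hp : ofPath k p ∈ I) (q : Path b c) :
    ofPath k (p.comp q) ∈ I := by
  rw [← ofPath_mul_ofPath]; exact I.mul_mem_right _ _ hp

theorem ofPath_comp_mem_right {a b c : V} (p : Path a b) {q : Path b c} (hq : ofPath k q ∈ I) :
    ofPath k (p.comp q) ∈ I := by
  rw [← ofPath_mul_ofPath]; exact I.mul_mem_left _ _ hq

end Bound

/-! ## The universal property of the path algebra -/

section Lift

variable {k : Type w} {V : Type u} [Quiver.{v} V] [Field k]
variable {A : Type*} [Ring A] [Algebra k A]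

/-- The value of a path in an algebra, when the trivial paths and the arrows are given values. -/
def pathValue (e : V → A) (s : ∀ a b : V, (a ⟶ b) → A) {a : V} : {b : V} → Path a b → A
  | _, Path.nil => e a
  | _, Path.cons p f => pathValue e s p * s _ _ f

variable {e : V → A} {s : ∀ a b : V, (a ⟶ b) → A}

theorem pathValue_mul_right (he : ∀ a, e a * e a = e a) (hr : ∀ a b f, s a b f * e b = s a b f)
    {a b : V} (p : Path a b) : pathValue e s p * e b = pathValue e s p := by
  cases p with
  | nil => exact he a
  | cons p f => rw [pathValue, mul_assoc, hr]

theorem mul_pathValue_left (he : ∀ a, e a * e a = e a) {a b : V} (p : Path a b) :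
    e a * pathValue e s p = pathValue e s p := by
  induction p with
  | nil => exact he a
  | cons p f ih => rw [pathValue, ← mul_assoc, ih]

theorem pathValue_comp (he : ∀ a, e a * e a = e a) (hr : ∀ a b f, s a b f * e b = s a b f)
    {a b c : V} (p : Path a b) (q : Path b c) :
    pathValue e s (p.comp q) = pathValue e s p * pathValue e s q := by
  induction q with
  | nil => rw [Path.comp_nil, pathValue, pathValue_mul_right he hr]
  | cons q f ih => rw [Path.comp_cons, pathValue, pathValue, ih, mul_assoc]

variable [Finite V]

/-- The homomorphism on the path algebra given by the values of the trivial paths and the arrows. -/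
def pathLift (e : V → A) (s : ∀ a b : V, (a ⟶ b) → A) (he : ∀ a, e a * e a = e a)
    (horth : ∀ a b, a ≠ b → e a * e b = 0)
    (hsum : ∑ a ∈ (Set.finite_univ (α := V)).toFinset, e a = 1)
    (hr : ∀ a b f, s a b f * e b = s a b f) :
    PathAlgebra k V →ₐ[k] A :=
  let L : PathAlgebra k V →ₗ[k] A :=
    (Finsupp.linearCombination k fun p : TotalPath V => pathValue e s p.2.2 :
      (TotalPath V →₀ k) →ₗ[k] A)
  have hL : ∀ {a b : V} (p : Path a b), L (ofPath k p) = pathValue e s p := fun p =>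
    (Finsupp.linearCombination_single k _ _).trans (one_smul _ _)
  AlgHom.ofLinearMap L
    (by
      rw [PathAlgebra.one_def, map_sum, ← hsum]
      exact Finset.sum_congr rfl fun a _ => hL _)
    (by
      intro x y
      have h : (LinearMap.mul k (PathAlgebra k V)).compr₂ L = (LinearMap.mul k A).compl₁₂ L L := by
        refine PathAlgebra.hom_ext fun a b p => PathAlgebra.hom_ext fun c d q => ?_
        change L (ofPath k p * ofPath k q) = L (ofPath k p) * L (ofPath k q)
        rw [hL, hL]
        by_cases h : b = c
        · subst h
          rw [ofPath_mul_ofPath, hL, pathValue_comp he hr]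
        · rw [ofPath_mul_ofPath_of_ne _ _ h, map_zero, ← pathValue_mul_right he hr p,
            ← mul_pathValue_left he q, mul_assoc, ← mul_assoc (e b), horth _ _ h, zero_mul,
            mul_zero]
      exact LinearMap.congr_fun (LinearMap.congr_fun h x) y)

theorem pathLift_ofPath (he : ∀ a, e a * e a = e a)
    (horth : ∀ a b, a ≠ b → e a * e b = 0)
    (hsum : ∑ a ∈ (Set.finite_univ (α := V)).toFinset, e a = 1)
    (hr : ∀ a b f, s a b f * e b = s a b f) {a b : V} (p : Path a b) :
    pathLift (k := k) e s he horth hsum hr (ofPath k p) = pathValue e s p :=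
  (Finsupp.linearCombination_single k _ _).trans (one_smul _ _)

variable {I : TwoSidedIdeal (PathAlgebra k V)}

/-- A homomorphism on `kQ` that vanishes on `I` induces a homomorphism on `kQ/I`. -/
def quotLift (φ : PathAlgebra k V →ₐ[k] A) (h : ∀ x ∈ I, φ x = 0) : BoundAlgebra I →ₐ[k] A :=
  { I.ringCon.lift φ.toRingHom (fun x y hxy => by
      rw [TwoSidedIdeal.rel_iff] at hxy
      have := h _ hxy
      rw [map_sub, sub_eq_zero] at this
      exact this) with
    commutes' := fun c => φ.commutes c }

theorem quotLift_quotMap (φ : PathAlgebra k V →ₐ[k] A) (h : ∀ x ∈ I, φ x = 0)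
    (x : PathAlgebra k V) : quotLift φ h (quotMap I x) = φ x := rfl

/-- A linear map on `kQ` that vanishes on `I` induces a linear map on `kQ/I`. -/
def quotLiftLin {M : Type*} [AddCommGroup M] [Module k M] (φ : PathAlgebra k V →ₗ[k] M)
    (h : ∀ x ∈ I, φ x = 0) : BoundAlgebra I →ₗ[k] M where
  toFun x := Quotient.liftOn' x φ fun x y hxy => by
    have hxy : I.ringCon x y := hxy
    rw [TwoSidedIdeal.rel_iff] at hxy
    have := h _ hxy
    rwa [map_sub, sub_eq_zero] at this
  map_add' x y := by
    obtain ⟨x, rfl⟩ := quotMap_surjective I x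
    obtain ⟨y, rfl⟩ := quotMap_surjective I y
    exact map_add φ x y
  map_smul' c x := by
    obtain ⟨x, rfl⟩ := quotMap_surjective I x
    exact map_smul φ c x

end Lift

/-! ## Symmetric algebras -/

section Symmetric

variable {k : Type w} [Field k] {A : Type u} [Ring A] [Algebra k A]

/-- The form is the image of `1` under the bimodule isomorphism; bilinearity gives both `φ x y = φ 1
(x * y)` and `φ x y = φ 1 (y * x)`. -/
theorem IsSymmetricAlgebra.exists_form (h : IsSymmetricAlgebra k A) :
    ∃ f : A →ₗ[k] k, (∀ x y, f (x * y) = f (y * x)) ∧ ∀ x, (∀ y, f (x * y) = 0) → x = 0 := by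
  obtain ⟨φ, hφ⟩ := h
  have h1 : ∀ x y, φ x y = φ 1 (x * y) := fun x y => by
    have := hφ 1 1 x y
    rwa [one_mul, one_mul, mul_one] at this
  have h2 : ∀ x y, φ x y = φ 1 (y * x) := fun x y => by
    have := hφ x 1 1 y
    rwa [mul_one, mul_one, one_mul] at this
  refine ⟨φ 1, fun x y => (h1 x y).symm.trans (h2 x y), fun x hx => ?_⟩
  refine φ.map_eq_zero_iff.1 (LinearMap.ext fun y => ?_)
  rw [h1, hx]; rfl

/-- Non-degeneracy makes `x ↦ f (x * ·)` injective, and a space and its dual have equal finite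
dimension. -/
theorem isSymmetricAlgebra_of_form [Module.Finite k A] (f : A →ₗ[k] k)
    (hf : ∀ x y, f (x * y) = f (y * x)) (hn : ∀ x, (∀ y, f (x * y) = 0) → x = 0) :
    IsSymmetricAlgebra k A := by
  let φ : A →ₗ[k] Module.Dual k A := (LinearMap.mul k A).compr₂ f
  have hφ : ∀ x y, φ x y = f (x * y) := fun _ _ => rfl
  have hinj : Function.Injective φ := by
    refine (injective_iff_map_eq_zero φ).2 fun x hx => hn x fun y => ?_
    rw [← hφ, hx]; rfl
  refine ⟨LinearEquiv.ofInjectiveOfFinrankEq φ hinj Subspace.dual_finrank_eq.symm,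
    fun a x b y => ?_⟩
  change φ (a * x * b) y = φ x (b * y * a)
  rw [hφ, hφ, mul_assoc, mul_assoc, hf]
  simp only [mul_assoc]

theorem IsSymmetricAlgebra.of_algEquiv {B : Type v} [Ring B] [Algebra k B] (e : A ≃ₐ[k] B)
    (h : IsSymmetricAlgebra k A) : IsSymmetricAlgebra k B := by
  obtain ⟨φ, hφ⟩ := h
  refine ⟨(e.symm.toLinearEquiv.trans φ).trans e.symm.toLinearEquiv.dualMap, fun a x b y => ?_⟩
  change φ (e.symm (a * x * b)) (e.symm y) = φ (e.symm x) (e.symm (b * y * a))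
  rw [map_mul e.symm, map_mul e.symm, hφ, map_mul e.symm, map_mul e.symm]

end Symmetric

/-! ## Walks in the quiver of a Brauer graph -/

namespace LocalGraph

variable {Γ : LocalGraph.{u, v}} (k : Type w) [Field k]

/-- The arrow of a germ as an element of the path algebra. -/
def arrowElt (g : Γ.Germ) (hg : ¬ Γ.IsTruncated g) : PathAlgebra k Γ.QVert :=
  ofPath k (arrow g hg).toPath

/-- A walk around a vertex as an element of the path algebra. -/
def walkElt (g : Γ.Germ) (hg : ¬ Γ.IsTruncated g) (n : ℕ) : PathAlgebra k Γ.QVert :=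
  ofPath k (walk g hg n)

variable {k}

theorem ofPath_toPath_eq {a b : Γ.QVert} (f : a ⟶ b) :
    ofPath k f.toPath = arrowElt k f.1 f.2.2.2 := by
  obtain ⟨g, rfl, rfl, hg⟩ := f
  rfl

theorem arrowElt_congr {g h : Γ.Germ} (e : g = h) (hg : ¬ Γ.IsTruncated g)
    (hh : ¬ Γ.IsTruncated h) : arrowElt k g hg = arrowElt k h hh := by
  subst e; rfl

theorem walkElt_congr {g h : Γ.Germ} (e : g = h) (hg : ¬ Γ.IsTruncated g)
    (hh : ¬ Γ.IsTruncated h) (n : ℕ) : walkElt k g hg n = walkElt k h hh n := by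
  subst e; rfl

theorem walkElt_zero (g : Γ.Germ) (hg : ¬ Γ.IsTruncated g) :
    walkElt k g hg 0 = ofPath k (Path.nil : Path (qvert g) (qvert g)) := rfl

theorem walkElt_succ (g : Γ.Germ) (hg : ¬ Γ.IsTruncated g) (n : ℕ) :
    walkElt k g hg (n + 1) =
      walkElt k g hg n * arrowElt k ((Γ.next ^ n) g) (not_isTruncated_pow hg n) := by
  rw [walkElt, walk, ← Path.comp_toPath_eq_cons, ← ofPath_mul_ofPath, ofPath_toPath_eq]
  rfl

theorem ofPath_cons {a b c : Γ.QVert} (p : Path a b) (f : b ⟶ c) :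
    ofPath k (p.cons f) = ofPath k p * arrowElt k f.1 f.2.2.2 := by
  rw [← Path.comp_toPath_eq_cons, ← ofPath_mul_ofPath, ofPath_toPath_eq]

theorem next_pow_pow (g : Γ.Germ) (m n : ℕ) :
    (Γ.next ^ n) ((Γ.next ^ m) g) = (Γ.next ^ (m + n)) g := by
  rw [← Equiv.Perm.mul_apply, ← pow_add, add_comm]

theorem walkElt_add (g : Γ.Germ) (hg : ¬ Γ.IsTruncated g) (m n : ℕ) :
    walkElt k g hg (m + n) =
      walkElt k g hg m * walkElt k ((Γ.next ^ m) g) (not_isTruncated_pow hg m) n := by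
  induction n with
  | zero => exact (ofPath_mul_ofPath (walk g hg m) Path.nil).symm
  | succ n ih =>
    rw [← add_assoc, walkElt_succ, ih, walkElt_succ, mul_assoc]
    congr 2
    exact arrowElt_congr (next_pow_pow g m n).symm _ _

theorem walkElt_one (g : Γ.Germ) (hg : ¬ Γ.IsTruncated g) :
    walkElt k g hg 1 = arrowElt k g hg := by
  rw [walkElt_succ, walkElt_zero]
  exact (ofPath_mul_ofPath Path.nil (arrow g hg).toPath).trans (by rw [Path.nil_comp]; rfl)

variable (Γ) in
/-- The length of the path `C_g ^ e`. -/
def fullLen (g : Γ.Germ) : ℕ := Function.minimalPeriod Γ.next g * Γ.mult (Γ.vert g)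

theorem next_pow_fullLen (g : Γ.Germ) : (Γ.next ^ Γ.fullLen g) g = g := by
  rw [← Equiv.Perm.iterate_eq_pow]
  exact (Function.isPeriodicPt_minimalPeriod Γ.next g).mul_const _

/-- If the arrows do not compose, the product is already zero in the path algebra; if they do, it is
a relation of type (iii). -/
theorem arrowElt_mul_mem {g h : Γ.Germ} (hg : ¬ Γ.IsTruncated g) (hh : ¬ Γ.IsTruncated h)
    (hne : Γ.next g ≠ h) : arrowElt k g hg * arrowElt k h hh ∈ Γ.ideal k := by
  by_cases he : Γ.edge (Γ.next g) = Γ.edge h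
  · exact TwoSidedIdeal.subset_span (Rel.zero g h hg hh he hne)
  · have h0 : arrowElt k g hg * arrowElt k h hh = 0 :=
      ofPath_mul_ofPath_of_ne (arrow g hg).toPath (arrow h hh).toPath he
    rw [h0]
    exact (Γ.ideal k).zero_mem

namespace IsBrauerGraph

variable (hΓ : Γ.IsBrauerGraph)

include hΓ

theorem exists_other (g : Γ.Germ) : ∃ h, h ≠ g ∧ Γ.edge h = Γ.edge g ∧
    ∀ x, Γ.edge x = Γ.edge g → x = g ∨ x = h := by
  obtain ⟨⟨x, hx⟩, ⟨y, hy⟩, hxy, huniv⟩ := Nat.card_eq_two_iff.1 (hΓ.two_germs (Γ.edge g))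
  have hne : x ≠ y := fun h => hxy (Subtype.ext h)
  have key : ∀ z, Γ.edge z = Γ.edge g → z = x ∨ z = y := by
    intro z hz
    have : (⟨z, hz⟩ : {z // Γ.edge z = Γ.edge g}) ∈ (Set.univ : Set _) := trivial
    rw [← huniv] at this
    rcases this with h | h
    · exact Or.inl (congrArg Subtype.val h)
    · exact Or.inr (congrArg Subtype.val h)
  rcases key g rfl with rfl | rfl
  · exact ⟨y, hne.symm, hy, key⟩
  · exact ⟨x, hne, hx, fun z hz => (key z hz).symm⟩

theorem exists_germ (e : Γ.Edge) : ∃ g, Γ.edge g = e := by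
  obtain ⟨⟨x, hx⟩, -⟩ := Nat.card_eq_two_iff.1 (hΓ.two_germs e)
  exact ⟨x, hx⟩

theorem vert_next (g : Γ.Germ) : Γ.vert (Γ.next g) = Γ.vert g :=
  (hΓ.cyclic _ _).2 (Equiv.Perm.sameCycle_apply_left.2 (Equiv.Perm.SameCycle.refl _ _))

theorem mem_periodicPts (g : Γ.Germ) : g ∈ Function.periodicPts Γ.next :=
  haveI := hΓ.finite_germ
  Function.Injective.mem_periodicPts Γ.next.injective g

theorem minimalPeriod_pos (g : Γ.Germ) : 0 < Function.minimalPeriod Γ.next g :=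
  Function.minimalPeriod_pos_of_mem_periodicPts (hΓ.mem_periodicPts g)

theorem fullLen_pos (g : Γ.Germ) : 0 < Γ.fullLen g :=
  Nat.mul_pos (hΓ.minimalPeriod_pos g) (hΓ.mult_pos _)

theorem fullLen_next (g : Γ.Germ) : Γ.fullLen (Γ.next g) = Γ.fullLen g := by
  rw [fullLen, fullLen, hΓ.vert_next, Function.minimalPeriod_apply (hΓ.mem_periodicPts g)]

theorem fullLen_next_pow (g : Γ.Germ) (n : ℕ) : Γ.fullLen ((Γ.next ^ n) g) = Γ.fullLen g := by
  induction n with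
  | zero => rfl
  | succ n ih => rw [pow_succ', Equiv.Perm.mul_apply, hΓ.fullLen_next, ih]

/-- Full length one means period one and multiplicity one, which is truncation. This keeps the
relations inside `R ^ 2`. -/
theorem two_le_fullLen {g : Γ.Germ} (hg : ¬ Γ.IsTruncated g) : 2 ≤ Γ.fullLen g := by
  by_contra hlt
  have h1 : Γ.fullLen g = 1 := by have := hΓ.fullLen_pos g; omega
  have h2 := Nat.eq_one_of_mul_eq_one_right h1
  have h3 := Nat.eq_one_of_mul_eq_one_left h1
  exact hg ⟨Function.minimalPeriod_eq_one_iff_isFixedPt.1 h2, h3⟩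

theorem cyclePow_eq (g : Γ.Germ) (hg : ¬ Γ.IsTruncated g) :
    cyclePow k g hg = walkElt k g hg (Γ.fullLen g) := by
  -- The exponent zero has to be avoided: the zeroth power is the sum of all trivial paths and not
  -- the trivial path at one vertex.
  have key : ∀ m, cycle k g hg ^ (m + 1) =
      walkElt k g hg (Function.minimalPeriod Γ.next g * (m + 1)) := by
    intro m
    induction m with
    | zero => rw [zero_add, pow_one, mul_one]; rfl
    | succ m ih =>
      rw [pow_succ, ih, mul_add _ (m + 1), mul_one, walkElt_add]
      congr 1
      refine walkElt_congr ?_ _ _ _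
      rw [← Equiv.Perm.iterate_eq_pow]
      exact ((Function.isPeriodicPt_minimalPeriod Γ.next g).mul_const _).symm
  obtain ⟨m, hm⟩ := Nat.exists_eq_succ_of_ne_zero (hΓ.mult_pos (Γ.vert g)).ne'
  rw [cyclePow, fullLen, hm]
  exact key m

/-- An edge with two truncated germs meets no other edge, so by connectedness it is the whole graph,
and this graph is excluded. -/
theorem not_isTruncated_or (hE : ¬ Γ.IsExcluded) {g h : Γ.Germ} (hne : h ≠ g)
    (he : Γ.edge h = Γ.edge g) : ¬ Γ.IsTruncated g ∨ ¬ Γ.IsTruncated h := by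
  by_contra hcon
  rw [not_or, not_not, not_not] at hcon
  obtain ⟨⟨hg1, hg2⟩, hh1, hh2⟩ := hcon
  have hsingle : ∀ {g x : Γ.Germ}, Γ.next g = g → Γ.vert x = Γ.vert g → x = g := by
    intro g x hg hx
    obtain ⟨n, hn⟩ := (hΓ.cyclic _ _).1 hx.symm
    rw [← hn]
    exact Equiv.Perm.zpow_apply_eq_self_of_apply_eq_self hg n
  obtain ⟨h', -, -, hall⟩ := hΓ.exists_other g
  have hh' : h = h' := (hall h he).resolve_left hne
  subst hh'
  have hreach : ∀ y, Relation.ReflTransGen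
      (fun x y => ∃ g h : Γ.Germ, Γ.edge g = Γ.edge h ∧ Γ.vert g = x ∧ Γ.vert h = y)
      (Γ.vert g) y → y = Γ.vert g ∨ y = Γ.vert h := by
    intro y hy
    induction hy with
    | refl => exact Or.inl rfl
    | tail _ hs ih =>
      obtain ⟨a, b, hab, rfl, rfl⟩ := hs
      have ha : Γ.edge a = Γ.edge g := by
        rcases ih with h1 | h1
        · rw [hsingle hg1 h1]
        · rw [hsingle hh1 h1, he]
      rcases hall b (hab ▸ ha) with rfl | rfl
      · exact Or.inl rfl
      · exact Or.inr rfl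
  have hgerm : ∀ x, x = g ∨ x = h := fun x =>
    (hreach _ (hΓ.connected (Γ.vert g) (Γ.vert x))).imp (hsingle hg1) (hsingle hh1)
  refine hE (Or.inr ⟨?_, ?_, ?_⟩)
  · refine Nat.card_eq_one_iff_unique.2 ⟨⟨fun a b => ?_⟩, ⟨Γ.edge g⟩⟩
    have : ∀ a, a = Γ.edge g := by
      intro a
      obtain ⟨x, rfl⟩ := hΓ.exists_germ a
      rcases hgerm x with rfl | rfl
      · rfl
      · exact he
    rw [this a, this b]
  · intro x y hxy
    rcases hgerm y with rfl | rfl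
    · exact hsingle hg1 hxy
    · exact hsingle hh1 hxy
  · intro x
    rcases hgerm x with rfl | rfl
    · exact hg2
    · exact hh2

theorem exists_not_isTruncated (hE : ¬ Γ.IsExcluded) (e : Γ.Edge) :
    ∃ g, Γ.edge g = e ∧ ¬ Γ.IsTruncated g := by
  obtain ⟨g, rfl⟩ := hΓ.exists_germ e
  obtain ⟨h, hne, he, -⟩ := hΓ.exists_other g
  rcases hΓ.not_isTruncated_or hE hne he with h1 | h1
  · exact ⟨g, rfl, h1⟩
  · exact ⟨h, he, h1⟩

/-- The last arrow of the walk belongs to the predecessor of `g`, so continuing with `h` is a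
forbidden turn. -/
theorem walkElt_fullLen_mul_mem {g h : Γ.Germ} (hg : ¬ Γ.IsTruncated g) (hh : ¬ Γ.IsTruncated h)
    (hne : g ≠ h) : walkElt k g hg (Γ.fullLen g) * arrowElt k h hh ∈ Γ.ideal k := by
  obtain ⟨m, hm⟩ := Nat.exists_eq_succ_of_ne_zero (hΓ.fullLen_pos g).ne'
  rw [hm, Nat.succ_eq_add_one, walkElt_succ, mul_assoc]
  refine (Γ.ideal k).mul_mem_left _ _ (arrowElt_mul_mem _ _ ?_)
  rw [← Equiv.Perm.mul_apply, ← pow_succ', ← Nat.succ_eq_add_one, ← hm, next_pow_fullLen]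
  exact hne

theorem comm_mem {g h : Γ.Germ} (hg : ¬ Γ.IsTruncated g) (hh : ¬ Γ.IsTruncated h)
    (he : Γ.edge g = Γ.edge h) :
    walkElt k g hg (Γ.fullLen g) - walkElt k h hh (Γ.fullLen h) ∈ Γ.ideal k := by
  by_cases hne : g = h
  · subst hne
    rw [sub_self]
    exact (Γ.ideal k).zero_mem
  · have := Rel.comm (k := k) g h hg hh hne he
    rw [hΓ.cyclePow_eq, hΓ.cyclePow_eq] at this
    exact TwoSidedIdeal.subset_span this

/-- If the other germ `h` of the edge is truncated, this is relation (ii). Otherwise relation (i)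
replaces `C_g ^ e` by the cycle of `h`, and passing from that to the arrow of `g` is a forbidden
turn. -/
theorem walkElt_fullLen_mul_self_mem {g : Γ.Germ} (hg : ¬ Γ.IsTruncated g) :
    walkElt k g hg (Γ.fullLen g) * arrowElt k g hg ∈ Γ.ideal k := by
  obtain ⟨h, hne, he, -⟩ := hΓ.exists_other g
  by_cases hh : Γ.IsTruncated h
  · have := Rel.leaf (k := k) g h hg hne.symm he.symm hh
    rw [hΓ.cyclePow_eq] at this
    exact TwoSidedIdeal.subset_span this
  · have h1 := (Γ.ideal k).mul_mem_right _ (arrowElt k g hg) (hΓ.comm_mem (k := k) hg hh he.symm)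
    rw [sub_mul] at h1
    have h2 := hΓ.walkElt_fullLen_mul_mem (k := k) hh hg hne
    simpa using (Γ.ideal k).add_mem h1 h2

theorem walkElt_fullLen_mul_arrowElt_mem {g h : Γ.Germ} (hg : ¬ Γ.IsTruncated g)
    (hh : ¬ Γ.IsTruncated h) : walkElt k g hg (Γ.fullLen g) * arrowElt k h hh ∈ Γ.ideal k := by
  by_cases hne : g = h
  · subst hne
    exact hΓ.walkElt_fullLen_mul_self_mem hg
  · exact hΓ.walkElt_fullLen_mul_mem hg hh hne

theorem walkElt_mem_of_lt {g : Γ.Germ} (hg : ¬ Γ.IsTruncated g) {n : ℕ} (hn : Γ.fullLen g < n) :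
    walkElt k g hg n ∈ Γ.ideal k := by
  obtain ⟨m, rfl⟩ := Nat.exists_eq_add_of_lt hn
  rw [add_assoc, add_comm m, ← add_assoc, walkElt_add, walkElt_succ]
  exact (Γ.ideal k).mul_mem_right _ _ (hΓ.walkElt_fullLen_mul_arrowElt_mem _ _)

variable (k) in
/-- Every path that is not zero in the Brauer graph algebra is a walk around a vertex, of at most
the length of `C_g ^ e`. -/
theorem ofPath_mem_or (hE : ¬ Γ.IsExcluded) {a b : Γ.QVert} (p : Path a b) :
    ofPath k p ∈ Γ.ideal k ∨ ∃ (g : Γ.Germ) (hg : ¬ Γ.IsTruncated g), qvert g = a ∧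
      p.length ≤ Γ.fullLen g ∧ ofPath k p = walkElt k g hg p.length := by
  induction p with
  | nil =>
    obtain ⟨g, rfl, hg⟩ := hΓ.exists_not_isTruncated hE a
    exact Or.inr ⟨g, hg, rfl, Nat.zero_le _, rfl⟩
  | cons p f ih =>
    rcases ih with h | ⟨g, hg, rfl, hle, h⟩
    · left
      rw [ofPath_cons]
      exact (Γ.ideal k).mul_mem_right _ _ h
    · by_cases hp : p.length = 0
      · cases p with
        | nil =>
          -- The germ attached to a trivial path is an arbitrary choice; once an arrow follows, the
          -- walk is restarted from the germ of that arrow.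
          refine Or.inr ⟨f.1, f.2.2.2, f.2.1, hΓ.fullLen_pos _, ?_⟩
          rw [Path.length_cons, Path.length_nil, zero_add, walkElt_one, ← ofPath_toPath_eq]
          rfl
        | cons p f => simp at hp
      · obtain ⟨m, hm⟩ := Nat.exists_eq_succ_of_ne_zero hp
        have h2 : ofPath k (p.cons f) = walkElt k g hg m *
            (arrowElt k ((Γ.next ^ m) g) (not_isTruncated_pow hg m) *
              arrowElt k f.1 f.2.2.2) := by
          rw [ofPath_cons, h, hm, Nat.succ_eq_add_one, walkElt_succ, mul_assoc]
        by_cases hf : Γ.next ((Γ.next ^ m) g) = f.1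
        · have h3 : ofPath k (p.cons f) = walkElt k g hg (p.length + 1) := by
            rw [ofPath_cons, h, walkElt_succ]
            congr 1
            refine arrowElt_congr ?_ _ _
            rw [← hf, hm, ← Equiv.Perm.mul_apply, ← pow_succ']
          by_cases hle' : p.length + 1 ≤ Γ.fullLen g
          · exact Or.inr ⟨g, hg, rfl, hle', h3⟩
          · left
            rw [h3]
            exact hΓ.walkElt_mem_of_lt hg (by omega)
        · left
          rw [h2]
          exact (Γ.ideal k).mul_mem_left _ _ (arrowElt_mul_mem _ _ hf)

end IsBrauerGraph

end LocalGraph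

/-! ## The symmetrizing form of a Brauer graph algebra -/

namespace LocalGraph

variable {Γ : LocalGraph.{u, v}}

/-- The germs of the arrows of a path. -/
def germs {a : Γ.QVert} : {b : Γ.QVert} → Path a b → List Γ.Germ
  | _, Path.nil => []
  | _, Path.cons p f => germs p ++ [f.1]

theorem germs_nil {a : Γ.QVert} : germs (Path.nil : Path a a) = [] := rfl

theorem germs_cons {a b c : Γ.QVert} (p : Path a b) (f : b ⟶ c) :
    germs (p.cons f) = germs p ++ [f.1] := rfl

theorem germs_comp {a b c : Γ.QVert} (p : Path a b) (q : Path b c) :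
    germs (p.comp q) = germs p ++ germs q := by
  induction q with
  | nil => rw [Path.comp_nil, germs_nil, List.append_nil]
  | cons q f ih => rw [Path.comp_cons, germs_cons, germs_cons, ih, List.append_assoc]

theorem germs_cast {a b a' b' : Γ.QVert} (ha : a = a') (hb : b = b') (p : Path a b) :
    germs (p.cast ha hb) = germs p := by
  subst ha hb; rfl

theorem qvert_of_germs_eq_cons {a b : Γ.QVert} {p : Path a b} {g : Γ.Germ} {l : List Γ.Germ}
    (h : germs p = g :: l) : qvert g = a := by
  induction p generalizing l with
  | nil => cases h
  | cons p f ih =>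
    cases hp : germs p with
    | nil =>
      cases p with
      | nil =>
        rw [germs_cons, hp, List.nil_append] at h
        obtain rfl := (List.cons.inj h).1
        exact f.2.1
      | cons p f => simp [germs_cons] at hp
    | cons x l' =>
      rw [germs_cons, hp, List.cons_append] at h
      obtain rfl := (List.cons.inj h).1
      exact ih hp

theorem qvert_of_germs_eq_append {a b : Γ.QVert} {p : Path a b} {g : Γ.Germ} {l : List Γ.Germ}
    (h : germs p = l ++ [g]) : qvert (Γ.next g) = b := by
  cases p with
  | nil => simp [germs_nil] at h
  | cons p f =>
    rw [germs_cons] at h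
    obtain rfl := (List.cons.inj (List.append_inj_right' h rfl)).1
    exact f.2.2.1

variable (Γ) in
/-- The first `n` germs in the cyclic ordering from a germ on. -/
def orb (g : Γ.Germ) (n : ℕ) : List Γ.Germ := (List.range n).map fun i => (Γ.next ^ i) g

theorem orb_succ (g : Γ.Germ) (n : ℕ) : Γ.orb g (n + 1) = Γ.orb g n ++ [(Γ.next ^ n) g] := by
  rw [orb, List.range_succ, List.map_append]; rfl

theorem orb_succ' (g : Γ.Germ) (n : ℕ) : Γ.orb g (n + 1) = g :: Γ.orb (Γ.next g) n := by
  rw [orb, List.range_succ_eq_map, List.map_cons, List.map_map]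
  rfl

theorem length_orb (g : Γ.Germ) (n : ℕ) : (Γ.orb g n).length = n := by
  rw [orb, List.length_map, List.length_range]

theorem isChain_orb (g : Γ.Germ) (n : ℕ) :
    (Γ.orb g n).IsChain fun a b => Γ.next a = b := by
  induction n generalizing g with
  | zero => exact List.IsChain.nil
  | succ n ih =>
    cases n with
    | zero => exact List.IsChain.singleton _
    | succ n =>
      have := ih (Γ.next g)
      rw [orb_succ'] at this
      rw [orb_succ', orb_succ']
      exact List.isChain_cons_cons.2 ⟨rfl, this⟩

theorem germs_walk (g : Γ.Germ) (hg : ¬ Γ.IsTruncated g) (n : ℕ) :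
    germs (walk g hg n) = Γ.orb g n := by
  induction n with
  | zero => rfl
  | succ n ih => rw [orb_succ, walk, germs_cons, ih]

/-- The lists of germs of the paths `C_g ^ e`. -/
def IsFull (l : List Γ.Germ) : Prop := ∃ g : Γ.Germ, l = Γ.orb g (Γ.fullLen g)

variable (k : Type w) [Field k]

open Classical in
/-- The linear form with the value `1` at the paths `C_g ^ e` and `0` at all other paths. -/
def form : PathAlgebra k Γ.QVert →ₗ[k] k :=
  (Finsupp.linearCombination k fun p : TotalPath Γ.QVert => if IsFull (germs p.2.2) then 1 else 0 :
    (TotalPath Γ.QVert →₀ k) →ₗ[k] k)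

variable {k}

open Classical in
theorem form_ofPath {a b : Γ.QVert} (p : Path a b) :
    form k (ofPath k p) = if IsFull (germs p) then 1 else 0 :=
  (Finsupp.linearCombination_single k _ _).trans (one_smul _ _)

open Classical in
theorem form_mul_mul {a b c d e f : Γ.QVert} (p : Path a b) (q : Path c d) (r : Path e f) :
    form k (ofPath k p * ofPath k q * ofPath k r) =
      if b = c ∧ d = e ∧ IsFull (germs p ++ germs q ++ germs r) then 1 else 0 := by
  by_cases h : b = c
  · subst h
    by_cases h' : d = e
    · subst h'
      rw [ofPath_mul_ofPath, ofPath_mul_ofPath, form_ofPath, germs_comp, germs_comp]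
      simp
    · rw [ofPath_mul_ofPath, ofPath_mul_ofPath_of_ne _ _ h', map_zero, if_neg (fun hh => h' hh.2.1)]
  · rw [ofPath_mul_ofPath_of_ne _ _ h, zero_mul, map_zero, if_neg (fun hh => h hh.1)]

theorem form_walkElt_fullLen (g : Γ.Germ) (hg : ¬ Γ.IsTruncated g) :
    form k (walkElt k g hg (Γ.fullLen g)) = 1 := by
  rw [walkElt, form_ofPath, if_pos]
  exact ⟨g, germs_walk g hg _⟩

namespace IsBrauerGraph

variable (hΓ : Γ.IsBrauerGraph)

include hΓ

/-- Rotation by one position moves the starting germ to its successor, because after the full length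
the walk is back at its start. -/
theorem isFull_rotate {l : List Γ.Germ} (h : IsFull l) (n : ℕ) : IsFull (l.rotate n) := by
  induction n with
  | zero => rwa [List.rotate_zero]
  | succ n ih =>
    rw [← List.rotate_rotate]
    obtain ⟨g, hg⟩ := ih
    refine ⟨Γ.next g, ?_⟩
    have hper := next_pow_fullLen g
    rw [hg, hΓ.fullLen_next]
    obtain ⟨m, hm⟩ := Nat.exists_eq_succ_of_ne_zero (hΓ.fullLen_pos g).ne'
    rw [hm] at hper ⊢
    rw [Nat.succ_eq_add_one, orb_succ', orb_succ, List.rotate_cons_succ, List.rotate_zero,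
      ← Equiv.Perm.mul_apply, ← pow_succ, ← Nat.succ_eq_add_one, hper]

theorem isFull_append_comm {l l' : List Γ.Germ} (h : IsFull (l ++ l')) : IsFull (l' ++ l) := by
  rw [← List.rotate_append_length_eq]
  exact hΓ.isFull_rotate h _

theorem length_of_isFull {l : List Γ.Germ} (h : IsFull l) {g : Γ.Germ} (hg : g ∈ l) :
    l.length = Γ.fullLen g := by
  obtain ⟨h, rfl⟩ := h
  obtain ⟨n, -, rfl⟩ := List.mem_map.1 hg
  rw [length_orb, hΓ.fullLen_next_pow]

theorem eq_of_isFull {a b : Γ.QVert} {p : Path a b} (h : IsFull (germs p)) : a = b := by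
  obtain ⟨g, hg⟩ := h
  have hper := next_pow_fullLen g
  obtain ⟨m, hm⟩ := Nat.exists_eq_succ_of_ne_zero (hΓ.fullLen_pos g).ne'
  rw [hm] at hg hper
  rw [← qvert_of_germs_eq_cons (hg.trans (orb_succ' g m)),
    ← qvert_of_germs_eq_append (hg.trans (orb_succ g m)), ← Equiv.Perm.mul_apply, ← pow_succ',
    ← Nat.succ_eq_add_one, hper]

theorem form_mul_comm (x y : PathAlgebra k Γ.QVert) : form k (x * y) = form k (y * x) := by
  have h : (LinearMap.mul k (PathAlgebra k Γ.QVert)).compr₂ (form k) =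
      ((LinearMap.mul k (PathAlgebra k Γ.QVert)).compr₂ (form k)).flip := by
    refine PathAlgebra.hom_ext fun a b p => PathAlgebra.hom_ext fun c d q => ?_
    change form k (ofPath k p * ofPath k q) = form k (ofPath k q * ofPath k p)
    -- Only the case of a non-zero value needs an argument: then the product is a full cycle, so the
    -- two paths also compose in the other order.
    have key : ∀ {a b c d : Γ.QVert} (p : Path a b) (q : Path c d),
        form k (ofPath k p * ofPath k q) ≠ 0 →
          form k (ofPath k q * ofPath k p) = form k (ofPath k p * ofPath k q) := by
      intro a b c d p q h
      by_cases hbc : b = c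
      · subst hbc
        rw [ofPath_mul_ofPath, form_ofPath] at h ⊢
        have hf : IsFull (germs (p.comp q)) := by
          by_contra hf
          exact h (if_neg hf)
        obtain rfl := hΓ.eq_of_isFull hf
        rw [ofPath_mul_ofPath, form_ofPath, if_pos hf, if_pos]
        rw [germs_comp] at hf ⊢
        exact hΓ.isFull_append_comm hf
      · rw [ofPath_mul_ofPath_of_ne _ _ hbc, map_zero] at h
        exact absurd rfl h
    by_cases h : form k (ofPath k p * ofPath k q) = 0
    · by_cases h' : form k (ofPath k q * ofPath k p) = 0
      · rw [h, h']
      · exact key _ _ h'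
    · exact (key _ _ h).symm
  exact LinearMap.congr_fun (LinearMap.congr_fun h x) y

/-- The length `n + 1` ensures that `g` occurs among the germs, and a full list containing `g` has
length `Γ.fullLen g`. -/
theorem form_mul_walkElt_mul (g : Γ.Germ) (hg : ¬ Γ.IsTruncated g) (n : ℕ)
    {a b c d : Γ.QVert} (p : Path a b) (q : Path c d)
    (hn : (germs p).length + (n + 1) + (germs q).length ≠ Γ.fullLen g) :
    form k (ofPath k p * walkElt k g hg (n + 1) * ofPath k q) = 0 := by
  classical
  rw [walkElt, form_mul_mul, if_neg]
  rintro ⟨-, -, h⟩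
  rw [germs_walk] at h
  refine hn ?_
  rw [← hΓ.length_of_isFull h (g := g)]
  · simp [length_orb, add_assoc]
  · simp [orb_succ']

/-- If `p` or `q` is non-trivial, both products are too long to be full and both values vanish. If
both are trivial, both values only record whether the end points match, and these are the same for
the two germs of an edge. -/
theorem form_mul_cycle_mul {g h : Γ.Germ} (hg : ¬ Γ.IsTruncated g) (hh : ¬ Γ.IsTruncated h)
    (he : Γ.edge g = Γ.edge h) {a b c d : Γ.QVert} (p : Path a b) (q : Path c d) :
    form k (ofPath k p * walkElt k g hg (Γ.fullLen g) * ofPath k q) =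
      form k (ofPath k p * walkElt k h hh (Γ.fullLen h) * ofPath k q) := by
  classical
  by_cases hpq : (germs p).length + (germs q).length = 0
  · have hp : germs p = [] := List.length_eq_zero_iff.1 (by omega)
    have hq : germs q = [] := List.length_eq_zero_iff.1 (by omega)
    rw [walkElt, walkElt, form_mul_mul, form_mul_mul, hp, hq, germs_walk, germs_walk,
      List.nil_append, List.append_nil, List.nil_append, List.append_nil]
    have h1 : IsFull (Γ.orb g (Γ.fullLen g)) := ⟨g, rfl⟩
    have h2 : IsFull (Γ.orb h (Γ.fullLen h)) := ⟨h, rfl⟩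
    have h3 : qvert g = qvert h := he
    simp only [h1, h2, next_pow_fullLen, h3]
  · have key : ∀ (x : Γ.Germ) (hx : ¬ Γ.IsTruncated x),
        form k (ofPath k p * walkElt k x hx (Γ.fullLen x) * ofPath k q) = 0 := by
      intro x hx
      obtain ⟨m, hm⟩ := Nat.exists_eq_succ_of_ne_zero (hΓ.fullLen_pos x).ne'
      rw [hm]
      refine hΓ.form_mul_walkElt_mul x hx m p q ?_
      omega
    rw [key, key]

-- In a full list each germ is followed by its successor, so a list containing `g, h` with `h` not
-- the successor of `g` is never full.
omit hΓ in
theorem form_mul_arrowElt_mul {g h : Γ.Germ} (hg : ¬ Γ.IsTruncated g) (hh : ¬ Γ.IsTruncated h)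
    (hne : Γ.next g ≠ h) {a b c d : Γ.QVert} (p : Path a b) (q : Path c d) :
    form k (ofPath k p * (arrowElt k g hg * arrowElt k h hh) * ofPath k q) = 0 := by
  classical
  by_cases he : qvert (Γ.next g) = qvert h
  · have h1 : arrowElt k g hg * arrowElt k h hh =
        ofPath k ((arrow g hg).toPath.comp ((arrow h hh).toPath.cast he.symm rfl)) := by
      rw [← ofPath_mul_ofPath, arrowElt, arrowElt]
      congr 1
      generalize qvert (Γ.next g) = x at he
      subst he
      rfl
    have h2 : germs ((arrow h hh).toPath.cast he.symm rfl) = [h] := germs_cast _ _ _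
    rw [h1, form_mul_mul, if_neg]
    rintro ⟨-, -, x, hx⟩
    have hc := isChain_orb x (Γ.fullLen x)
    rw [germs_comp, h2] at hx
    have h3 : germs (arrow g hg).toPath = [g] := rfl
    rw [← hx, h3] at hc
    have h4 := List.IsChain.infix hc (List.infix_append (germs p) ([g] ++ [h]) (germs q))
    exact hne (List.isChain_cons_cons.1 h4).1
  · have h0 : arrowElt k g hg * arrowElt k h hh = 0 :=
      ofPath_mul_ofPath_of_ne (arrow g hg).toPath (arrow h hh).toPath he
    rw [h0, mul_zero, zero_mul, map_zero]

theorem form_mul_mul_of_rel {x : PathAlgebra k Γ.QVert} (hx : Rel k x)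
    (y z : PathAlgebra k Γ.QVert) : form k (y * x * z) = 0 := by
  have key : ∀ {a b c d : Γ.QVert} (p : Path a b) (q : Path c d),
      form k (ofPath k p * x * ofPath k q) = 0 := by
    intro a b c d p q
    cases hx with
    | comm g h hg hh hne he =>
      rw [hΓ.cyclePow_eq, hΓ.cyclePow_eq, mul_sub, sub_mul, map_sub,
        hΓ.form_mul_cycle_mul hg hh he, sub_self]
    | leaf g h hg hne he hh =>
      rw [hΓ.cyclePow_eq, ← arrowElt]
      -- The leaf relation is itself a walk, one step longer than a full one, and therefore
      -- invisible to the form.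
      have : walkElt k g hg (Γ.fullLen g) * arrowElt k g hg =
          walkElt k g hg (Γ.fullLen g + 1) := by
        rw [walkElt_succ]
        congr 1
        exact arrowElt_congr (next_pow_fullLen g).symm _ _
      rw [this]
      refine hΓ.form_mul_walkElt_mul g hg _ p q ?_
      omega
    | zero g h hg hh he hne =>
      exact form_mul_arrowElt_mul hg hh hne p q
  have h : ((LinearMap.mul k (PathAlgebra k Γ.QVert)).compr₂ (form k)).comp
      (LinearMap.mulRight k x) = 0 := by
    refine PathAlgebra.hom_ext fun a b p => PathAlgebra.hom_ext fun c d q => ?_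
    exact key p q
  exact LinearMap.congr_fun (LinearMap.congr_fun h y) z

/-- The factors `y` and `z` let the induction absorb multiplication by ring elements on either side.
-/
theorem form_mul_mul_of_mem {x : PathAlgebra k Γ.QVert} (hx : x ∈ Γ.ideal k)
    (y z : PathAlgebra k Γ.QVert) : form k (y * x * z) = 0 := by
  induction hx using TwoSidedIdeal.span_induction generalizing y z with
  | mem x hx => exact hΓ.form_mul_mul_of_rel hx y z
  | zero => rw [mul_zero, zero_mul, map_zero]
  | add a b _ _ ha hb => rw [mul_add, add_mul, map_add, ha, hb, add_zero]
  | neg a _ ha => rw [mul_neg, neg_mul, map_neg, ha, neg_zero]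
  | left_absorb a x _ hx => rw [← mul_assoc, hx]
  | right_absorb b x _ hx => rw [← mul_assoc, mul_assoc, hx]

theorem form_of_mem {x : PathAlgebra k Γ.QVert} (hx : x ∈ Γ.ideal k) : form k x = 0 := by
  have := hΓ.form_mul_mul_of_mem hx 1 1
  rwa [one_mul, mul_one] at this

end IsBrauerGraph

end LocalGraph

/-! ## Brauer graph algebras are symmetric special biserial -/

section Coeff

variable {k : Type w} {V : Type u} [Quiver.{v} V] [Field k] [Finite V]

omit [Finite V] in
theorem ofPath_injective {p q : TotalPath V} (h : ofPath k p.2.2 = ofPath k q.2.2) : p = q :=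
  Finsupp.single_left_injective one_ne_zero h

theorem coeff_ofPath_mul_ofPath {n : ℕ} {a b c d e f : V} (p : Path a b) (q : Path c d)
    (r : Path e f) (hpq : n ≤ p.length + q.length) (hr : r.length < n) :
    coeff (ofPath k p * ofPath k q) r = 0 := by
  by_cases h : b = c
  · subst h
    rw [ofPath_mul_ofPath]
    refine coeff_ofPath_of_length_ne ?_
    rw [Path.length_comp]
    omega
  · rw [ofPath_mul_ofPath_of_ne _ _ h, coeff_zero]

theorem coeff_mul_eq_zero {m n : ℕ} {x y : PathAlgebra k V}
    (hx : ∀ (a b : V) (p : Path a b), p.length < m → coeff x p = 0)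
    (hy : ∀ (a b : V) (p : Path a b), p.length < n → coeff y p = 0)
    {a b : V} (r : Path a b) (hr : r.length < m + n) : coeff (x * y) r = 0 := by
  rw [← coeffLin_apply, eq_sum_ofPath x, eq_sum_ofPath y, Finsupp.sum, Finsupp.sum,
    Finset.sum_mul_sum, map_sum]
  refine Finset.sum_eq_zero fun p hp => ?_
  rw [map_sum]
  refine Finset.sum_eq_zero fun q hq => ?_
  rw [smul_mul_smul_comm, map_smul, coeffLin_apply, coeff_ofPath_mul_ofPath (n := m + n),
    smul_zero]
  · have h1 : m ≤ p.2.2.length := by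
      by_contra hlt
      exact Finsupp.mem_support_iff.1 hp (hx _ _ p.2.2 (by omega))
    have h2 : n ≤ q.2.2.length := by
      by_contra hlt
      exact Finsupp.mem_support_iff.1 hq (hy _ _ q.2.2 (by omega))
    omega
  · exact hr

/-- The elements supported on paths of length at least `n` form a two-sided ideal, so it suffices to
look at generators. -/
theorem coeff_eq_zero_of_mem_span {s : Set (PathAlgebra k V)} {n : ℕ}
    (hs : ∀ x ∈ s, ∀ (a b : V) (p : Path a b), p.length < n → coeff x p = 0)
    {x : PathAlgebra k V} (hx : x ∈ TwoSidedIdeal.span s) :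
    ∀ (a b : V) (p : Path a b), p.length < n → coeff x p = 0 := by
  induction hx using TwoSidedIdeal.span_induction with
  | mem x hx => exact hs x hx
  | zero => exact fun _ _ _ _ => rfl
  | add x y _ _ hx hy =>
    intro a b p hp
    rw [coeff_add, hx a b p hp, hy a b p hp, add_zero]
  | neg x _ hx =>
    intro a b p hp
    rw [← coeffLin_apply, map_neg, coeffLin_apply, hx a b p hp, neg_zero]
  | left_absorb y x _ hx =>
    intro a b p hp
    exact coeff_mul_eq_zero (m := 0) (fun _ _ _ h => absurd h (Nat.not_lt_zero _)) hx p (by omega)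
  | right_absorb y x _ hx =>
    intro a b p hp
    exact coeff_mul_eq_zero (n := 0) hx (fun _ _ _ h => absurd h (Nat.not_lt_zero _)) p (by omega)

end Coeff

namespace LocalGraph

variable {Γ : LocalGraph.{u, v}} {k : Type w} [Field k]

theorem length_walk (g : Γ.Germ) (hg : ¬ Γ.IsTruncated g) (n : ℕ) : (walk g hg n).length = n := by
  induction n with
  | zero => rfl
  | succ n ih => rw [walk, Path.length_cons, ih]

namespace IsBrauerGraph

variable (hΓ : Γ.IsBrauerGraph)

include hΓ

theorem coeff_eq_zero_of_rel {x : PathAlgebra k Γ.QVert} (hx : Rel k x) :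
    ∀ (a b : Γ.QVert) (p : Path a b), p.length < 2 → coeff x p = 0 := by
  intro a b p hp
  have key : ∀ (g : Γ.Germ) (hg : ¬ Γ.IsTruncated g) (a b : Γ.QVert) (p : Path a b),
      p.length < 2 → coeff (walkElt k g hg (Γ.fullLen g)) p = 0 := by
    intro g hg a b p hp
    refine coeff_ofPath_of_length_ne ?_
    have := hΓ.two_le_fullLen hg
    rw [length_walk]
    omega
  cases hx with
  | comm g h hg hh hne he =>
    rw [hΓ.cyclePow_eq, hΓ.cyclePow_eq, coeff_sub, key g hg _ _ p hp, key h hh _ _ p hp, sub_zero]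
  | leaf g h hg hne he hh =>
    rw [hΓ.cyclePow_eq]
    exact coeff_mul_eq_zero (n := 0) (key g hg) (fun _ _ _ h => absurd h (Nat.not_lt_zero _)) p
      (by omega)
  | zero g h hg hh he hne =>
    exact coeff_ofPath_mul_ofPath (n := 2) _ _ _ le_rfl hp

theorem exists_fullLen_le : ∃ N, ∀ g, Γ.fullLen g ≤ N := by
  have := hΓ.finite_germ
  obtain ⟨N, hN⟩ := (Set.finite_range Γ.fullLen).bddAbove
  exact ⟨N, fun g => hN ⟨g, rfl⟩⟩

theorem isAdmissible (hE : ¬ Γ.IsExcluded) : IsAdmissible (Γ.ideal k) := by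
  obtain ⟨N, hN⟩ := hΓ.exists_fullLen_le
  refine ⟨⟨N + 2, by omega, fun a b p hp => ?_⟩, fun x hx a b p hp => ?_⟩
  · refine (hΓ.ofPath_mem_or k hE p).resolve_right ?_
    rintro ⟨g, hg, -, hle, -⟩
    have := hN g
    omega
  · by_contra hlt
    exact hp (coeff_eq_zero_of_mem_span (fun x hx => hΓ.coeff_eq_zero_of_rel hx) hx a b p
      (by omega))

/-- Arrows starting at `a` are told apart by their germ, arrows ending at `a` by the successor of
their germ; both are among the two germs of the edge `a`. A non-zero product of two arrows forces
the second germ to be the successor of the first, and `next` is a bijection. -/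
theorem isSpecialBiserial : IsSpecialBiserial (Γ.ideal k) := by
  have hcard : ∀ (a : Γ.QVert) {α : Type (max u v)} (F : α → {g : Γ.Germ // Γ.edge g = a}),
      Function.Injective F → Nat.card α ≤ 2 := by
    intro a α F hF
    have h2 := hΓ.two_germs a
    have : Finite {g : Γ.Germ // Γ.edge g = a} := Nat.finite_of_card_ne_zero (by omega)
    exact (Nat.card_le_card_of_injective F hF).trans h2.le
  have heq : ∀ {a b : Γ.QVert} (α β : Σ c : Γ.QVert, a ⟶ c), α.2.1 = β.2.1 → α = β := by
    rintro a b ⟨c, g, hg⟩ ⟨c', g', hg'⟩ h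
    obtain rfl : g = g' := h
    obtain ⟨h1, rfl, h3⟩ := hg
    obtain ⟨h1', rfl, h3'⟩ := hg'
    rfl
  have heq' : ∀ {a b : Γ.QVert} (α β : Σ c : Γ.QVert, c ⟶ a), α.2.1 = β.2.1 → α = β := by
    rintro a b ⟨c, g, hg⟩ ⟨c', g', hg'⟩ h
    obtain rfl : g = g' := h
    obtain ⟨rfl, h2, h3⟩ := hg
    obtain ⟨rfl, h2', h3'⟩ := hg'
    rfl
  have hnext : ∀ {a b c : Γ.QVert} (α : a ⟶ b) (β : b ⟶ c),
      ofPath k (α.toPath.comp β.toPath) ∉ Γ.ideal k → Γ.next α.1 = β.1 := by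
    intro a b c α β h
    by_contra hne
    refine h ?_
    rw [← ofPath_mul_ofPath, ofPath_toPath_eq, ofPath_toPath_eq]
    exact arrowElt_mul_mem _ _ hne
  constructor
  · intro a
    exact hcard a (fun α => ⟨α.2.1, α.2.2.1⟩)
      fun α β h => heq (b := a) α β (congrArg Subtype.val h)
  · intro a
    exact hcard a (fun α => ⟨Γ.next α.2.1, α.2.2.2.1⟩)
      fun α β h => heq' (b := a) α β (Γ.next.injective (congrArg Subtype.val h))
  · intro a b α β β' h h'
    exact heq (b := a) _ _ ((hnext _ _ h).symm.trans (hnext _ _ h'))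
  · intro a b α γ γ' h h'
    exact heq' (b := a) _ _ (Γ.next.injective ((hnext _ _ h).trans (hnext _ _ h').symm))

theorem isFiniteQuiver : IsFiniteQuiver Γ.QVert := by
  have := hΓ.finite_germ
  exact ⟨inferInstance, fun a b => Subtype.finite⟩

theorem isConnectedQuiver (hE : ¬ Γ.IsExcluded) : IsConnectedQuiver Γ.QVert := by
  have hne : Nonempty Γ.Edge := not_isEmpty_iff.1 fun h => hE (Or.inl h)
  -- Lying in the same component of the quiver. It relates the edges of any two germs at a common
  -- vertex, and a chain of vertices in the graph then links any two edges.
  let J : Γ.Edge → Γ.Edge → Prop := fun a b =>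
    Nonempty (@Path (Symmetrify Γ.QVert) _ (show Γ.QVert from a) (show Γ.QVert from b))
  have Jrefl : ∀ a, J a a := fun a => ⟨Path.nil⟩
  have Jtrans : ∀ {a b c}, J a b → J b c → J a c := fun ⟨p⟩ ⟨q⟩ => ⟨p.comp q⟩
  have Jsymm : ∀ {a b}, J a b → J b a := fun ⟨p⟩ => ⟨p.reverse⟩
  have Jnext : ∀ g, J (Γ.edge g) (Γ.edge (Γ.next g)) := by
    intro g
    by_cases hg : Γ.IsTruncated g
    · rw [hg.1]; exact Jrefl _
    · exact ⟨Hom.toPath (V := Symmetrify Γ.QVert) (Sum.inl (arrow g hg))⟩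
  have Jpow : ∀ (n : ℕ) g, J (Γ.edge g) (Γ.edge ((Γ.next ^ n) g)) := by
    intro n g
    induction n with
    | zero => exact Jrefl _
    | succ n ih =>
      rw [pow_succ', Equiv.Perm.mul_apply]
      exact Jtrans ih (Jnext _)
  have Jvert : ∀ g h, Γ.vert g = Γ.vert h → J (Γ.edge g) (Γ.edge h) := by
    have := hΓ.finite_germ
    intro g h hgh
    obtain ⟨n, hn⟩ := ((hΓ.cyclic g h).1 hgh).exists_nat_pow_eq
    rw [← hn]
    exact Jpow n g
  refine ⟨hne, fun a b => ?_⟩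
  obtain ⟨g, rfl⟩ := hΓ.exists_germ a
  obtain ⟨h, rfl⟩ := hΓ.exists_germ b
  have key : ∀ y, Relation.ReflTransGen
      (fun x y => ∃ g h : Γ.Germ, Γ.edge g = Γ.edge h ∧ Γ.vert g = x ∧ Γ.vert h = y)
      (Γ.vert g) y → ∀ x, Γ.vert x = y → J (Γ.edge g) (Γ.edge x) := by
    intro y hy
    induction hy with
    | refl => exact fun x hx => Jvert _ _ hx.symm
    | tail _ hs ih =>
      obtain ⟨a, b, hab, ha, hb⟩ := hs
      intro x hx
      refine Jtrans (ih a ha) ?_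
      rw [hab]
      exact Jvert _ _ (hb.trans hx.symm)
  exact key _ (hΓ.connected _ _) h rfl

theorem moduleFinite (hE : ¬ Γ.IsExcluded) : Module.Finite k (Γ.BrauerGraphAlgebra k) := by
  have := hΓ.finite_germ
  obtain ⟨N, hN⟩ := hΓ.exists_fullLen_le
  let F : {g : Γ.Germ // ¬ Γ.IsTruncated g} × Fin (N + 1) → Γ.BrauerGraphAlgebra k :=
    fun x => quotMap (Γ.ideal k) (walkElt k x.1.1 x.1.2 x.2)
  refine ⟨Submodule.fg_def.2 ⟨Set.range F, Set.finite_range F, ?_⟩⟩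
  rw [eq_top_iff, ← span_pathClass, Submodule.span_le]
  rintro _ ⟨⟨a, b, p⟩, rfl⟩
  rcases hΓ.ofPath_mem_or k hE p with h | ⟨g, hg, -, hle, h⟩
  · have h0 : pathClass (Γ.ideal k) p = 0 := pathClass_eq_zero.2 h
    change pathClass (Γ.ideal k) p ∈ _
    rw [h0]
    exact Submodule.zero_mem _
  · refine Submodule.subset_span ⟨⟨⟨g, hg⟩, ⟨p.length, ?_⟩⟩, ?_⟩
    · have := hN g; omega
    · exact congrArg (quotMap (Γ.ideal k)) h.symm

/-- The socle elements `C_g ^ e` are essential: every non-zero element of the Brauer graph algebra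
has a non-zero multiple of one of them in the ideal it generates. -/
theorem exists_mul_mul_eq (hE : ¬ Γ.IsExcluded) {x : Γ.BrauerGraphAlgebra k} (hx : x ≠ 0) :
    ∃ (y z : Γ.BrauerGraphAlgebra k) (g : Γ.Germ) (hg : ¬ Γ.IsTruncated g) (c : k), c ≠ 0 ∧
      y * x * z = c • quotMap (Γ.ideal k) (walkElt k g hg (Γ.fullLen g)) := by
  classical
  obtain ⟨X, rfl⟩ := quotMap_surjective _ x
  let X' : TotalPath Γ.QVert →₀ k := X
  let S : Finset (TotalPath Γ.QVert) := X'.support.filter fun p => ofPath k p.2.2 ∉ Γ.ideal k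
  have hsum : quotMap (Γ.ideal k) X = ∑ p ∈ S, X' p • pathClass (Γ.ideal k) p.2.2 := by
    rw [quotMap_eq_sum, Finsupp.sum, Finset.sum_filter]
    refine Finset.sum_congr rfl fun p _ => ?_
    by_cases hp : ofPath k p.2.2 ∈ Γ.ideal k
    · rw [if_neg (not_not.2 hp), pathClass_eq_zero.2 hp, smul_zero]
    · rw [if_pos hp]
  have hX : ∀ p ∈ S, X' p ≠ 0 := fun p hp =>
    Finsupp.mem_support_iff.1 (Finset.mem_filter.1 hp).1
  -- The non-zero terms that stop before the socle, that is, proper initial segments of some `C_g ^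
  -- e`; trivial paths are among them.
  let T : Finset (TotalPath Γ.QVert) := S.filter fun p =>
    ∃ (g : Γ.Germ) (hg : ¬ Γ.IsTruncated g), qvert g = p.1 ∧ p.2.2.length < Γ.fullLen g ∧
      ofPath k p.2.2 = walkElt k g hg p.2.2.length
  have hmul : ∀ y z, y * quotMap (Γ.ideal k) X * z =
      ∑ p ∈ S, X' p • (y * pathClass (Γ.ideal k) p.2.2 * z) := by
    intro y z
    rw [hsum, Finset.mul_sum, Finset.sum_mul]
    exact Finset.sum_congr rfl fun p _ => by rw [mul_smul_comm, smul_mul_assoc]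
  by_cases hT : T.Nonempty
  · obtain ⟨p, hpT, hmin⟩ := Finset.exists_min_image T (fun p => p.2.2.length) hT
    obtain ⟨hpS, g, hg, hgp, hlt, hp⟩ := Finset.mem_filter.1 hpT
    obtain ⟨m, hm⟩ := Nat.exists_eq_add_of_lt hlt
    have hgn := not_isTruncated_pow hg p.2.2.length
    -- The left factor keeps only the terms starting where `p` starts; the right factor is the
    -- missing part of the walk that completes `p` to `C_g ^ e`.
    refine ⟨pathClass _ (Path.nil : Path p.1 p.1),
      quotMap _ (walkElt k ((Γ.next ^ p.2.2.length) g) hgn (m + 1)), g, hg, X' p, hX p hpS, ?_⟩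
    rw [hmul, Finset.sum_eq_single p]
    · congr 1
      rw [pathClass_nil_mul, ← quotMap_ofPath, ← map_mul, hp, ← walkElt_add, hm, add_assoc]
    · intro q hqS hqp
      obtain ⟨a, b, q⟩ := q
      by_cases ha : p.1 = a
      · subst ha
        rw [pathClass_nil_mul, ← quotMap_ofPath, ← map_mul, quotMap_eq_zero.2, smul_zero]
        obtain ⟨g', hg', hgq, hle', hq⟩ := (hΓ.ofPath_mem_or k hE q).resolve_left
          (Finset.mem_filter.1 hqS).2
        have hsplit : ∀ (h : Γ.Germ) (hh : ¬ Γ.IsTruncated h), ∃ y,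
            walkElt k h hh (m + 1) = arrowElt k h hh * y := by
          intro h hh
          rw [add_comm, walkElt_add, walkElt_one]
          exact ⟨_, rfl⟩
        obtain ⟨y, hy⟩ := hsplit _ hgn
        by_cases hlt' : q.length < Γ.fullLen g'
        · have hpq : p.2.2.length ≤ q.length :=
            hmin ⟨_, b, q⟩ (Finset.mem_filter.2 ⟨hqS, g', hg', hgq, hlt', hq⟩)
          by_cases hq0 : q.length = 0
          · exfalso
            have hp0 : p.2.2.length = 0 := by omega
            obtain ⟨a, c, p⟩ := p
            obtain rfl := Path.eq_of_length_zero q hq0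
            obtain rfl := Path.eq_of_length_zero p hp0
            obtain rfl := Path.eq_nil_of_length_zero q hq0
            obtain rfl := Path.eq_nil_of_length_zero p hp0
            exact hqp rfl
          -- A competing term `q` of positive length either takes a forbidden turn into the
          -- completing walk, or it continues along the same vertex. In the second case it is longer
          -- than `p` and overshoots the full length, or equally long and then equal to `p`.
          · by_cases hne : (Γ.next ^ q.length) g' = (Γ.next ^ p.2.2.length) g
            · rw [hq, ← walkElt_congr hne (not_isTruncated_pow hg' _) hgn, ← walkElt_add]
              have hL : Γ.fullLen g' = Γ.fullLen g := by
                rw [← hΓ.fullLen_next_pow g' q.length, hne, hΓ.fullLen_next_pow]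
              refine hΓ.walkElt_mem_of_lt hg' ?_
              rcases hpq.lt_or_eq with h | h
              · omega
              · exfalso
                rw [← h] at hne
                obtain rfl := (Γ.next ^ p.2.2.length).injective hne
                exact hqp (ofPath_injective (k := k) (by rw [hp, h, hq]))
            · obtain ⟨n, hn⟩ := Nat.exists_eq_succ_of_ne_zero hq0
              rw [hy, hq, ← mul_assoc]
              refine (Γ.ideal k).mul_mem_right _ _ ?_
              rw [hn] at hne ⊢
              rw [Nat.succ_eq_add_one, walkElt_succ, mul_assoc]
              refine (Γ.ideal k).mul_mem_left _ _ (arrowElt_mul_mem _ _ ?_)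
              rwa [← Equiv.Perm.mul_apply, ← pow_succ']
        · rw [hy, hq, le_antisymm hle' (not_lt.1 hlt'), ← mul_assoc]
          exact (Γ.ideal k).mul_mem_right _ _ (hΓ.walkElt_fullLen_mul_arrowElt_mem hg' _)
      · rw [pathClass_mul_of_ne _ _ ha, zero_mul, smul_zero]
    · exact fun h => absurd hpS h
  -- Now every term is some `C_h ^ e`, and at a fixed starting vertex all of these coincide by
  -- relation (i).
  · have hi : ∃ a : Γ.QVert,
        pathClass (Γ.ideal k) (Path.nil : Path a a) * quotMap (Γ.ideal k) X ≠ 0 := by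
      by_contra hcon
      push Not at hcon
      refine hx ?_
      rw [← one_mul (quotMap (Γ.ideal k) X), one_eq_sum_pathClass, Finset.sum_mul]
      exact Finset.sum_eq_zero fun a _ => hcon a
    obtain ⟨a, ha⟩ := hi
    obtain ⟨g, hga, hg⟩ := hΓ.exists_not_isTruncated hE a
    have hmain : pathClass (Γ.ideal k) (Path.nil : Path a a) * quotMap (Γ.ideal k) X * 1 =
        (∑ p ∈ S, if p.1 = a then X' p else 0) •
          quotMap (Γ.ideal k) (walkElt k g hg (Γ.fullLen g)) := by
      rw [hmul, Finset.sum_smul]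
      refine Finset.sum_congr rfl fun p hpS => ?_
      obtain ⟨b, c, p⟩ := p
      split_ifs with hb
      · dsimp only at hb
        subst hb
        rw [pathClass_nil_mul, mul_one]
        congr 1
        obtain ⟨h, hh, hhp, hle, hp⟩ := (hΓ.ofPath_mem_or k hE p).resolve_left
          (Finset.mem_filter.1 hpS).2
        have hfull : p.length = Γ.fullLen h := by
          by_contra hlt
          exact hT ⟨⟨_, c, p⟩,
            Finset.mem_filter.2 ⟨hpS, h, hh, hhp, lt_of_le_of_ne hle hlt, hp⟩⟩
        rw [← quotMap_ofPath, hp, hfull, ← sub_eq_zero, ← map_sub, quotMap_eq_zero]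
        exact hΓ.comm_mem hh hg (hhp.trans hga.symm)
      · rw [pathClass_mul_of_ne _ _ (fun h => hb h.symm), zero_mul, smul_zero, zero_smul]
    -- The total coefficient is non-zero because the component of the element at `a` is.
    refine ⟨_, _, g, hg, _, fun hc => ha ?_, hmain⟩
    rw [hc, zero_smul, mul_one] at hmain
    exact hmain

theorem isSymmetricAlgebra (hE : ¬ Γ.IsExcluded) :
    IsSymmetricAlgebra k (Γ.BrauerGraphAlgebra k) := by
  have := hΓ.moduleFinite (k := k) hE
  let f : Γ.BrauerGraphAlgebra k →ₗ[k] k := quotLiftLin (form k) fun x hx => hΓ.form_of_mem hx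
  have hf : ∀ x y, f (x * y) = f (y * x) := by
    intro x y
    obtain ⟨x, rfl⟩ := quotMap_surjective _ x
    obtain ⟨y, rfl⟩ := quotMap_surjective _ y
    rw [← map_mul, ← map_mul]
    exact hΓ.form_mul_comm x y
  refine isSymmetricAlgebra_of_form f hf fun x hx => ?_
  by_contra hne
  obtain ⟨y, z, g, hg, c, hc, h⟩ := hΓ.exists_mul_mul_eq hE hne
  have h1 : f (y * x * z) = 0 := by rw [mul_assoc, hf, mul_assoc, hx]
  have h2 : f (quotMap (Γ.ideal k) (walkElt k g hg (Γ.fullLen g))) = 1 :=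
    form_walkElt_fullLen g hg
  rw [h, map_smul, h2, smul_eq_mul, mul_one] at h1
  exact hc h1

/-- This separates Brauer graph algebras from `k` and `k[x]/(x²)`, of dimensions one and two. A
trivial path and an arrow are independent modulo `R ^ 2`, and the form detects the socle element. -/
theorem three_le_finrank (hE : ¬ Γ.IsExcluded) :
    3 ≤ Module.finrank k (Γ.BrauerGraphAlgebra k) := by
  have := hΓ.moduleFinite (k := k) hE
  obtain ⟨e⟩ : Nonempty Γ.Edge := not_isEmpty_iff.1 fun h => hE (Or.inl h)
  obtain ⟨g, -, hg⟩ := hΓ.exists_not_isTruncated hE e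
  let t : Path (qvert g) (qvert g) := Path.nil
  let C := walkElt k g hg (Γ.fullLen g)
  let F : Fin 3 → Γ.BrauerGraphAlgebra k := ![quotMap (Γ.ideal k) (ofPath k t),
    quotMap (Γ.ideal k) (arrowElt k g hg), quotMap (Γ.ideal k) C]
  have hF : LinearIndependent k F := by
    rw [Fintype.linearIndependent_iff]
    intro c hc
    rw [Fin.sum_univ_three] at hc
    change c 0 • quotMap (Γ.ideal k) (ofPath k t) +
      c 1 • quotMap (Γ.ideal k) (arrowElt k g hg) + c 2 • quotMap (Γ.ideal k) C = 0 at hc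
    rw [← map_smul, ← map_smul, ← map_smul, ← map_add, ← map_add, quotMap_eq_zero] at hc
    have hL := hΓ.two_le_fullLen hg
    have h1 : ∀ {a b : Γ.QVert} (p : Path a b), p.length < 2 → coeff C p = 0 := by
      intro a b p hp
      refine coeff_ofPath_of_length_ne ?_
      rw [length_walk]
      omega
    have h0 : ∀ {a b : Γ.QVert} (p : Path a b), p.length < 2 →
        c 0 * coeff (ofPath k t) p + c 1 * coeff (arrowElt k g hg) p = 0 := by
      intro a b p hp
      by_contra hne
      refine length_one_notMem (hΓ.isAdmissible hE) hp ?_ hc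
      rwa [coeff_add, coeff_add, coeff_smul, coeff_smul, coeff_smul, h1 p hp, mul_zero, add_zero]
    have hc0 : c 0 = 0 := by
      have := h0 t (by simp [t])
      rwa [coeff_ofPath_self, arrowElt, coeff_ofPath_of_length_ne (by simp [t]), mul_one, mul_zero,
        add_zero] at this
    have hc1 : c 1 = 0 := by
      have := h0 (arrow g hg).toPath (by simp)
      rwa [hc0, zero_mul, zero_add, arrowElt, coeff_ofPath_self, mul_one] at this
    have hc2 : c 2 = 0 := by
      rw [hc0, hc1, zero_smul, zero_smul, zero_add, zero_add] at hc
      have := hΓ.form_of_mem hc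
      rwa [map_smul, form_walkElt_fullLen, smul_eq_mul, mul_one] at this
    intro i
    fin_cases i
    · exact hc0
    · exact hc1
    · exact hc2
  simpa using hF.fintype_card_le_finrank

theorem not_isExcludedAlgebra (hE : ¬ Γ.IsExcluded) :
    ¬ IsExcludedAlgebra k (Γ.BrauerGraphAlgebra k) := by
  have h3 := hΓ.three_le_finrank (k := k) hE
  rintro (⟨⟨e⟩⟩ | ⟨⟨e⟩⟩)
  · rw [e.toLinearEquiv.finrank_eq, Module.finrank_self] at h3
    omega
  · have h2 : Module.finrank k (DualNumber k) = 2 := by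
      have : Module.finrank k (k × k) = 2 := by
        rw [Module.finrank_prod, Module.finrank_self]
      exact this
    rw [e.toLinearEquiv.finrank_eq, h2] at h3
    omega

end IsBrauerGraph

end LocalGraph

/-! ## Rotations and powers of cyclic paths -/

section Rotation

variable {V : Type u} [Quiver.{v} V]

theorem exists_eq_comp_of_le {a b : V} (p : Path a b) {n : ℕ} (hn : n ≤ p.length) :
    ∃ (c : V) (q : Path a c) (r : Path c b), p = q.comp r ∧ q.length = n := by
  induction p with
  | nil => exact ⟨a, Path.nil, Path.nil, rfl, (Nat.le_zero.1 hn).symm⟩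
  | cons p e ih =>
    by_cases h : n ≤ p.length
    · obtain ⟨c, q, r, rfl, hq⟩ := ih h
      exact ⟨c, q, r.cons e, rfl, hq⟩
    · refine ⟨_, p.cons e, Path.nil, rfl, ?_⟩
      rw [Path.length_cons] at hn ⊢
      omega

/-- Stated in a sigma type because the equality of the intermediate vertices is part of the
conclusion. -/
theorem eq_of_comp_eq_comp {a b b' c : V} {p : Path a b} {q : Path b c} {p' : Path a b'}
    {q' : Path b' c} (h : p.comp q = p'.comp q') (hl : p.length = p'.length) :
    (⟨b, p, q⟩ : Σ x : V, Path a x × Path x c) = ⟨b', p', q'⟩ := by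
  have hlen := congrArg Path.length h
  rw [Path.length_comp, Path.length_comp] at hlen
  induction q with
  | nil =>
    obtain rfl := Path.eq_of_length_zero q' (by rw [Path.length_nil] at hlen; omega)
    obtain rfl := Path.eq_nil_of_length_zero q' (by rw [Path.length_nil] at hlen; omega)
    rw [Path.comp_nil, Path.comp_nil] at h
    rw [h]
  | cons q e ih =>
    cases q' with
    | nil => rw [Path.length_cons, Path.length_nil] at hlen; omega
    | cons q' e' =>
      rw [Path.comp_cons, Path.comp_cons] at h
      obtain rfl := Path.obj_eq_of_cons_eq_cons h
      have h1 := eq_of_heq (Path.heq_of_cons_eq_cons h)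
      obtain rfl := eq_of_heq (Path.hom_heq_of_cons_eq_cons h)
      rw [Path.length_cons, Path.length_cons] at hlen
      have h2 := ih h1 (by omega)
      obtain ⟨rfl, h3⟩ := Sigma.mk.inj h2
      obtain ⟨rfl, rfl⟩ := Prod.mk.inj (eq_of_heq h3)
      rfl

theorem rotate_toPath_comp {a b : V} (e : a ⟶ b) (q : Path b a) :
    rotate V ⟨a, e.toPath.comp q⟩ = ⟨b, q.comp e.toPath⟩ := rotateFun_comp e q

theorem rotate_pow_comp {a b : V} (p : Path a b) (q : Path b a) :
    (rotate V ^ p.length) ⟨a, p.comp q⟩ = ⟨b, q.comp p⟩ := by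
  induction hn : p.length generalizing a with
  | zero =>
    obtain rfl := Path.eq_of_length_zero p hn
    obtain rfl := Path.eq_nil_of_length_zero p hn
    rw [Path.nil_comp, Path.comp_nil]
    rfl
  | succ n ih =>
    obtain ⟨c, e, p, rfl, hp⟩ := (Path.length_ne_zero_iff_eq_comp p).1 (by omega)
    rw [pow_succ, Equiv.Perm.mul_apply, Path.comp_assoc, rotate_toPath_comp, Path.comp_assoc,
      ih p (q.comp e.toPath) (by omega), Path.comp_assoc]

theorem rotate_pow_length (p : CyclicPath V) : (rotate V ^ p.2.length) p = p := by
  have := rotate_pow_comp p.2 Path.nil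
  rwa [Path.comp_nil, Path.nil_comp] at this

theorem isPeriodicPt_rotate {p : CyclicPath V} {n : ℕ} :
    Function.IsPeriodicPt (rotate V) n p ↔ (rotate V ^ n) p = p := by
  rw [Function.IsPeriodicPt, Function.IsFixedPt, Equiv.Perm.iterate_eq_pow]

theorem length_pathPow {a : V} (c : Path a a) (m : ℕ) : (pathPow c m).length = m * c.length := by
  induction m with
  | zero => rw [pathPow, zero_mul]; rfl
  | succ m ih => rw [pathPow, Path.length_comp, ih, add_mul, one_mul]

theorem pathPow_add {a : V} (c : Path a a) (m n : ℕ) :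
    pathPow c (m + n) = (pathPow c m).comp (pathPow c n) := by
  induction n with
  | zero => rw [add_zero, pathPow, Path.comp_nil]
  | succ n ih => rw [← add_assoc, pathPow, ih, pathPow, Path.comp_assoc]

theorem pathPow_mul {a : V} (c : Path a a) (m n : ℕ) :
    pathPow c (m * n) = pathPow (pathPow c m) n := by
  induction n with
  | zero => rfl
  | succ n ih => rw [mul_add, mul_one, pathPow_add, ih, pathPow]

theorem rotate_pow_cyclicPow (c : CyclicPath V) (m : ℕ) :
    (rotate V ^ c.2.length) (cyclicPow c m) = cyclicPow c m := by
  obtain ⟨a, c⟩ := c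
  cases m with
  | zero =>
    have h : rotate V ⟨a, Path.nil⟩ = ⟨a, Path.nil⟩ := rfl
    exact Equiv.Perm.pow_apply_eq_self_of_apply_eq_self h _
  | succ m =>
    have h1 : cyclicPow (⟨a, c⟩ : CyclicPath V) (m + 1) = ⟨a, c.comp (pathPow c m)⟩ := by
      rw [comp_pathPow]; rfl
    rw [h1, rotate_pow_comp, comp_pathPow]

/-- A path `r` commuting with `c` and at least as long begins with `c`; cutting this off leaves a
shorter path that still commutes with `c`. -/
theorem eq_pathPow_of_comm {a : V} {c r : Path a a} (h : c.comp r = r.comp c) {k : ℕ}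
    (hr : r.length = k * c.length) : r = pathPow c k := by
  induction k generalizing r with
  | zero => exact Path.eq_nil_of_length_zero r (by rw [hr, zero_mul])
  | succ k ih =>
    obtain ⟨b, s, t, rfl, hs⟩ := exists_eq_comp_of_le r (n := c.length) (by rw [hr, add_mul]; omega)
    have h1 : c.comp (s.comp t) = s.comp (t.comp c) := by rw [h, Path.comp_assoc]
    obtain ⟨rfl, h2⟩ := Sigma.mk.inj (eq_of_comp_eq_comp h1 hs.symm)
    obtain ⟨rfl, h3⟩ := Prod.mk.inj (eq_of_heq h2)
    rw [Path.length_comp, add_mul] at hr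
    rw [ih h3 (by omega), comp_pathPow]
    rfl

/-- The period of a cyclic path under rotation times its multiplicity is its length. -/
theorem minimalPeriod_mul_multiplicity (p : CyclicPath V) (hp : p.2.length ≠ 0) :
    Function.minimalPeriod (rotate V) p * multiplicity p = p.2.length := by
  obtain ⟨a, p⟩ := p
  have hper : Function.IsPeriodicPt (rotate V) p.length (⟨a, p⟩ : CyclicPath V) :=
    isPeriodicPt_rotate.2 (rotate_pow_length ⟨a, p⟩)
  have hdvd := hper.minimalPeriod_dvd
  have hpos := hper.minimalPeriod_pos (Nat.pos_of_ne_zero hp)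
  have hrot := isPeriodicPt_rotate.1
    (Function.isPeriodicPt_minimalPeriod (rotate V) (⟨a, p⟩ : CyclicPath V))
  have hmin : ∀ n, (rotate V ^ n) (⟨a, p⟩ : CyclicPath V) = ⟨a, p⟩ →
      Function.minimalPeriod (rotate V) (⟨a, p⟩ : CyclicPath V) ∣ n :=
    fun n hn => (isPeriodicPt_rotate.2 hn).minimalPeriod_dvd
  generalize Function.minimalPeriod (rotate V) (⟨a, p⟩ : CyclicPath V) = d at *
  dsimp only at hp ⊢
  obtain ⟨m, hm⟩ := hdvd
  have hm0 : m ≠ 0 := by rintro rfl; exact hp hm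
  -- The path is cut after one period `d`. Invariance under rotation by `d` says that the two pieces
  -- commute, so the path is a power of the first piece `c`.
  obtain ⟨b, c, r, rfl, hc⟩ := exists_eq_comp_of_le p (n := d)
    (by rw [hm]; exact Nat.le_mul_of_pos_right d (Nat.pos_of_ne_zero hm0))
  rw [← hc, rotate_pow_comp] at hrot
  obtain ⟨rfl, h1⟩ := Sigma.mk.inj hrot
  have h1 := eq_of_heq h1
  obtain ⟨j, rfl⟩ := Nat.exists_eq_succ_of_ne_zero hm0
  have h2 : c.comp r = pathPow c (j + 1) := by
    have : r = pathPow c j := by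
      refine eq_pathPow_of_comm h1.symm ?_
      rw [Path.length_comp, hc, Nat.succ_eq_add_one, mul_add, mul_one, mul_comm] at hm
      rw [hc]
      omega
    rw [this, comp_pathPow]; rfl
  -- Both inclusions use the minimality of `d`: rotation by the length of any root fixes the path,
  -- so this length is a multiple of `d`. The supremum in `multiplicity` is then taken over a
  -- singleton.
  have hset : {m | ∃ c' : CyclicPath V, IsSimpleCycle c' ∧
      (⟨b, c.comp r⟩ : CyclicPath V) = cyclicPow c' m} = {j + 1} := by
    ext n
    constructor
    · rintro ⟨⟨b', c'⟩, hs, h⟩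
      obtain ⟨rfl, h⟩ := Sigma.mk.inj h
      have h := eq_of_heq h
      have hl : d ∣ c'.length := by
        refine hmin _ ?_
        rw [h]
        exact rotate_pow_cyclicPow ⟨_, c'⟩ n
      obtain ⟨t, ht⟩ := hl
      have hlen : n * c'.length = d * (j + 1) := by
        rw [← length_pathPow]
        exact (congrArg Path.length h).symm.trans hm
      rw [ht, ← mul_assoc, mul_comm n d, mul_assoc] at hlen
      have hlen' : n * t = j + 1 := Nat.eq_of_mul_eq_mul_left hpos hlen
      have hn0 : n ≠ 0 := by rintro rfl; simp at hlen'
      obtain ⟨i, rfl⟩ := Nat.exists_eq_succ_of_ne_zero hn0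
      have hle : t ≤ j + 1 := by rw [← hlen']; exact Nat.le_mul_of_pos_left t (by omega)
      obtain ⟨s, hs'⟩ := Nat.exists_eq_add_of_le hle
      have h3 : c'.comp (pathPow c' i) = (pathPow c t).comp (pathPow c s) := by
        rw [comp_pathPow, ← pathPow_add, ← hs', ← h2, h]
        rfl
      have h4 : c' = pathPow c t :=
        ((Path.comp_inj' (by rw [ht, length_pathPow, hc, mul_comm])).1 h3).1
      have h5 : t = 1 := hs.2 ⟨_, c⟩ t (by rw [h4]; rfl)
      rw [h5, mul_one] at hlen'
      exact hlen'
    · rintro rfl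
      refine ⟨⟨b, c⟩, ⟨by rw [hc]; exact hpos, ?_⟩, by rw [h2]; rfl⟩
      rintro ⟨b', e⟩ t h
      obtain ⟨rfl, h⟩ := Sigma.mk.inj h
      have h := eq_of_heq h
      have hl : d ∣ e.length := by
        refine hmin _ ?_
        rw [h2, h, ← pathPow_mul]
        exact rotate_pow_cyclicPow ⟨_, e⟩ (t * (j + 1))
      have hlen : d = t * e.length := by rw [← hc, h, length_pathPow]
      have he : e.length = d := Nat.dvd_antisymm (hlen ▸ Dvd.intro_left t rfl) hl
      rw [he] at hlen
      exact Nat.eq_of_mul_eq_mul_right hpos (by omega)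
  rw [multiplicity, if_neg hp, hset, csSup_singleton, hm]

theorem toPath_comp_eq {a b b' c : V} {e : a ⟶ b} {q : Path b c} {e' : a ⟶ b'} {q' : Path b' c}
    (h : e.toPath.comp q = e'.toPath.comp q') : (⟨b, e⟩ : Σ b, a ⟶ b) = ⟨b', e'⟩ := by
  obtain ⟨rfl, h1⟩ := Sigma.mk.inj (eq_of_comp_eq_comp h rfl)
  have h2 := (Prod.mk.inj (eq_of_heq h1)).1
  rw [eq_of_heq (Path.hom_heq_of_cons_eq_cons h2)]

end Rotation

/-! ## Maximal paths in a symmetric special biserial algebra -/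

section MaximalPaths

variable {k : Type w} {V : Type u} [Quiver.{v} V] [Field k] [Finite V]

/-- A special biserial bound quiver with a symmetrizing form on its algebra. -/
structure IsSymmetrized (I : TwoSidedIdeal (PathAlgebra k V)) (f : BoundAlgebra I →ₗ[k] k) :
    Prop where
  admissible : IsAdmissible I
  specialBiserial : IsSpecialBiserial I
  comm : ∀ x y, f (x * y) = f (y * x)
  nondeg : ∀ x, (∀ y, f (x * y) = 0) → x = 0

/-- Non-trivial maximal paths from a vertex to itself. -/
def IsMaxCycle (I : TwoSidedIdeal (PathAlgebra k V)) (p : CyclicPath V) : Prop :=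
  0 < p.2.length ∧ IsMaximalPath I p.2

variable {I : TwoSidedIdeal (PathAlgebra k V)} {f : BoundAlgebra I →ₗ[k] k}

theorem notMem_of_form_ne {a b : V} {p : Path a b} (h : f (pathClass I p) ≠ 0) :
    ofPath k p ∉ I := by
  intro hp
  rw [pathClass_eq_zero.2 hp, map_zero] at h
  exact h rfl

theorem IsMaximalPath.comp_mem {a b c : V} {p : Path a b} (hp : IsMaximalPath I p)
    (r : Path b c) (hr : r.length ≠ 0) : ofPath k (p.comp r) ∈ I := by
  obtain ⟨c, e, r, rfl, -⟩ := (Path.length_ne_zero_iff_eq_comp r).1 hr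
  rw [← Path.comp_assoc]
  exact ofPath_comp_mem_left (hp.2.2 _ e) r

namespace IsSymmetrized

variable (hf : IsSymmetrized I f)

include hf

theorem exists_form_mul_ne {x : BoundAlgebra I} (hx : x ≠ 0) :
    ∃ (a b : V) (p : Path a b), f (x * pathClass I p) ≠ 0 := by
  by_contra hcon
  push Not at hcon
  refine hx (hf.nondeg x fun y => ?_)
  have h : f.comp (LinearMap.mulLeft k x) = 0 := linearMap_ext_pathClass hcon
  exact LinearMap.congr_fun h y

/-- By symmetry the idempotent at the end of `p` can be moved to its front, where it kills `p`
unless the two vertices agree. -/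
theorem eq_of_form_ne {a b : V} {p : Path a b} (h : f (pathClass I p) ≠ 0) : a = b := by
  by_contra hne
  refine h ?_
  rw [← pathClass_mul_nil, hf.comm, pathClass_mul_of_ne _ _ fun h => hne h.symm, map_zero]

/-- Non-degeneracy gives a path `q` with `f(pq) ≠ 0`, and right maximality leaves only the trivial
one. -/
theorem form_ne_of_right_maximal {a b : V} {p : Path a b} (hp : ofPath k p ∉ I)
    (hmax : ∀ (c : V) (α : b ⟶ c), ofPath k (p.comp α.toPath) ∈ I) : f (pathClass I p) ≠ 0 := by
  obtain ⟨c, d, q, hq⟩ := hf.exists_form_mul_ne fun h => hp (pathClass_eq_zero.1 h)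
  by_cases hbc : b = c
  · subst hbc
    rw [← pathClass_comp] at hq
    by_cases hq0 : q.length = 0
    · obtain rfl := Path.eq_of_length_zero q hq0
      obtain rfl := Path.eq_nil_of_length_zero q hq0
      rwa [Path.comp_nil] at hq
    · obtain ⟨c, α, q, rfl, -⟩ := (Path.length_ne_zero_iff_eq_comp q).1 hq0
      refine absurd ?_ (notMem_of_form_ne hq)
      rw [← Path.comp_assoc]
      exact ofPath_comp_mem_left (hmax c α) q
  · rw [pathClass_mul_of_ne _ _ hbc, map_zero] at hq
    exact absurd rfl hq

/-- If `αp` were non-zero, it would again be right maximal, so `f(αp) = f(pα)` would be non-zero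
although `pα` is zero. -/
theorem isMaximalPath_of_right_maximal {a b : V} {p : Path a b} (hp : ofPath k p ∉ I)
    (hmax : ∀ (c : V) (α : b ⟶ c), ofPath k (p.comp α.toPath) ∈ I) : IsMaximalPath I p := by
  refine ⟨hp, fun c α => ?_, hmax⟩
  by_contra hα
  have h1 := hf.form_ne_of_right_maximal hα fun d β => by
    rw [Path.comp_assoc]
    exact ofPath_comp_mem_right _ (hmax d β)
  obtain rfl := hf.eq_of_form_ne h1
  rw [pathClass_comp, hf.comm, ← pathClass_comp] at h1
  exact notMem_of_form_ne h1 (hmax a α)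

theorem form_ne_of_isMaximalPath {a b : V} {p : Path a b} (hp : IsMaximalPath I p) :
    f (pathClass I p) ≠ 0 := hf.form_ne_of_right_maximal hp.1 hp.2.2

theorem exists_right_maximal {a b : V} {p : Path a b} (hp : ofPath k p ∉ I) :
    ∃ (c : V) (q : Path b c), IsMaximalPath I (p.comp q) := by
  obtain ⟨N, -, hN⟩ := hf.admissible.1
  -- Admissibility bounds the length of non-zero paths by `N`, so prolonging must stop.
  induction hn : N - p.length generalizing b with
  | zero => exact absurd (hN a b p (by omega)) hp
  | succ n ih =>
    by_cases hmax : ∀ (c : V) (α : b ⟶ c), ofPath k (p.comp α.toPath) ∈ I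
    · exact ⟨b, Path.nil, hf.isMaximalPath_of_right_maximal hp hmax⟩
    · push Not at hmax
      obtain ⟨c, α, hα⟩ := hmax
      obtain ⟨d, q, hq⟩ := ih hα (by rw [Path.length_comp, Path.length_toPath]; omega)
      exact ⟨d, α.toPath.comp q, by rwa [← Path.comp_assoc]⟩

/-- Every arrow is the first arrow of a maximal path, which is cyclic. -/
theorem exists_isMaximalPath {a b : V} (α : a ⟶ b) :
    ∃ q : Path b a, IsMaximalPath I (α.toPath.comp q) := by
  obtain ⟨c, q, hq⟩ := hf.exists_right_maximal
    (ofPath_notMem hf.admissible (p := α.toPath) (by simp))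
  obtain rfl := hf.eq_of_form_ne (hf.form_ne_of_isMaximalPath hq)
  exact ⟨q, hq⟩

/-- The non-zero paths with first arrow `α` form a chain: where two of them would part, both
continuations of the last common arrow are non-zero, and (S2) identifies them. The shared arrow `α`
provides the start. -/
theorem exists_eq_comp {a b c d : V} {α : a ⟶ b} {q : Path b c} {q' : Path b d}
    (hq : ofPath k (α.toPath.comp q) ∉ I) (hq' : ofPath k (α.toPath.comp q') ∉ I)
    (hle : q.length ≤ q'.length) : ∃ r : Path c d, q' = q.comp r := by
  induction q with
  | nil => exact ⟨q', (Path.nil_comp q').symm⟩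
  | cons q e ih =>
    rw [Path.length_cons] at hle
    obtain ⟨r, rfl⟩ := ih (fun h => hq (by
      rw [← Path.comp_toPath_eq_cons, ← Path.comp_assoc]
      exact ofPath_comp_mem_left h _)) (by omega)
    rw [Path.length_comp] at hle
    obtain ⟨x, e', r, rfl, -⟩ := (Path.length_ne_zero_iff_eq_comp r).1 (by omega)
    obtain ⟨y, s, β, hs⟩ := (Path.length_ne_zero_iff_eq_cons _).1
      (show (α.toPath.comp q).length ≠ 0 by rw [Path.length_comp, Path.length_toPath]; omega)
    have h1 : ofPath k (β.toPath.comp e.toPath) ∉ I := fun h => hq (by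
      rw [← Path.comp_toPath_eq_cons, ← Path.comp_assoc, hs, ← Path.comp_toPath_eq_cons,
        Path.comp_assoc]
      exact ofPath_comp_mem_right _ h)
    have h2 : ofPath k (β.toPath.comp e'.toPath) ∉ I := fun h => hq' (by
      rw [← Path.comp_assoc, ← Path.comp_assoc, hs, ← Path.comp_toPath_eq_cons, Path.comp_assoc s]
      exact ofPath_comp_mem_left (ofPath_comp_mem_right _ h) _)
    have h3 := hf.specialBiserial.right_unique _ _ β ⟨_, e⟩ ⟨_, e'⟩ h1 h2
    obtain ⟨rfl, h4⟩ := Sigma.mk.inj h3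
    obtain rfl := eq_of_heq h4
    exact ⟨r, by rw [← Path.comp_assoc, Path.comp_toPath_eq_cons]⟩

theorem length_le_of_isMaximalPath {a b c d : V} {α : a ⟶ b} {q : Path b c} {q' : Path b d}
    (hq : IsMaximalPath I (α.toPath.comp q)) (hq' : ofPath k (α.toPath.comp q') ∉ I) :
    q'.length ≤ q.length := by
  by_contra hlt
  obtain ⟨r, rfl⟩ := hf.exists_eq_comp hq.1 hq' (by omega)
  rw [Path.length_comp] at hlt
  refine hq' ?_
  rw [← Path.comp_assoc]
  exact hq.comp_mem r (by omega)

theorem eq_of_isMaximalPath {a b : V} {α : a ⟶ b} {q q' : Path b a}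
    (hq : IsMaximalPath I (α.toPath.comp q)) (hq' : IsMaximalPath I (α.toPath.comp q')) :
    q = q' := by
  have hl : q.length = q'.length := le_antisymm (hf.length_le_of_isMaximalPath hq' hq.1)
    (hf.length_le_of_isMaximalPath hq hq'.1)
  obtain ⟨r, rfl⟩ := hf.exists_eq_comp hq.1 hq'.1 hl.le
  rw [Path.length_comp] at hl
  rw [Path.eq_nil_of_length_zero r (by omega), Path.comp_nil]

/-- The form is non-zero on `qα`. If `qαγ` were non-zero, it would extend to a maximal cycle;
rotating that one to begin with `α` gives a non-zero path longer than the maximal path `αq`. -/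
theorem isMaximalPath_rotate {a b : V} {α : a ⟶ b} {q : Path b a}
    (hq : IsMaximalPath I (α.toPath.comp q)) : IsMaximalPath I (q.comp α.toPath) := by
  have h1 := hf.form_ne_of_isMaximalPath hq
  rw [pathClass_comp, hf.comm, ← pathClass_comp] at h1
  refine hf.isMaximalPath_of_right_maximal (notMem_of_form_ne h1) fun d γ => ?_
  by_contra hγ
  obtain ⟨c, r, hr⟩ := hf.exists_right_maximal hγ
  have h2 := hf.form_ne_of_isMaximalPath hr
  obtain rfl := hf.eq_of_form_ne h2
  rw [Path.comp_assoc, Path.comp_assoc, pathClass_comp, hf.comm, ← pathClass_comp,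
    Path.comp_assoc] at h2
  have h3 := hf.length_le_of_isMaximalPath hq (notMem_of_form_ne h2)
  simp only [Path.length_comp, Path.length_toPath] at h3
  omega

theorem isMaxCycle_rotate_of {p : CyclicPath V} (hp : IsMaxCycle I p) :
    IsMaxCycle I (rotate V p) := by
  refine ⟨by rw [length_rotate]; exact hp.1, ?_⟩
  obtain ⟨a, p⟩ := p
  obtain ⟨hp1, hp2⟩ := hp
  obtain ⟨b, α, q, rfl, -⟩ := (Path.length_ne_zero_iff_eq_comp p).1 hp1.ne'
  rw [rotate_toPath_comp]
  exact hf.isMaximalPath_rotate hp2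

theorem isMaxCycle_rotate_pow {p : CyclicPath V} (hp : IsMaxCycle I p) (n : ℕ) :
    IsMaxCycle I ((rotate V ^ n) p) := by
  induction n with
  | zero => exact hp
  | succ n ih =>
    rw [pow_succ', Equiv.Perm.mul_apply]
    exact hf.isMaxCycle_rotate_of ih

theorem isMaxCycle_rotate {p : CyclicPath V} : IsMaxCycle I (rotate V p) ↔ IsMaxCycle I p := by
  refine ⟨fun h => ?_, hf.isMaxCycle_rotate_of⟩
  have hpos := h.1
  rw [length_rotate] at hpos
  -- Rotating back by one arrow is the same as rotating forward by the length minus one.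
  obtain ⟨n, hn⟩ := Nat.exists_eq_succ_of_ne_zero hpos.ne'
  have h1 := hf.isMaxCycle_rotate_pow h n
  rwa [← Equiv.Perm.mul_apply, ← pow_succ, ← Nat.succ_eq_add_one, ← hn, rotate_pow_length] at h1

theorem isMaxCycle_of_sameCycle {p q : CyclicPath V} (hp : IsMaxCycle I p)
    (h : (rotate V).SameCycle p q) : IsMaxCycle I q := by
  obtain ⟨n, rfl⟩ := h
  induction n with
  | zero => exact hp
  | succ n ih =>
    rw [add_comm, zpow_add, zpow_one, Equiv.Perm.mul_apply]
    exact hf.isMaxCycle_rotate_of ih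
  | pred n ih =>
    rw [← hf.isMaxCycle_rotate, ← Equiv.Perm.mul_apply, ← zpow_one_add, add_sub_cancel]
    exact ih

/-- Maximal cycles are stable under rotation and trivial paths are fixed by it, so closing up under
rotation adds nothing. -/
theorem isGerm_iff {p : CyclicPath V} : IsGerm I p ↔ IsMaximalCyclicPath I p := by
  refine ⟨?_, fun h => ⟨p, h, Equiv.Perm.SameCycle.refl _ _⟩⟩
  rintro ⟨q, hq | hq, h⟩
  · exact Or.inl (hf.isMaxCycle_of_sameCycle hq h)
  · obtain ⟨a, q⟩ := q
    obtain rfl := Path.eq_nil_of_length_zero q hq.1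
    have h1 : rotate V ⟨a, Path.nil⟩ = ⟨a, Path.nil⟩ := rfl
    obtain ⟨n, rfl⟩ := h
    rw [Equiv.Perm.zpow_apply_eq_self_of_apply_eq_self h1]
    exact Or.inr hq

theorem form_rotate (p : CyclicPath V) :
    f (pathClass I (rotate V p).2) = f (pathClass I p.2) := by
  obtain ⟨a, p⟩ := p
  by_cases hp : p.length = 0
  · obtain rfl := Path.eq_nil_of_length_zero p hp
    rfl
  · obtain ⟨b, α, q, rfl, -⟩ := (Path.length_ne_zero_iff_eq_comp p).1 hp
    rw [rotate_toPath_comp, pathClass_comp, pathClass_comp, hf.comm]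

/-- Two maximal cycles at the same vertex agree up to a scalar. -/
theorem smul_pathClass_eq {a : V} {p q : Path a a} (hp : IsMaximalPath I p)
    (hq : IsMaximalPath I q) :
    f (pathClass I q) • pathClass I p = f (pathClass I p) • pathClass I q := by
  rw [← sub_eq_zero]
  by_contra hne
  obtain ⟨c, d, r, hr⟩ := hf.exists_form_mul_ne hne
  rw [sub_mul, smul_mul_assoc, smul_mul_assoc] at hr
  by_cases hac : a = c
  · subst hac
    rw [← pathClass_comp, ← pathClass_comp] at hr
    by_cases hr0 : r.length = 0
    · obtain rfl := Path.eq_of_length_zero r hr0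
      obtain rfl := Path.eq_nil_of_length_zero r hr0
      rw [Path.comp_nil, Path.comp_nil, map_sub, map_smul, map_smul, smul_eq_mul, smul_eq_mul,
        mul_comm, sub_self] at hr
      exact hr rfl
    · rw [pathClass_eq_zero.2 (hp.comp_mem r hr0), pathClass_eq_zero.2 (hq.comp_mem r hr0),
        smul_zero, smul_zero, sub_zero, map_zero] at hr
      exact hr rfl
  · rw [pathClass_mul_of_ne _ _ hac, pathClass_mul_of_ne _ _ hac, smul_zero, smul_zero, sub_zero,
      map_zero] at hr
    exact hr rfl

end IsSymmetrized

end MaximalPaths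

/-! ## Small algebras -/

section Small

variable {k : Type w} {V : Type u} [Quiver.{v} V] [Field k] [Finite V]
variable {I : TwoSidedIdeal (PathAlgebra k V)}

omit [Finite V] in
theorem eq_of_isolated (hV : IsConnectedQuiver V) {a : V} (hout : ∀ b, (a ⟶ b) → b = a)
    (hin : ∀ b, (b ⟶ a) → b = a) (b : V) : b = a := by
  obtain ⟨p⟩ := hV.2 a b
  have key : ∀ (x y : Symmetrify V) (p : @Path (Symmetrify V) _ x y), x = a → y = a := by
    intro x y p hx
    induction p with
    | nil => exact hx
    | cons p e ih =>
      rcases e with e | e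
      · obtain rfl := ih
        exact hout _ e
      · obtain rfl := ih
        exact hin _ e
  exact key a b p rfl

theorem isExcludedAlgebra_of_no_arrow (hI : IsAdmissible I) (a : V) (hV : ∀ b : V, b = a)
    (h : ∀ b c : V, IsEmpty (b ⟶ c)) : IsExcludedAlgebra k (BoundAlgebra I) := by
  have hone : (1 : BoundAlgebra I) = pathClass I (Path.nil : Path a a) := by
    rw [one_eq_sum_pathClass, Finset.sum_eq_single a (fun b _ hb => absurd (hV b) hb) (by simp)]
  left
  refine ⟨(AlgEquiv.ofBijective (Algebra.ofId k (BoundAlgebra I)) ⟨?_, fun x => ?_⟩).symm⟩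
  · have : Nontrivial (BoundAlgebra I) := ⟨1, 0, fun h1 => by
      rw [hone] at h1
      exact ofPath_notMem hI (by simp) (pathClass_eq_zero.1 h1)⟩
    exact (algebraMap k (BoundAlgebra I)).injective
  · have hx : x ∈ (⊤ : Submodule k (BoundAlgebra I)) := trivial
    rw [← span_pathClass] at hx
    have hle : Submodule.span k (Set.range fun p : TotalPath V => pathClass I p.2.2) ≤
        LinearMap.range (Algebra.linearMap k (BoundAlgebra I)) := by
      rw [Submodule.span_le]
      rintro _ ⟨⟨b, c, p⟩, rfl⟩
      cases p with
      | nil =>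
        obtain rfl := hV b
        exact ⟨1, by simpa using hone⟩
      | cons p e => exact ((h _ _).false e).elim
    exact hle hx

/-- All paths of length at least two vanish, while `1` and `α` stay independent by admissibility; so
`ε ↦ α` identifies the dual numbers with the algebra. -/
theorem isExcludedAlgebra_of_loop (hI : IsAdmissible I) (a : V) (hV : ∀ b : V, b = a)
    (α : a ⟶ a) (hα : ∀ β : a ⟶ a, β = α) (hsq : ofPath k (α.toPath.comp α.toPath) ∈ I) :
    IsExcludedAlgebra k (BoundAlgebra I) := by
  have hone : (1 : BoundAlgebra I) = pathClass I (Path.nil : Path a a) := by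
    rw [one_eq_sum_pathClass, Finset.sum_eq_single a (fun b _ hb => absurd (hV b) hb) (by simp)]
  have hsq' : pathClass I α.toPath * pathClass I α.toPath = 0 := by
    rw [← pathClass_comp, pathClass_eq_zero.2 hsq]
  let φ : DualNumber k →ₐ[k] BoundAlgebra I :=
    DualNumber.lift ⟨(Algebra.ofId k _, pathClass I α.toPath),
      hsq', fun c => Algebra.commutes' c _ |>.symm⟩
  have hφ : ∀ x : DualNumber k, φ x = x.fst • pathClass I (Path.nil : Path a a) +
      x.snd • pathClass I α.toPath := by
    intro x
    rw [← hone, ← Algebra.algebraMap_eq_smul_one, Algebra.smul_def]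
    exact DualNumber.lift_apply_apply _ x
  right
  refine ⟨(AlgEquiv.ofBijective φ ⟨(injective_iff_map_eq_zero φ).2 fun x hx => ?_,
    fun x => ?_⟩).symm⟩
  · rw [hφ, ← quotMap_ofPath, ← quotMap_ofPath, ← map_smul, ← map_smul, ← map_add,
      quotMap_eq_zero] at hx
    have h0 : ∀ {b c : V} (p : Path b c), p.length < 2 →
        x.fst * coeff (ofPath k (Path.nil : Path a a)) p +
          x.snd * coeff (ofPath k α.toPath) p = 0 := by
      intro b c p hp
      by_contra hne
      refine length_one_notMem hI hp ?_ hx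
      rwa [coeff_add, coeff_smul, coeff_smul]
    have h1 := h0 (Path.nil : Path a a) (by simp)
    have h2 := h0 α.toPath (by simp)
    rw [coeff_ofPath_self, coeff_ofPath_of_length_ne (by simp), mul_one, mul_zero, add_zero] at h1
    rw [coeff_ofPath_self, h1, zero_mul, mul_one, zero_add] at h2
    exact TrivSqZeroExt.ext h1 h2
  · have hx : x ∈ (⊤ : Submodule k (BoundAlgebra I)) := trivial
    rw [← span_pathClass] at hx
    have hle : Submodule.span k (Set.range fun p : TotalPath V => pathClass I p.2.2) ≤
        LinearMap.range φ.toLinearMap := by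
      rw [Submodule.span_le]
      rintro _ ⟨⟨b, c, p⟩, rfl⟩
      cases p with
      | nil =>
        obtain rfl := hV b
        exact ⟨1, (map_one φ).trans hone⟩
      | cons p e =>
        obtain rfl := hV c
        rename_i d
        obtain rfl := hV d
        obtain rfl := hα e
        cases p with
        | nil =>
          exact ⟨DualNumber.eps, (hφ _).trans (by
            rw [DualNumber.fst_eps, DualNumber.snd_eps, zero_smul, one_smul, zero_add]; rfl)⟩
        | cons p e' =>
          rename_i d
          obtain rfl := hV d
          obtain rfl := hα e'
          refine ⟨0, (map_zero φ).trans ?_⟩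
          change 0 = pathClass I (p.comp (e'.toPath.comp e'.toPath))
          rw [pathClass_comp, pathClass_eq_zero.2 hsq, mul_zero]
    exact hle hx

end Small

/-! ## Uniserial projective modules -/

section Uniserial

variable {k : Type w} {V : Type u} [Quiver.{v} V] [Field k] [Finite V]
variable {I : TwoSidedIdeal (PathAlgebra k V)}

variable (I) in
/-- The span of the residue classes of the paths of at least a given length. -/
def lengthSpan (n : ℕ) : Submodule k (BoundAlgebra I) :=
  Submodule.span k {x | ∃ (a b : V) (p : Path a b), n ≤ p.length ∧ x = pathClass I p}

theorem pathClass_mem_lengthSpan {n : ℕ} {a b : V} {p : Path a b} (hp : n ≤ p.length) :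
    pathClass I p ∈ lengthSpan I n := Submodule.subset_span ⟨a, b, p, hp, rfl⟩

theorem mul_mem_lengthSpan {m n : ℕ} {x y : BoundAlgebra I} (hx : x ∈ lengthSpan I m)
    (hy : y ∈ lengthSpan I n) : x * y ∈ lengthSpan I (m + n) := by
  have h := Submodule.mul_mem_mul hx hy
  rw [lengthSpan, lengthSpan, Submodule.span_mul_span] at h
  refine Submodule.span_le.2 ?_ h
  rintro _ ⟨_, ⟨a, b, p, hp, rfl⟩, _, ⟨c, d, q, hq, rfl⟩, rfl⟩
  by_cases hbc : b = c
  · subst hbc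
    change pathClass I p * pathClass I q ∈ _
    rw [← pathClass_comp]
    exact pathClass_mem_lengthSpan (by rw [Path.length_comp]; omega)
  · change pathClass I p * pathClass I q ∈ _
    rw [pathClass_mul_of_ne _ _ hbc]
    exact Submodule.zero_mem _

theorem isNilpotent_of_mem_lengthSpan (hI : IsAdmissible I) {x : BoundAlgebra I}
    (hx : x ∈ lengthSpan I 1) : IsNilpotent x := by
  obtain ⟨N, -, hN⟩ := hI.1
  have hpow : ∀ n, x ^ (n + 1) ∈ lengthSpan I (n + 1) := by
    intro n
    induction n with
    | zero => rwa [zero_add, pow_one]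
    | succ n ih =>
      rw [pow_succ]
      exact mul_mem_lengthSpan ih hx
  have hbot : lengthSpan I (N + 1) = ⊥ := by
    rw [lengthSpan, Submodule.span_eq_bot]
    rintro _ ⟨a, b, p, hp, rfl⟩
    exact pathClass_eq_zero.2 (hN a b p (by omega))
  refine ⟨N + 1, ?_⟩
  have := hpow N
  rwa [hbot, Submodule.mem_bot] at this

theorem mem_projectiveAt {a : V} {x : BoundAlgebra I} :
    x ∈ projectiveAt I a ↔ ∃ y, x = pathClass I (Path.nil : Path a a) * y := by
  rw [Submodule.mem_span_singleton]
  constructor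
  · rintro ⟨r, rfl⟩
    exact ⟨r.unop, rfl⟩
  · rintro ⟨y, rfl⟩
    exact ⟨MulOpposite.op y, rfl⟩

/-- If the paths starting at a vertex that do not lie in `I` are linearly ordered by extension, then
every non-zero element of the projective module is the product of a path and a unit. -/
theorem exists_eq_pathClass_mul_unit (hI : IsAdmissible I) {a : V}
    (hchain : ∀ (b c : V) (p : Path a b) (q : Path a c), ofPath k p ∉ I → ofPath k q ∉ I →
      p.length ≤ q.length → ∃ r : Path b c, q = p.comp r)
    {x : BoundAlgebra I} (hx : x ∈ projectiveAt I a) (hx0 : x ≠ 0) :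
    ∃ (b : V) (p : Path a b) (y : BoundAlgebra I), ofPath k p ∉ I ∧ IsUnit y ∧
      x = pathClass I p * y := by
  classical
  obtain ⟨y, rfl⟩ := mem_projectiveAt.1 hx
  obtain ⟨X, rfl⟩ := quotMap_surjective I y
  let X' : TotalPath V →₀ k := X
  let S : Finset (TotalPath V) :=
    X'.support.filter fun p => p.1 = a ∧ ofPath k p.2.2 ∉ I
  have hsum : pathClass I (Path.nil : Path a a) * quotMap I X =
      ∑ p ∈ S, X' p • pathClass I p.2.2 := by
    rw [quotMap_eq_sum, Finsupp.sum, Finset.mul_sum, Finset.sum_filter]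
    refine Finset.sum_congr rfl fun p _ => ?_
    obtain ⟨b, c, p⟩ := p
    rw [mul_smul_comm]
    by_cases hb : b = a
    · subst hb
      rw [pathClass_nil_mul]
      by_cases hp : ofPath k p ∈ I
      · rw [if_neg fun h => h.2 hp, pathClass_eq_zero.2 hp, smul_zero]
      · rw [if_pos ⟨rfl, hp⟩]
    · rw [if_neg fun h => hb h.1, pathClass_mul_of_ne _ _ fun h => hb h.symm, smul_zero]
  have hS : S.Nonempty := by
    rw [Finset.nonempty_iff_ne_empty]
    intro h
    rw [hsum, h, Finset.sum_empty] at hx0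
    exact hx0 rfl
  -- All other terms properly prolong the shortest term `p`. Hence the element is `p` times the sum
  -- of a non-zero scalar and a combination of paths of positive length, which is nilpotent.
  obtain ⟨⟨a', b, p⟩, hpS, hmin⟩ := Finset.exists_min_image S (fun p => p.2.2.length) hS
  obtain ⟨hp1, hp2, hp3⟩ := Finset.mem_filter.1 hpS
  dsimp only at hp2 hp3 hmin
  subst hp2
  have hrest : ∑ q ∈ S.erase ⟨a', b, p⟩, X' q • pathClass I q.2.2 ∈
      (lengthSpan I 1).map (LinearMap.mulLeft k (pathClass I p)) := by
    refine Submodule.sum_mem _ fun q hq => Submodule.smul_mem _ _ ?_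
    obtain ⟨hqp, hqS⟩ := Finset.mem_erase.1 hq
    have hle := hmin q hqS
    obtain ⟨c, d, q⟩ := q
    obtain ⟨-, hq2, hq3⟩ := Finset.mem_filter.1 hqS
    dsimp only at hq2 hq3 hle
    subst hq2
    obtain ⟨r, rfl⟩ := hchain _ _ p q hp3 hq3 hle
    refine ⟨pathClass I r, pathClass_mem_lengthSpan ?_, (pathClass_comp p r).symm⟩
    by_contra hr
    obtain rfl := Path.eq_of_length_zero r (by omega)
    obtain rfl := Path.eq_nil_of_length_zero r (by omega)
    exact hqp rfl
  obtain ⟨z, hz, hz'⟩ := hrest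
  refine ⟨b, p, algebraMap k _ (X' ⟨a', b, p⟩) + z, hp3, ?_, ?_⟩
  · exact IsNilpotent.isUnit_add_left_of_commute (isNilpotent_of_mem_lengthSpan hI hz)
      ((IsUnit.mk0 _ (Finsupp.mem_support_iff.1 hp1)).map (algebraMap k _))
      (Algebra.commutes _ _).symm
  · rw [hsum, ← Finset.add_sum_erase _ _ hpS, mul_add, ← Algebra.commutes, ← Algebra.smul_def]
    exact congrArg _ hz'.symm

/-- Up to units the elements are paths, and of two paths one prolongs the other; so any two cyclic
submodules are comparable, and therefore any two submodules. -/
theorem isUniserial_of_chain (hI : IsAdmissible I) {a : V}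
    (hchain : ∀ (b c : V) (p : Path a b) (q : Path a c), ofPath k p ∉ I → ofPath k q ∉ I →
      p.length ≤ q.length → ∃ r : Path b c, q = p.comp r) :
    IsUniserial (BoundAlgebra I)ᵐᵒᵖ (projectiveAt I a) := by
  have key : ∀ x y : projectiveAt I a, x ≠ 0 → y ≠ 0 →
      (∃ r : (BoundAlgebra I)ᵐᵒᵖ, y = r • x) ∨ ∃ r : (BoundAlgebra I)ᵐᵒᵖ, x = r • y := by
    rintro ⟨x, hx⟩ ⟨y, hy⟩ hx0 hy0
    obtain ⟨b, p, s, hp, hs, rfl⟩ := exists_eq_pathClass_mul_unit hI hchain hx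
      fun h => hx0 (Subtype.ext h)
    obtain ⟨c, q, t, hq, ht, rfl⟩ := exists_eq_pathClass_mul_unit hI hchain hy
      fun h => hy0 (Subtype.ext h)
    obtain ⟨s, rfl⟩ := hs
    obtain ⟨t, rfl⟩ := ht
    rcases le_total p.length q.length with hle | hle
    · left
      obtain ⟨r, rfl⟩ := hchain _ _ p q hp hq hle
      refine ⟨MulOpposite.op (↑s⁻¹ * pathClass I r * t), Subtype.ext ?_⟩
      change pathClass I (p.comp r) * ↑t = pathClass I p * ↑s * (↑s⁻¹ * pathClass I r * ↑t)
      rw [pathClass_comp]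
      simp only [mul_assoc, Units.mul_inv_cancel_left]
    · right
      obtain ⟨r, rfl⟩ := hchain _ _ q p hq hp hle
      refine ⟨MulOpposite.op (↑t⁻¹ * pathClass I r * s), Subtype.ext ?_⟩
      change pathClass I (q.comp r) * ↑s = pathClass I q * ↑t * (↑t⁻¹ * pathClass I r * ↑s)
      rw [pathClass_comp]
      simp only [mul_assoc, Units.mul_inv_cancel_left]
  intro N N'
  by_contra hcon
  rw [not_or, SetLike.not_le_iff_exists, SetLike.not_le_iff_exists] at hcon
  obtain ⟨⟨x, hxN, hxN'⟩, y, hyN', hyN⟩ := hcon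
  rcases key x y (fun h => hxN' (h ▸ N'.zero_mem)) (fun h => hyN (h ▸ N.zero_mem)) with
    ⟨r, rfl⟩ | ⟨r, rfl⟩
  · exact hyN (N.smul_mem r hxN)
  · exact hxN' (N'.smul_mem r hyN')

/-- Every path occurring in `βy` begins with `β`, so the coefficient of the arrow `α` in `α - βy` is
one, which is impossible in `R ^ 2`. -/
theorem pathClass_ne_mul (hI : IsAdmissible I) {a b c : V} {α : a ⟶ b} {β : a ⟶ c}
    (hne : (⟨b, α⟩ : Σ b, a ⟶ b) ≠ ⟨c, β⟩) (y : BoundAlgebra I) :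
    pathClass I α.toPath ≠ pathClass I β.toPath * y := by
  obtain ⟨Y, rfl⟩ := quotMap_surjective I y
  intro h
  rw [← quotMap_ofPath, ← quotMap_ofPath, ← map_mul, ← sub_eq_zero, ← map_sub,
    quotMap_eq_zero] at h
  refine length_one_notMem hI (p := α.toPath) (by simp) ?_ h
  have hlin : (coeffLin α.toPath).comp (LinearMap.mulLeft k (ofPath k β.toPath)) = 0 := by
    refine PathAlgebra.hom_ext fun d e r => ?_
    change coeff (ofPath k β.toPath * ofPath k r) α.toPath = 0
    by_cases hcd : c = d
    · subst hcd
      rw [ofPath_mul_ofPath]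
      refine coeff_ofPath_of_ne fun h => hne ?_
      obtain ⟨-, h⟩ := Sigma.mk.inj h
      obtain ⟨rfl, h⟩ := Sigma.mk.inj (eq_of_heq h)
      exact (toPath_comp_eq ((eq_of_heq h).trans (Path.comp_nil _).symm)).symm
    · rw [ofPath_mul_ofPath_of_ne _ _ hcd, coeff_zero]
  have h0 : coeff (ofPath k β.toPath * Y) α.toPath = 0 := LinearMap.congr_fun hlin Y
  rw [coeff_sub, coeff_ofPath_self, h0, sub_zero]
  exact one_ne_zero

theorem not_isUniserial (hI : IsAdmissible I) {a b c : V} {α : a ⟶ b} {β : a ⟶ c}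
    (hne : (⟨b, α⟩ : Σ b, a ⟶ b) ≠ ⟨c, β⟩) :
    ¬ IsUniserial (BoundAlgebra I)ᵐᵒᵖ (projectiveAt I a) := by
  intro h
  have hmem : ∀ {b : V} (α : a ⟶ b), pathClass I α.toPath ∈ projectiveAt I a := fun α =>
    mem_projectiveAt.2 ⟨_, (pathClass_nil_mul _).symm⟩
  have key : ∀ {b c : V} {α : a ⟶ b} {β : a ⟶ c}, (⟨b, α⟩ : Σ b, a ⟶ b) ≠ ⟨c, β⟩ →
      ¬ Submodule.span (BoundAlgebra I)ᵐᵒᵖ {(⟨_, hmem α⟩ : projectiveAt I a)} ≤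
        Submodule.span (BoundAlgebra I)ᵐᵒᵖ {(⟨_, hmem β⟩ : projectiveAt I a)} := by
    intro b c α β hne hle
    obtain ⟨r, hr⟩ := Submodule.mem_span_singleton.1 (hle (Submodule.mem_span_singleton_self _))
    exact pathClass_ne_mul hI hne r.unop (congrArg Subtype.val hr).symm
  rcases h _ _ with h | h
  · exact key hne h
  · exact key hne.symm h

end Uniserial

/-! ## The graph of a symmetric special biserial algebra is a Brauer graph -/

section BrauerGraph

variable {k : Type w} {V : Type u} [Quiver.{v} V] [Field k] [Finite V]
variable {I : TwoSidedIdeal (PathAlgebra k V)} {f : BoundAlgebra I →ₗ[k] k}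

namespace IsSymmetrized

variable (hf : IsSymmetrized I f) (hV : IsConnectedQuiver V)
  (hE : ¬ IsExcludedAlgebra k (BoundAlgebra I))

include hf hV hE

/-- An arrow into a vertex without outgoing arrows would be right maximal, hence a loop there, a
contradiction. So the vertex is isolated, it is the whole quiver, and the algebra is `k`. -/
theorem exists_arrow (a : V) : Nonempty (Σ b : V, a ⟶ b) := by
  by_contra hout
  rw [not_nonempty_iff] at hout
  have hin : ∀ b, IsEmpty (b ⟶ a) := by
    refine fun b => ⟨fun β => ?_⟩
    have h1 := hf.form_ne_of_right_maximal
      (ofPath_notMem hf.admissible (p := β.toPath) (by simp)) fun c α => (hout.false ⟨c, α⟩).elim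
    obtain rfl := hf.eq_of_form_ne h1
    exact hout.false ⟨_, β⟩
  have hall := eq_of_isolated hV (a := a) (fun b α => (hout.false ⟨b, α⟩).elim)
    fun b β => ((hin b).false β).elim
  refine hE (isExcludedAlgebra_of_no_arrow hf.admissible a hall fun b c => ⟨fun α => ?_⟩)
  obtain rfl := hall b
  exact hout.false ⟨c, α⟩

/-- Suppose a loop `α` is a maximal cycle. Any other arrow at its vertex would have a maximal cycle
proportional to `α` in the algebra, against `I ⊆ R ^ 2`. An arrow from another vertex would lead to
a longer maximal path starting with `α`, against uniqueness. So the quiver is one loop with `α² ∈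
I`, and the algebra is `k[x]/(x²)`. -/
theorem two_le_length {p : CyclicPath V} (hp : IsMaxCycle I p) : 2 ≤ p.2.length := by
  obtain ⟨a, p⟩ := p
  obtain ⟨hp0, hp⟩ := hp
  by_contra hlt
  obtain ⟨b, α, q, rfl, -⟩ := (Path.length_ne_zero_iff_eq_comp p).1 hp0.ne'
  rw [Path.length_comp, Path.length_toPath] at hlt
  obtain rfl := Path.eq_of_length_zero q (by omega)
  obtain rfl := Path.eq_nil_of_length_zero q (by omega)
  have hout : ∀ β : Σ c : V, b ⟶ c, β = ⟨b, α⟩ := by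
    rintro ⟨c, β⟩
    by_contra hne
    obtain ⟨q, hq⟩ := hf.exists_isMaximalPath β
    have h1 := hf.smul_pathClass_eq hp hq
    rw [Path.comp_nil, ← sub_eq_zero, ← quotMap_ofPath, ← quotMap_ofPath, ← map_smul, ← map_smul,
      ← map_sub, quotMap_eq_zero] at h1
    refine length_one_notMem hf.admissible (p := α.toPath) (by simp) ?_ h1
    rw [coeff_sub, coeff_smul, coeff_smul, coeff_ofPath_self, coeff_ofPath_of_ne, mul_zero, sub_zero,
      mul_one]
    · exact hf.form_ne_of_isMaximalPath hq
    · intro h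
      obtain ⟨-, h⟩ := Sigma.mk.inj h
      obtain ⟨-, h⟩ := Sigma.mk.inj (eq_of_heq h)
      exact hne (toPath_comp_eq ((eq_of_heq h).trans (Path.comp_nil _).symm))
  have hin : ∀ c, (c ⟶ b) → c = b := by
    intro c γ
    obtain ⟨q, hq⟩ := hf.exists_isMaximalPath γ
    by_cases hq0 : q.length = 0
    · exact (Path.eq_of_length_zero q hq0).symm
    · exfalso
      obtain ⟨d, δ, q, rfl, -⟩ := (Path.length_ne_zero_iff_eq_comp q).1 hq0
      have h1 := hf.isMaximalPath_rotate hq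
      obtain ⟨rfl, h2⟩ := Sigma.mk.inj (hout ⟨d, δ⟩)
      obtain rfl := eq_of_heq h2
      rw [Path.comp_assoc] at h1
      have h3 := congrArg Path.length (hf.eq_of_isMaximalPath hp h1)
      rw [Path.length_nil, Path.length_comp, Path.length_toPath] at h3
      omega
  have hall := eq_of_isolated hV (fun c β => congrArg Sigma.fst (hout ⟨c, β⟩)) hin
  refine hE (isExcludedAlgebra_of_loop hf.admissible b hall α (fun β => ?_) ?_)
  · exact eq_of_heq (Sigma.mk.inj (hout ⟨b, β⟩)).2
  · have := hp.2.2 b α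
    rwa [Path.comp_nil] at this

omit hV hE in
theorem isUniserial_of_unique {a b : V} {α : a ⟶ b} (hα : ∀ β : Σ c : V, a ⟶ c, β = ⟨b, α⟩) :
    IsUniserial (BoundAlgebra I)ᵐᵒᵖ (projectiveAt I a) := by
  refine isUniserial_of_chain hf.admissible fun c d p q hp hq hle => ?_
  by_cases hp0 : p.length = 0
  · obtain rfl := Path.eq_of_length_zero p hp0
    obtain rfl := Path.eq_nil_of_length_zero p hp0
    exact ⟨q, (Path.nil_comp q).symm⟩
  · obtain ⟨x, e, p, rfl, -⟩ := (Path.length_ne_zero_iff_eq_comp p).1 hp0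
    obtain ⟨y, e', q, rfl, -⟩ := (Path.length_ne_zero_iff_eq_comp q).1 (by omega)
    obtain ⟨rfl, h⟩ := Sigma.mk.inj ((hα ⟨x, e⟩).trans (hα ⟨y, e'⟩).symm)
    obtain rfl := eq_of_heq h
    rw [Path.length_comp, Path.length_comp] at hle
    obtain ⟨r, rfl⟩ := hf.exists_eq_comp hp hq (by omega)
    exact ⟨r, (Path.comp_assoc _ _ _).symm⟩

/-- The non-trivial germs at `a` correspond to the arrows starting there, of which there are one or
two. The trivial path is a germ exactly when there is only one, since two arrows generate
incomparable submodules. -/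
theorem card_germ [∀ a b : V, Finite (a ⟶ b)] (a : V) :
    Nat.card {g : (graph I).Germ // (graph I).edge g = a} = 2 := by
  obtain ⟨⟨b, α⟩⟩ := hf.exists_arrow hV hE a
  obtain ⟨q, hq⟩ := hf.exists_isMaximalPath α
  have hgerm : IsGerm I ⟨a, α.toPath.comp q⟩ :=
    hf.isGerm_iff.2 (Or.inl ⟨by rw [Path.length_comp, Path.length_toPath]; omega, hq⟩)
  by_cases huniq : ∀ β : Σ c : V, a ⟶ c, β = ⟨b, α⟩
  · have hnil : IsGerm I ⟨a, Path.nil⟩ :=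
      hf.isGerm_iff.2 (Or.inr ⟨rfl, hf.isUniserial_of_unique huniq⟩)
    refine Nat.card_eq_two_iff.2 ⟨⟨⟨_, hnil⟩, rfl⟩, ⟨⟨_, hgerm⟩, rfl⟩, ?_, ?_⟩
    · intro h
      have h1 := congrArg (fun g : {g : (graph I).Germ // (graph I).edge g = a} =>
        g.1.1.2.length) h
      dsimp only at h1
      rw [Path.length_nil, Path.length_comp, Path.length_toPath] at h1
      omega
    · refine Set.eq_univ_of_forall ?_
      rintro ⟨⟨⟨c, p⟩, hp⟩, hc⟩
      change c = a at hc
      subst hc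
      rcases hf.isGerm_iff.1 hp with ⟨h0, h⟩ | ⟨h0, -⟩
      · right
        obtain ⟨d, β, r, rfl, -⟩ := (Path.length_ne_zero_iff_eq_comp p).1 h0.ne'
        obtain ⟨rfl, h1⟩ := Sigma.mk.inj (huniq ⟨d, β⟩)
        obtain rfl := eq_of_heq h1
        obtain rfl := hf.eq_of_isMaximalPath hq h
        rfl
      · left
        obtain rfl := Path.eq_nil_of_length_zero p h0
        rfl
  · push Not at huniq
    obtain ⟨⟨c, β⟩, hβ⟩ := huniq
    obtain ⟨r, hr⟩ := hf.exists_isMaximalPath β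
    have hgerm' : IsGerm I ⟨a, β.toPath.comp r⟩ :=
      hf.isGerm_iff.2 (Or.inl ⟨by rw [Path.length_comp, Path.length_toPath]; omega, hr⟩)
    refine Nat.card_eq_two_iff.2 ⟨⟨⟨_, hgerm⟩, rfl⟩, ⟨⟨_, hgerm'⟩, rfl⟩, ?_, ?_⟩
    · intro h
      have h1 := congrArg (fun g : {g : (graph I).Germ // (graph I).edge g = a} => g.1.1) h
      exact hβ (toPath_comp_eq (eq_of_heq (Sigma.mk.inj h1).2)).symm
    · refine Set.eq_univ_of_forall ?_
      rintro ⟨⟨⟨x, p⟩, hp⟩, hx⟩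
      change x = a at hx
      subst hx
      rcases hf.isGerm_iff.1 hp with ⟨h0, h⟩ | ⟨-, h⟩
      · obtain ⟨d, γ, s, rfl, -⟩ := (Path.length_ne_zero_iff_eq_comp p).1 h0.ne'
        have h2 : (⟨d, γ⟩ : Σ c : V, x ⟶ c) = ⟨b, α⟩ ∨ (⟨d, γ⟩ : Σ c : V, x ⟶ c) = ⟨c, β⟩ := by
          by_contra hcon
          rw [not_or] at hcon
          have hcard := hf.specialBiserial.out_le_two x
          -- A third arrow starting at `x` would contradict (S1).
          have h3 := Nat.card_le_card_of_injective
            (![⟨b, α⟩, ⟨c, β⟩, ⟨d, γ⟩] : Fin 3 → Σ c : V, x ⟶ c) (by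
              intro i j hij
              fin_cases i <;> fin_cases j <;> first | rfl | skip
              · exact absurd hij.symm hβ
              · exact absurd hij.symm hcon.1
              · exact absurd hij hβ
              · exact absurd hij.symm hcon.2
              · exact absurd hij hcon.1
              · exact absurd hij hcon.2)
          rw [Nat.card_fin] at h3
          omega
        rcases h2 with h2 | h2
        · left
          obtain ⟨rfl, h1⟩ := Sigma.mk.inj h2
          obtain rfl := eq_of_heq h1
          obtain rfl := hf.eq_of_isMaximalPath hq h
          rfl
        · right
          obtain ⟨rfl, h1⟩ := Sigma.mk.inj h2
          obtain rfl := eq_of_heq h1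
          obtain rfl := hf.eq_of_isMaximalPath hr h
          rfl
      · exact absurd h (not_isUniserial hf.admissible hβ.symm)

end IsSymmetrized

/-! ### Arrows, periods and multiplicities in the graph of an algebra -/

/-- The residue class of the last arrow of a cyclic path (zero for a trivial path). -/
def lastArrow (I : TwoSidedIdeal (PathAlgebra k V)) : CyclicPath V → BoundAlgebra I
  | ⟨_, Path.nil⟩ => 0
  | ⟨_, Path.cons _ e⟩ => pathClass I e.toPath

/-- The residue class of the first arrow of a cyclic path (zero for a trivial path). -/
def firstArrow (I : TwoSidedIdeal (PathAlgebra k V)) (p : CyclicPath V) : BoundAlgebra I :=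
  lastArrow I (rotate V p)

theorem firstArrow_toPath_comp {a b : V} (α : a ⟶ b) (q : Path b a) :
    firstArrow I ⟨a, α.toPath.comp q⟩ = pathClass I α.toPath := by
  rw [firstArrow, rotate_toPath_comp]
  rfl

theorem rotateGerm_pow_val (g : (graph I).Germ) (n : ℕ) :
    (((graph I).next ^ n) g).1 = (rotate V ^ n) g.1 := by
  induction n with
  | zero => rfl
  | succ n ih =>
    rw [pow_succ', pow_succ', Equiv.Perm.mul_apply, Equiv.Perm.mul_apply, ← ih]
    rfl

theorem minimalPeriod_graph_next (g : (graph I).Germ) :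
    Function.minimalPeriod (graph I).next g = Function.minimalPeriod (rotate V) g.1 := by
  rw [Function.minimalPeriod_eq_minimalPeriod_iff]
  intro n
  rw [isPeriodicPt_rotate, Function.IsPeriodicPt, Function.IsFixedPt, Equiv.Perm.iterate_eq_pow,
    ← rotateGerm_pow_val]
  exact Subtype.ext_iff

theorem mult_vert_graph (g : (graph I).Germ) :
    (graph I).mult ((graph I).vert g) = multiplicity g.1 := rfl

theorem fullLen_graph (g : (graph I).Germ) (hg : g.1.2.length ≠ 0) :
    (graph I).fullLen g = g.1.2.length := by
  rw [LocalGraph.fullLen, minimalPeriod_graph_next, mult_vert_graph,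
    minimalPeriod_mul_multiplicity _ hg]

theorem vert_graph_next (g : (graph I).Germ) :
    (graph I).vert ((graph I).next g) = (graph I).vert g :=
  Quotient.sound (Equiv.Perm.sameCycle_apply_left.2 (Equiv.Perm.SameCycle.refl _ _))

namespace IsSymmetrized

variable (hf : IsSymmetrized I f)

include hf

/-- The germs given by trivial paths are fixed by rotation and have multiplicity one. -/
theorem isMaxCycle_of_not_isTruncated {g : (graph I).Germ} (hg : ¬ (graph I).IsTruncated g) :
    IsMaxCycle I g.1 := by
  rcases hf.isGerm_iff.1 g.2 with h | ⟨h, -⟩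
  · exact h
  · refine absurd ⟨Subtype.ext ?_, ?_⟩ hg
    · obtain ⟨⟨a, p⟩, hp⟩ := g
      obtain rfl := Path.eq_nil_of_length_zero p h
      rfl
    · rw [mult_vert_graph, multiplicity, if_pos h]

/-- Every arrow is the first arrow of a non-trivial germ of `G_Λ`. -/
theorem exists_germ_of_arrow {a b : V} (α : a ⟶ b) :
    ∃ g : (graph I).Germ, IsMaxCycle I g.1 ∧ (graph I).edge g = a ∧
      (graph I).edge ((graph I).next g) = b ∧ firstArrow I g.1 = pathClass I α.toPath := by
  obtain ⟨q, hq⟩ := hf.exists_isMaximalPath α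
  have h : IsMaxCycle I ⟨a, α.toPath.comp q⟩ :=
    ⟨by rw [Path.length_comp, Path.length_toPath]; omega, hq⟩
  exact ⟨⟨_, hf.isGerm_iff.2 (Or.inl h)⟩, h, rfl, congrArg Sigma.fst (rotate_toPath_comp α q),
    firstArrow_toPath_comp α q⟩

/-- An arrow of `Q` is the first arrow of a maximal cycle; two consecutive germs at the vertex of
that cycle lie on the edges that the arrow joins. -/
theorem connected_graph (hV : IsConnectedQuiver V) (x y : (graph I).Vert) :
    Relation.ReflTransGen (fun x y => ∃ g h : (graph I).Germ, (graph I).edge g = (graph I).edge h ∧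
      (graph I).vert g = x ∧ (graph I).vert h = y) x y := by
  obtain ⟨g, rfl⟩ := Quotient.exists_rep x
  obtain ⟨h, rfl⟩ := Quotient.exists_rep y
  have key : ∀ (a b : Symmetrify V) (p : @Path (Symmetrify V) _ a b) (g h : (graph I).Germ),
      (graph I).edge g = a → (graph I).edge h = b →
      Relation.ReflTransGen (fun x y => ∃ g h : (graph I).Germ,
        (graph I).edge g = (graph I).edge h ∧ (graph I).vert g = x ∧ (graph I).vert h = y)
        ((graph I).vert g) ((graph I).vert h) := by
    intro a b p
    induction p with
    | nil => exact fun g h hg hh => Relation.ReflTransGen.single ⟨g, h, hg.trans hh.symm, rfl, rfl⟩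
    | @cons b c p e ih =>
      intro g h hg hh
      rcases e with e | e
      · obtain ⟨x, -, hx, hx', -⟩ := hf.exists_germ_of_arrow e
        exact (ih g x hg hx).tail
          ⟨(graph I).next x, h, hx'.trans hh.symm, vert_graph_next _, rfl⟩
      · obtain ⟨x, -, hx, hx', -⟩ := hf.exists_germ_of_arrow e
        have h2 := ih g ((graph I).next x) hg hx'
        rw [vert_graph_next] at h2
        exact h2.tail ⟨x, h, hx.trans hh.symm, rfl, rfl⟩
  obtain ⟨p⟩ := hV.2 ((graph I).edge g) ((graph I).edge h)
  exact key _ _ p g h rfl rfl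

variable (hV : IsConnectedQuiver V) (hE : ¬ IsExcludedAlgebra k (BoundAlgebra I))

include hV hE

theorem isBrauerGraph [∀ a b : V, Finite (a ⟶ b)] : (graph I).IsBrauerGraph := by
  have hcard := hf.card_germ hV hE
  have hfin : Finite (graph I).Germ := by
    have : ∀ a, Finite {g : (graph I).Germ // (graph I).edge g = a} := fun a =>
      Nat.finite_of_card_ne_zero (by rw [hcard a]; omega)
    have := (graph I).finite_edge
    exact Finite.of_equiv _ (Equiv.sigmaFiberEquiv (graph I).edge)
  have hfin' : Finite {p : CyclicPath V // IsGerm I p} := hfin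
  obtain ⟨a⟩ := hV.1
  obtain ⟨⟨b, α⟩⟩ := hf.exists_arrow hV hE a
  obtain ⟨g, -⟩ := hf.exists_germ_of_arrow α
  exact
    { finite_germ := hfin
      finite_vert := Quotient.finite _
      two_germs := hcard
      cyclic := fun g h => Quotient.eq
      mult_pos := fun x => by
        obtain ⟨g, rfl⟩ := Quotient.exists_rep x
        change 0 < multiplicity g.1
        by_cases hg : g.1.2.length = 0
        · rw [multiplicity, if_pos hg]; exact one_pos
        · have h1 := minimalPeriod_mul_multiplicity g.1 hg
          refine Nat.pos_of_ne_zero fun h0 => hg ?_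
          rw [← h1, h0, mul_zero]
      nonempty_vert := ⟨(graph I).vert g⟩
      connected := hf.connected_graph hV }

/-- A truncated germ has full length one, whereas here the full length is the length of a maximal
cycle, which is at least two. -/
theorem not_isTruncated_of_isMaxCycle {g : (graph I).Germ} (hg : IsMaxCycle I g.1) :
    ¬ (graph I).IsTruncated g := by
  rintro ⟨h1, h2⟩
  have h3 := hf.two_le_length hV hE hg
  have h4 := fullLen_graph g hg.1.ne'
  have h5 : Function.minimalPeriod (graph I).next g = 1 :=
    Function.minimalPeriod_eq_one_iff_isFixedPt.2 h1
  unfold LocalGraph.fullLen at h4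
  rw [h2, h5] at h4
  omega

theorem graph_not_isExcluded : ¬ (graph I).IsExcluded := by
  obtain ⟨a⟩ := hV.1
  rintro (h | ⟨-, hinj, hmult⟩)
  · exact h.false a
  · obtain ⟨⟨b, α⟩⟩ := hf.exists_arrow hV hE a
    obtain ⟨g, hmax, -⟩ := hf.exists_germ_of_arrow α
    exact hf.not_isTruncated_of_isMaxCycle hV hE hmax ⟨hinj (vert_graph_next _), hmult _⟩

end IsSymmetrized

end BrauerGraph

/-! ## The isomorphism with the Brauer graph algebra -/

section Isomorphism

variable {k : Type w} {V : Type u} [Quiver.{v} V] [Field k] [Finite V]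

variable {I : TwoSidedIdeal (PathAlgebra k V)} {f : BoundAlgebra I →ₗ[k] k}

theorem firstArrow_mul_nil (p : CyclicPath V) :
    firstArrow I p * pathClass I (Path.nil : Path (rotate V p).1 _) = firstArrow I p := by
  rw [firstArrow]
  obtain ⟨a, q⟩ := rotate V p
  cases q with
  | nil => exact zero_mul _
  | cons q e => exact pathClass_mul_nil e.toPath

theorem nil_mul_firstArrow (p : CyclicPath V) :
    pathClass I (Path.nil : Path p.1 p.1) * firstArrow I p = firstArrow I p := by
  obtain ⟨a, p⟩ := p
  by_cases hp : p.length = 0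
  · obtain rfl := Path.eq_nil_of_length_zero p hp
    exact mul_zero _
  · obtain ⟨b, α, q, rfl, -⟩ := (Path.length_ne_zero_iff_eq_comp p).1 hp
    rw [firstArrow_toPath_comp, pathClass_nil_mul]

/-- An `n`-th root (one if `n = 0`). -/
def someRoot [IsAlgClosed k] (n : ℕ) (x : k) : k :=
  if h : 0 < n then (IsAlgClosed.exists_pow_nat_eq x h).choose else 1

theorem someRoot_pow [IsAlgClosed k] {n : ℕ} (hn : 0 < n) (x : k) : someRoot n x ^ n = x := by
  rw [someRoot, dif_pos hn]
  exact (IsAlgClosed.exists_pow_nat_eq x hn).choose_spec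

variable [IsAlgClosed k]

/-- The scalar by which the first arrow of a maximal cycle is multiplied, so that all maximal cycles
at a vertex become equal. -/
def scalar (f : BoundAlgebra I →ₗ[k] k) (p : CyclicPath V) : k :=
  someRoot p.2.length (f (pathClass I p.2))⁻¹

/-- The homomorphism from the path algebra of the quiver of `G_Λ` to `Λ`. -/
def graphHom (f : BoundAlgebra I →ₗ[k] k) :
    PathAlgebra k (graph I).QVert →ₐ[k] BoundAlgebra I :=
  pathLift (fun a : (graph I).QVert => pathClass I (Path.nil : Path (V := V) a a))
    (fun _ _ α => scalar f α.1.1 • firstArrow I α.1.1)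
    (fun _ => pathClass_nil_mul (V := V) _) (fun _ _ h => pathClass_mul_of_ne (V := V) _ _ h)
    (one_eq_sum_pathClass (V := V)).symm
    (by
      rintro _ _ ⟨g, rfl, rfl, hg⟩
      rw [smul_mul_assoc]
      exact congrArg _ (firstArrow_mul_nil g.1))

theorem graphHom_nil (a : (graph I).QVert) : graphHom f (ofPath k (Path.nil : Path a a)) =
    pathClass I (Path.nil : Path (V := V) a a) := pathLift_ofPath _ _ _ _ _

theorem graphHom_arrowElt (g : (graph I).Germ) (hg : ¬ (graph I).IsTruncated g) :
    graphHom f (LocalGraph.arrowElt k g hg) = scalar f g.1 • firstArrow I g.1 := by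
  refine (pathLift_ofPath _ _ _ _ _).trans ?_
  change pathClass I (Path.nil : Path g.1.1 g.1.1) * (scalar f g.1 • firstArrow I g.1) = _
  rw [mul_smul_comm, nil_mul_firstArrow]

namespace IsSymmetrized

variable (hf : IsSymmetrized I f)

include hf

/-- Length and form are invariant under rotation, so all arrows around one vertex of the graph
receive the same scalar. -/
theorem scalar_rotate_pow (p : CyclicPath V) (n : ℕ) :
    scalar f ((rotate V ^ n) p) = scalar f p := by
  induction n with
  | zero => rfl
  | succ n ih =>
    rw [← ih, pow_succ', Equiv.Perm.mul_apply, scalar, length_rotate, hf.form_rotate, ← scalar]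

theorem scalar_ne_zero {p : CyclicPath V} (hp : IsMaxCycle I p) : scalar f p ≠ 0 := by
  intro h
  have h1 := someRoot_pow hp.1 (f (pathClass I p.2))⁻¹
  rw [scalar] at h
  rw [h, zero_pow hp.1.ne'] at h1
  exact inv_ne_zero (hf.form_ne_of_isMaximalPath hp.2) h1.symm

theorem graphHom_walkElt (g : (graph I).Germ) (hg : ¬ (graph I).IsTruncated g) {n : ℕ}
    (hn : n ≤ g.1.2.length) : ∃ (b : V) (u : Path g.1.1 b) (v : Path b g.1.1),
      g.1.2 = u.comp v ∧ u.length = n ∧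
        graphHom f (LocalGraph.walkElt k g hg n) = scalar f g.1 ^ n • pathClass I u := by
  induction n with
  | zero =>
    refine ⟨g.1.1, Path.nil, g.1.2, (Path.nil_comp _).symm, rfl, ?_⟩
    rw [pow_zero, one_smul]
    exact graphHom_nil _
  | succ n ih =>
    obtain ⟨b, u, v, huv, hu, h⟩ := ih (by omega)
    have hv : v.length ≠ 0 := by
      rw [huv, Path.length_comp] at hn
      omega
    obtain ⟨c, α, v, rfl, -⟩ := (Path.length_ne_zero_iff_eq_comp v).1 hv
    refine ⟨c, u.comp α.toPath, v, by rw [huv, Path.comp_assoc], by simp [hu], ?_⟩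
    -- Rotation past the initial segment `u` of length `n` brings the next arrow `α` to the front.
    have h1 : (rotate V ^ n) g.1 = ⟨b, α.toPath.comp (v.comp u)⟩ := by
      rw [← Path.comp_assoc, ← rotate_pow_comp, hu, ← huv]
    rw [LocalGraph.walkElt_succ, map_mul, h, graphHom_arrowElt, rotateGerm_pow_val,
      hf.scalar_rotate_pow, h1, firstArrow_toPath_comp, smul_mul_smul_comm, ← pow_succ,
      pathClass_comp]

/-- The walk has as many arrows as the maximal cycle, so the scalar is raised to exactly the power
of which it is a root. Normalized by the form, the maximal cycles at one vertex become equal. -/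
theorem graphHom_walkElt_fullLen (g : (graph I).Germ) (hg : ¬ (graph I).IsTruncated g) :
    graphHom f (LocalGraph.walkElt k g hg ((graph I).fullLen g)) =
      (f (pathClass I g.1.2))⁻¹ • pathClass I g.1.2 := by
  have hmax := hf.isMaxCycle_of_not_isTruncated hg
  obtain ⟨b, u, v, huv, hu, h⟩ := hf.graphHom_walkElt g hg le_rfl
  have hv : v.length = 0 := by
    have := congrArg Path.length huv
    rw [Path.length_comp] at this
    omega
  obtain rfl := Path.eq_of_length_zero v hv
  obtain rfl := Path.eq_nil_of_length_zero v hv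
  rw [Path.comp_nil] at huv
  rw [fullLen_graph g hmax.1.ne', h, ← huv, scalar, someRoot_pow hmax.1]

variable (hV : IsConnectedQuiver V) (hE : ¬ IsExcludedAlgebra k (BoundAlgebra I))

include hV hE

-- Length at least two provides a second arrow `β` of `p` with `αβ` non-zero. If `αγ` is non-zero
-- for the first arrow `γ` of `q`, then `γ = β` by (S2), and the rotation of `p` equals `q` because
-- a maximal cycle is determined by its first arrow.
omit [IsAlgClosed k] in
theorem firstArrow_mul_firstArrow {p q : CyclicPath V} (hp : IsMaxCycle I p)
    (hq : IsMaxCycle I q) (hpq : (rotate V p).1 = q.1) (hne : rotate V p ≠ q) :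
    firstArrow I p * firstArrow I q = 0 := by
  have hlen := hf.two_le_length hV hE hp
  have hmax := hf.isMaxCycle_rotate_of hp
  obtain ⟨a, p⟩ := p
  obtain ⟨c, q⟩ := q
  obtain ⟨b, α, p, rfl, -⟩ := (Path.length_ne_zero_iff_eq_comp p).1 hp.1.ne'
  obtain ⟨d, γ, q, rfl, -⟩ := (Path.length_ne_zero_iff_eq_comp q).1 hq.1.ne'
  rw [rotate_toPath_comp] at hpq hne hmax
  dsimp only at hpq
  subst hpq
  rw [Path.length_comp, Path.length_toPath] at hlen
  obtain ⟨e, β, p, rfl, -⟩ := (Path.length_ne_zero_iff_eq_comp p).1 (by omega)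
  rw [firstArrow_toPath_comp, firstArrow_toPath_comp, ← pathClass_comp, pathClass_eq_zero]
  by_contra hmem
  have hmem' : ofPath k (α.toPath.comp β.toPath) ∉ I := by
    intro h
    refine hp.2.1 ?_
    rw [← Path.comp_assoc]
    exact ofPath_comp_mem_left h p
  obtain ⟨rfl, h⟩ := Sigma.mk.inj
    (hf.specialBiserial.right_unique _ _ α ⟨_, γ⟩ ⟨_, β⟩ hmem hmem')
  obtain rfl := eq_of_heq h
  rw [Path.comp_assoc] at hmax hne
  rw [hf.eq_of_isMaximalPath hmax.2 hq.2] at hne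
  exact hne rfl

variable (hB : (graph I).IsBrauerGraph)

include hB

theorem graphHom_eq_zero {x : PathAlgebra k (graph I).QVert} (hx : x ∈ (graph I).ideal k) :
    graphHom f x = 0 := by
  induction hx using TwoSidedIdeal.span_induction with
  | mem x hx =>
    cases hx with
    | comm g h hg hh hne he =>
      rw [hB.cyclePow_eq, hB.cyclePow_eq, map_sub, hf.graphHom_walkElt_fullLen,
        hf.graphHom_walkElt_fullLen, sub_eq_zero]
      have hg := hf.isMaxCycle_of_not_isTruncated hg
      have hh := hf.isMaxCycle_of_not_isTruncated hh
      obtain ⟨⟨a, p⟩, hp⟩ := g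
      obtain ⟨⟨b, q⟩, hq⟩ := h
      obtain rfl : a = b := he
      have h1 := hf.form_ne_of_isMaximalPath hg.2
      have h2 := hf.form_ne_of_isMaximalPath hh.2
      rw [inv_smul_eq_iff₀ h1, smul_comm, eq_inv_smul_iff₀ h2]
      exact hf.smul_pathClass_eq hg.2 hh.2
    | leaf g h hg hne he hh =>
      rw [hB.cyclePow_eq, ← LocalGraph.arrowElt, map_mul, hf.graphHom_walkElt_fullLen,
        graphHom_arrowElt, smul_mul_smul_comm]
      have hmax := hf.isMaxCycle_of_not_isTruncated hg
      obtain ⟨⟨a, p⟩, hp⟩ := g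
      obtain ⟨b, α, q, rfl, -⟩ := (Path.length_ne_zero_iff_eq_comp p).1 hmax.1.ne'
      rw [firstArrow_toPath_comp, ← pathClass_comp, pathClass_eq_zero.2 (hmax.2.2.2 b α), smul_zero]
    | zero g h hg hh he hne =>
      rw [← LocalGraph.arrowElt, ← LocalGraph.arrowElt, map_mul, graphHom_arrowElt,
        graphHom_arrowElt, smul_mul_smul_comm,
        hf.firstArrow_mul_firstArrow hV hE (hf.isMaxCycle_of_not_isTruncated hg)
          (hf.isMaxCycle_of_not_isTruncated hh) he fun h => hne (Subtype.ext h), smul_zero]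
  | zero => exact map_zero _
  | add x y _ _ hx hy => rw [map_add, hx, hy, add_zero]
  | neg x _ hx => rw [map_neg, hx, neg_zero]
  | left_absorb y x _ hx => rw [map_mul, hx, mul_zero]
  | right_absorb y x _ hx => rw [map_mul, hx, zero_mul]

omit hB in
theorem graphHom_surjective : Function.Surjective (graphHom f) := by
  have key : ∀ (a b : V) (p : Path a b), pathClass I p ∈ (graphHom f).range := by
    intro a b p
    induction p with
    | nil => exact ⟨_, graphHom_nil (f := f) (show (graph I).QVert from a)⟩
    | @cons b c p α ih =>
      rw [← Path.comp_toPath_eq_cons, pathClass_comp]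
      refine Subalgebra.mul_mem _ ih ?_
      obtain ⟨g, hmax, -, -, hg⟩ := hf.exists_germ_of_arrow α
      have h1 := graphHom_arrowElt (f := f) g (hf.not_isTruncated_of_isMaxCycle hV hE hmax)
      rw [hg] at h1
      rw [← inv_smul_smul₀ (hf.scalar_ne_zero hmax) (pathClass I α.toPath), ← h1]
      exact Subalgebra.smul_mem _ (AlgHom.mem_range_self _ _) _
  intro x
  have hx : x ∈ (⊤ : Submodule k (BoundAlgebra I)) := trivial
  rw [← span_pathClass] at hx
  refine (Submodule.span_le (p := Subalgebra.toSubmodule (graphHom f).range)).2 ?_ hx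
  rintro _ ⟨p, rfl⟩
  exact key _ _ _

theorem nonempty_algEquiv (hG : ¬ (graph I).IsExcluded) :
    Nonempty ((graph I).BrauerGraphAlgebra k ≃ₐ[k] BoundAlgebra I) := by
  refine ⟨AlgEquiv.ofBijective (quotLift (graphHom f) fun x hx => hf.graphHom_eq_zero hV hE hB hx)
    ⟨(injective_iff_map_eq_zero _).2 fun x hx => ?_, fun y => ?_⟩⟩
  · by_contra hne
    -- A non-zero kernel element would put a non-zero multiple of some `C_g ^ e` into the kernel,
    -- but `f` takes the value one on the image of `C_g ^ e`.
    obtain ⟨y, z, g, hg, c, hc, h⟩ := hB.exists_mul_mul_eq hG hne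
    have h1 := congrArg (quotLift (graphHom f) fun x hx => hf.graphHom_eq_zero hV hE hB hx) h
    rw [map_mul, map_mul, hx, mul_zero, zero_mul, map_smul, quotLift_quotMap,
      hf.graphHom_walkElt_fullLen, smul_smul] at h1
    have h2 := hf.form_ne_of_isMaximalPath (hf.isMaxCycle_of_not_isTruncated hg).2
    have h3 := congrArg f h1
    rw [map_zero, map_smul, smul_eq_mul, mul_assoc, inv_mul_cancel₀ h2, mul_one] at h3
    exact hc h3.symm
  · obtain ⟨x, hx⟩ := hf.graphHom_surjective hV hE y
    exact ⟨quotMap _ x, hx⟩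

end IsSymmetrized

end Isomorphism

end

end SSB

/-! ### Assembly of the two directions -/

theorem SSB.IsExcludedAlgebra.of_algEquiv {k : Type w} [Field k] {A : Type u} {B : Type v} [Ring A]
    [Algebra k A] [Ring B] [Algebra k B] (e : A ≃ₐ[k] B) (h : SSB.IsExcludedAlgebra k A) :
    SSB.IsExcludedAlgebra k B :=
  h.imp (fun ⟨e'⟩ => ⟨e.symm.trans e'⟩) fun ⟨e'⟩ => ⟨e.symm.trans e'⟩

theorem SSB.graph_spec {k : Type w} [Field k] [IsAlgClosed k]
    (V : Type u) [Quiver.{v} V] [Finite V] [∀ a b : V, Finite (a ⟶ b)]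
    (I : TwoSidedIdeal (SSB.PathAlgebra k V)) (hV : SSB.IsConnectedQuiver V)
    (hI : SSB.IsAdmissible I) (hS : SSB.IsSpecialBiserial I)
    (hsymm : SSB.IsSymmetricAlgebra k (SSB.BoundAlgebra I))
    (hE : ¬ SSB.IsExcludedAlgebra k (SSB.BoundAlgebra I)) :
    (SSB.graph I).IsBrauerGraph ∧ ¬ (SSB.graph I).IsExcluded ∧
      Nonempty ((SSB.graph I).BrauerGraphAlgebra k ≃ₐ[k] SSB.BoundAlgebra I) := by
  obtain ⟨f, hcomm, hnondeg⟩ := hsymm.exists_form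
  have hf : SSB.IsSymmetrized I f := ⟨hI, hS, hcomm, hnondeg⟩
  have hB := hf.isBrauerGraph hV hE
  have hG := hf.graph_not_isExcluded hV hE
  exact ⟨hB, hG, hf.nonempty_algEquiv hV hE hB hG⟩

theorem theorem1p1 {k : Type w} [Field k] [IsAlgClosed k] :
    (∀ (V : Type u) [Quiver.{v} V] [Finite V] [∀ a b : V, Finite (a ⟶ b)]
        (I : TwoSidedIdeal (SSB.PathAlgebra k V)),
      SSB.IsConnectedQuiver V → SSB.IsAdmissible I → SSB.IsSpecialBiserial I →
      SSB.IsSymmetricAlgebra k (SSB.BoundAlgebra I) →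
      ¬ SSB.IsExcludedAlgebra k (SSB.BoundAlgebra I) →
        (SSB.graph I).IsBrauerGraph ∧ ¬ (SSB.graph I).IsExcluded ∧
        Nonempty ((SSB.graph I).BrauerGraphAlgebra k ≃ₐ[k] SSB.BoundAlgebra I)) ∧
    (∀ Γ : SSB.LocalGraph.{u, v}, Γ.IsBrauerGraph → ¬ Γ.IsExcluded →
        SSB.IsFiniteQuiver Γ.QVert ∧ SSB.IsConnectedQuiver Γ.QVert ∧
        SSB.IsAdmissible (Γ.ideal k) ∧ SSB.IsSpecialBiserial (Γ.ideal k) ∧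
        Module.Finite k (Γ.BrauerGraphAlgebra k) ∧
        SSB.IsSymmetricAlgebra k (Γ.BrauerGraphAlgebra k)) ∧
    (∀ (A : Type v) [Ring A] [Algebra k A],
      SSB.IsSymmetricSpecialBiserialAlgebra.{u} k A ∧ ¬ SSB.IsExcludedAlgebra k A ↔
        SSB.IsBrauerGraphAlgebra.{u} k A) := by
  refine ⟨SSB.graph_spec, fun Γ hΓ hE => ⟨hΓ.isFiniteQuiver, hΓ.isConnectedQuiver hE,
    hΓ.isAdmissible hE, hΓ.isSpecialBiserial, hΓ.moduleFinite hE, hΓ.isSymmetricAlgebra hE⟩,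
    fun A _ _ => ⟨?_, ?_⟩⟩
  · rintro ⟨⟨V, hQ, hV, hconn, I, hI, hS, hsymm, ⟨e⟩⟩, hE⟩
    have := hV.1
    have := hV.2
    obtain ⟨hB, hG, ⟨e'⟩⟩ := SSB.graph_spec V I hconn hI hS (hsymm.of_algEquiv e)
      fun h => hE (h.of_algEquiv e.symm)
    exact ⟨SSB.graph I, hB, hG, ⟨e.trans e'.symm⟩⟩
  · rintro ⟨Γ, hΓ, hE, ⟨e⟩⟩
    exact ⟨⟨Γ.QVert, inferInstance, hΓ.isFiniteQuiver, hΓ.isConnectedQuiver hE, Γ.ideal k,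
      hΓ.isAdmissible hE, hΓ.isSpecialBiserial, (hΓ.isSymmetricAlgebra hE).of_algEquiv e.symm, ⟨e⟩⟩,
      fun h => hΓ.not_isExcludedAlgebra (k := k) hE (h.of_algEquiv e)⟩
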